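/- Let $\ell\ge 3$ be an odd integer, $\xi=\exp(2\pi i/\ell)$ and $\xi^{x}=\exp(2\pi i x/\ell)$ for $x\in\mathbb{C}$. Let $a_{11}=2$, $a_{12}=a_{21}=-1$, $a_{22}=0$. Let $\mathcal{U}_\xi\mathfrak{sl}(2|1)$ be the complex superalgebra generated by $k_i^{\pm1},e_i,f_i$ ($i=1,2$), with $e_2,f_2$ odd and the other generators even, subject to $$k_1k_2=k_2k_1,\quad k_ik_i^{-1}=k_i^{-1}k_i=1,\quad k_ie_jk_i^{-1}=\xi^{a_{ij}}e_j,\quad k_if_jk_i^{-1}=\xi^{-a_{ij}}f_j,$$ $$e_1f_1-f_1e_1=\tfrac{k_1-k_1^{-1}}{\xi-\xi^{-1}},\quad e_2f_2+f_2e_2=\tfrac{k_2-k_2^{-1}}{\xi-\xi^{-1}},\quad e_1f_2=f_2e_1,\quad e_2f_1=f_1e_2,\quad e_2^2=f_2^2=0,$$ $$e_1^2e_2-(\xi+\xi^{-1})e_1e_2e_1+e_2e_1^2=0,\quad f_1^2f_2-(\xi+\xi^{-1})f_1f_2f_1+f_2f_1^2=0.$$ Let $\mathcal{U}^H_\xi\mathfrak{sl}(2|1)$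 be generated by $\mathcal{U}_\xi\mathfrak{sl}(2|1)$ and even elements $h_1,h_2$ with the additional relations $[h_i,e_j]=a_{ij}e_j$, $[h_i,f_j]=-a_{ij}f_j$, $[h_i,h_j]=0$, $[h_i,k_j]=0$. Let $\mathscr{C}^H$ be the category whose objects are the finite-dimensional $\mathbb{Z}/2$-graded $\mathcal{U}^H_\xi\mathfrak{sl}(2|1)$-modules on which $e_1^\ell=f_1^\ell=0$, $h_1,h_2$ are diagonalizable and $k_i=\xi^{h_i}$, and whose morphisms are the even (parity-preserving) module morphisms. Let $G=\mathbb{C}/\mathbb{Z}\times\mathbb{C}/\mathbb{Z}$; for $g\in G$ let $\mathscr{C}^H_g$ be the full subcategory of the modules all of whose weights (joint eigenvalues of $(h_1,h_2)$) lie in the coset $g$. A graded module is called irreducible if it is nonzero and has no graded submodules other than $0$ and itself. A module of $\mathscr{C}^H$ is typical if it is irreducible as a $\mathcal{U}_\xi\mathfrak{sl}(2|1)$-module and has dimension $4\ell$. Let $G_s$ be the set of $g\in G$ such that $\mathscr{C}^H_g$ contains an irreducible module that is not typical. A $\mathbb{C}$-linear category is called semisimple if every object is a finite (possibly empty) direct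 sum of simple objects, an object $V$ being simple if $\operatorname{End}(V)\cong\mathbb{C}$ as an algebra, and $\operatorname{Hom}(V,W)=0$ for any two non-isomorphic simple objects $V,W$. **Theorem.** (1) If $\mu=(\mu_1,\mu_2)\in\mathbb{C}^2$ has class $\overline\mu\in G\setminus G_s$, then $\mathscr{C}^H_{\overline\mu}$ is semisimple, and its simple objects are exactly its irreducible modules. Moreover the algebra $$\mathcal{A}=\mathcal{U}_\xi\mathfrak{sl}(2|1)/(e_1^\ell,\ f_1^\ell,\ k_1^\ell-\xi^{\ell\mu_1},\ k_2^\ell-\xi^{\ell\mu_2})$$ is isomorphic, as a $\mathbb{C}$-algebra, to the product of $\ell^2$ copies of the matrix algebra $M_{4\ell}(\mathbb{C})$. (2) Every typical module of $\mathscr{C}^H$ is a projective object of $\mathscr{C}^H$. -/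

import Mathlib

open CategoryTheory

namespace QuantumSl21

/-! ### Simple objects and semisimple `ℂ`-linear categories -/

section Semisimple

universe v u

variable {C : Type u} [Category.{v} C] [Preadditive C]

/-- `W` is a (finite, possibly empty) direct sum of the objects `S 0, …, S (n - 1)`. -/
def IsDirectSum (W : C) {n : ℕ} (S : Fin n → C) : Prop :=
  ∃ (f : ∀ i, S i ⟶ W) (g : ∀ i, W ⟶ S i),
    (∀ i, f i ≫ g i = 𝟙 (S i)) ∧ (∀ i j, i ≠ j → f i ≫ g j = 0) ∧ ∑ i, g i ≫ f i = 𝟙 W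

/-- `V` is simple: its endomorphism algebra is `ℂ`. -/
def IsSimpleObject [Linear ℂ C] (V : C) : Prop := Nonempty (End V ≃ₐ[ℂ] ℂ)

/-- Every object is a direct sum of simple objects, and there is no nonzero morphism between
non-isomorphic simple objects. -/
def IsSemisimpleCategory (C : Type u) [Category.{v} C] [Preadditive C] [Linear ℂ C] : Prop :=
  (∀ W : C, ∃ (n : ℕ) (S : Fin n → C), (∀ i, IsSimpleObject (S i)) ∧ IsDirectSum W S) ∧
  (∀ V W : C, IsSimpleObject V → IsSimpleObject W → IsEmpty (V ≅ W) → ∀ f : V ⟶ W, f = 0)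

end Semisimple

/-! ### The superalgebras -/

/-- `ξ ^ x = exp (2 π i x / ℓ)`. -/
noncomputable def xiPow (ℓ : ℕ) (x : ℂ) : ℂ :=
  Complex.exp (2 * (Real.pi : ℂ) * Complex.I * x / (ℓ : ℂ))

/-- `ξ = exp (2 π i / ℓ)`. -/
noncomputable def xi (ℓ : ℕ) : ℂ := xiPow ℓ 1

/-- The matrix `(a i j)`; the indices `0`, `1` of `Fin 2` stand for `1`, `2`. -/
def cartan : Matrix (Fin 2) (Fin 2) ℤ := !![2, -1; -1, 0]

/-- The generators `k i`, `(k i)⁻¹`, `e i`, `f i`. -/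
inductive Gen : Type
  | k (i : Fin 2)
  | kinv (i : Fin 2)
  | e (i : Fin 2)
  | f (i : Fin 2)

/-- The odd generators are `e 1` and `f 1` (that is, `e₂` and `f₂`). -/
def Gen.parity : Gen → ZMod 2
  | .k _ => 0
  | .kinv _ => 0
  | .e i => if i = 1 then 1 else 0
  | .f i => if i = 1 then 1 else 0

/-- The generators of the unrolled superalgebra: those above and `h i`. -/
inductive GenH : Type
  | base (x : Gen)
  | h (i : Fin 2)

/-- The `h i` are even. -/
def GenH.parity : GenH → ZMod 2
  | .base x => x.parity
  | .h _ => 0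


/-- The generators in the free algebra. -/
abbrev FreeGen.k (i : Fin 2) : FreeAlgebra ℂ Gen := FreeAlgebra.ι ℂ (Gen.k i)
abbrev FreeGen.kinv (i : Fin 2) : FreeAlgebra ℂ Gen := FreeAlgebra.ι ℂ (Gen.kinv i)
abbrev FreeGen.e (i : Fin 2) : FreeAlgebra ℂ Gen := FreeAlgebra.ι ℂ (Gen.e i)
abbrev FreeGen.f (i : Fin 2) : FreeAlgebra ℂ Gen := FreeAlgebra.ι ℂ (Gen.f i)

open FreeGen in
/-- The defining relations of `U_ξ sl(2|1)`. -/
inductive Rel (ℓ : ℕ) : FreeAlgebra ℂ Gen → FreeAlgebra ℂ Gen → Prop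
  | k_comm : Rel ℓ (k 0 * k 1) (k 1 * k 0)
  | k_kinv (i : Fin 2) : Rel ℓ (k i * kinv i) 1
  | kinv_k (i : Fin 2) : Rel ℓ (kinv i * k i) 1
  | k_e (i j : Fin 2) : Rel ℓ (k i * e j * kinv i) ((xi ℓ ^ cartan i j) • e j)
  | k_f (i j : Fin 2) : Rel ℓ (k i * f j * kinv i) ((xi ℓ ^ (-cartan i j)) • f j)
  | e_f_even : Rel ℓ (e 0 * f 0 - f 0 * e 0) ((xi ℓ - (xi ℓ)⁻¹)⁻¹ • (k 0 - kinv 0))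
  | e_f_odd : Rel ℓ (e 1 * f 1 + f 1 * e 1) ((xi ℓ - (xi ℓ)⁻¹)⁻¹ • (k 1 - kinv 1))
  | e0_f1 : Rel ℓ (e 0 * f 1 - f 1 * e 0) 0
  | e1_f0 : Rel ℓ (e 1 * f 0 - f 0 * e 1) 0
  | e_sq : Rel ℓ (e 1 ^ 2) 0
  | f_sq : Rel ℓ (f 1 ^ 2) 0
  | serre_e : Rel ℓ
      (e 0 ^ 2 * e 1 - (xi ℓ + (xi ℓ)⁻¹) • (e 0 * e 1 * e 0) + e 1 * e 0 ^ 2) 0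
  | serre_f : Rel ℓ
      (f 0 ^ 2 * f 1 - (xi ℓ + (xi ℓ)⁻¹) • (f 0 * f 1 * f 0) + f 1 * f 0 ^ 2) 0

/-- `U_ξ sl(2|1)`, as an associative `ℂ`-algebra. -/
abbrev U (ℓ : ℕ) : Type := RingQuot (Rel ℓ)

/-- The class of a generator in `U_ξ sl(2|1)`. -/
noncomputable def U.gen (ℓ : ℕ) (x : Gen) : U ℓ :=
  RingQuot.mkAlgHom ℂ (Rel ℓ) (FreeAlgebra.ι ℂ x)

/-- The inclusion of free algebras induced by the inclusion of generators. -/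
noncomputable def freeIncl : FreeAlgebra ℂ Gen →ₐ[ℂ] FreeAlgebra ℂ GenH :=
  FreeAlgebra.lift ℂ fun x => FreeAlgebra.ι ℂ (GenH.base x)

/-- The generators in the free algebra on `GenH`. -/
abbrev FreeGenH.k (i : Fin 2) : FreeAlgebra ℂ GenH := FreeAlgebra.ι ℂ (GenH.base (Gen.k i))
abbrev FreeGenH.e (i : Fin 2) : FreeAlgebra ℂ GenH := FreeAlgebra.ι ℂ (GenH.base (Gen.e i))
abbrev FreeGenH.f (i : Fin 2) : FreeAlgebra ℂ GenH := FreeAlgebra.ι ℂ (GenH.base (Gen.f i))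
abbrev FreeGenH.h (i : Fin 2) : FreeAlgebra ℂ GenH := FreeAlgebra.ι ℂ (GenH.h i)

open FreeGenH in
/-- The defining relations of `U_ξ^H sl(2|1)`. -/
inductive RelH (ℓ : ℕ) : FreeAlgebra ℂ GenH → FreeAlgebra ℂ GenH → Prop
  | base {a b : FreeAlgebra ℂ Gen} (r : Rel ℓ a b) : RelH ℓ (freeIncl a) (freeIncl b)
  | h_e (i j : Fin 2) : RelH ℓ (h i * e j - e j * h i) ((cartan i j : ℂ) • e j)
  | h_f (i j : Fin 2) : RelH ℓ (h i * f j - f j * h i) (-(cartan i j : ℂ) • f j)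
  | h_h (i j : Fin 2) : RelH ℓ (h i * h j - h j * h i) 0
  | h_k (i j : Fin 2) : RelH ℓ (h i * k j - k j * h i) 0

/-- `U_ξ^H sl(2|1)`, as an associative `ℂ`-algebra. -/
abbrev UH (ℓ : ℕ) : Type := RingQuot (RelH ℓ)

/-- The class of a generator in `U_ξ^H sl(2|1)`. -/
noncomputable def UH.gen (ℓ : ℕ) (x : GenH) : UH ℓ :=
  RingQuot.mkAlgHom ℂ (RelH ℓ) (FreeAlgebra.ι ℂ x)

/-- The canonical homomorphism `U_ξ sl(2|1) → U_ξ^H sl(2|1)`. -/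
noncomputable def incl (ℓ : ℕ) : U ℓ →ₐ[ℂ] UH ℓ :=
  RingQuot.liftAlgHom ℂ ⟨(RingQuot.mkAlgHom ℂ (RelH ℓ)).comp freeIncl, fun _ _ r => by
    simpa using RingQuot.mkAlgHom_rel ℂ (RelH.base r)⟩

theorem incl_gen (ℓ : ℕ) (x : Gen) : incl ℓ (U.gen ℓ x) = UH.gen ℓ (GenH.base x) := by
  simp [incl, U.gen, UH.gen, freeIncl]

/-- The `ℤ/2`-grading of an algebra given by generators of prescribed parity: the component of
degree `i` is spanned by the words in the generators whose parity is `i`. -/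
def superPart {X B : Type} [Ring B] [Algebra ℂ B] (par : X → ZMod 2) (gen : X → B)
    (i : ZMod 2) : Submodule ℂ B :=
  Submodule.span ℂ {b | ∃ w : List X, (w.map par).sum = i ∧ (w.map gen).prod = b}

/-- The superalgebra grading of `U_ξ sl(2|1)`. -/
noncomputable def U.part (ℓ : ℕ) : ZMod 2 → Submodule ℂ (U ℓ) := superPart Gen.parity (U.gen ℓ)

/-- The superalgebra grading of `U_ξ^H sl(2|1)`. -/
noncomputable def UH.part (ℓ : ℕ) : ZMod 2 → Submodule ℂ (UH ℓ) :=
  superPart GenH.parity (UH.gen ℓ)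

theorem incl_mem_part (ℓ : ℕ) {i : ZMod 2} {b : U ℓ} (hb : b ∈ U.part ℓ i) :
    incl ℓ b ∈ UH.part ℓ i := by
  refine Submodule.span_induction (p := fun b _ => incl ℓ b ∈ UH.part ℓ i) ?_ ?_ ?_ ?_ hb
  · rintro _ ⟨w, hw, rfl⟩
    refine Submodule.subset_span ⟨w.map GenH.base, ?_, ?_⟩
    · rw [← hw, List.map_map]; rfl
    · rw [map_list_prod, List.map_map, List.map_map]
      congr 1
      exact List.map_congr_left fun x _ => (incl_gen ℓ x).symm
  · simp
  · intro x y _ _ hx hy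
    rw [map_add]; exact add_mem hx hy
  · intro a x _ hx
    rw [map_smul]; exact Submodule.smul_mem _ a hx

/-! ### Supermodules -/

/-- A supermodule over the superalgebra `B = ⨁ i, P i`: a `ℤ/2`-graded complex vector space
with a representation `ρ` of `B` such that `P i` maps the component of degree `j` to that of
degree `i + j`. -/
structure SuperModule (B : Type) [Ring B] [Algebra ℂ B] (P : ZMod 2 → Submodule ℂ B) where
  carrier : Type
  [addCommGroup : AddCommGroup carrier]
  [module : Module ℂ carrier]
  /-- the action -/
  ρ : B →ₐ[ℂ] Module.End ℂ carrier
  /-- the even and odd parts -/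
  part : ZMod 2 → Submodule ℂ carrier
  isInternal : DirectSum.IsInternal part
  map_mem : ∀ (i j : ZMod 2) (b : B) (v : carrier), b ∈ P i → v ∈ part j → ρ b v ∈ part (i + j)

attribute [instance] SuperModule.addCommGroup SuperModule.module

namespace SuperModule

variable {B : Type} [Ring B] [Algebra ℂ B] {P : ZMod 2 → Submodule ℂ B}

/-- The space of even morphisms: parity preserving `ℂ`-linear maps that commute with `B`. -/
def homs (V W : SuperModule B P) : Submodule ℂ (V.carrier →ₗ[ℂ] W.carrier) where
  carrier := {f | (∀ b v, f (V.ρ b v) = W.ρ b (f v)) ∧ ∀ i, ∀ v ∈ V.part i, f v ∈ W.part i}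
  add_mem' hf hg := ⟨fun b v => by simp [hf.1, hg.1],
    fun i v hv => add_mem (hf.2 i v hv) (hg.2 i v hv)⟩
  zero_mem' := ⟨fun b v => by simp, fun i v _ => by simp⟩
  smul_mem' c f hf := ⟨fun b v => by simp [hf.1],
    fun i v hv => Submodule.smul_mem _ c (hf.2 i v hv)⟩

/-- The even category of supermodules. -/
instance : Category (SuperModule B P) where
  Hom V W := homs V W
  id V := ⟨LinearMap.id, fun _ _ => rfl, fun _ _ hv => hv⟩
  comp f g := ⟨g.1.comp f.1, fun b v => by simp [f.2.1, g.2.1],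
    fun i v hv => g.2.2 i _ (f.2.2 i v hv)⟩

instance : Preadditive (SuperModule B P) where
  homGroup V W := inferInstanceAs (AddCommGroup (homs V W))
  add_comp _ _ _ _ _ g := Subtype.ext (LinearMap.comp_add _ _ g.1)
  comp_add _ _ _ f _ _ := Subtype.ext (LinearMap.add_comp f.1 _ _)

instance : Linear ℂ (SuperModule B P) where
  homModule V W := inferInstanceAs (Module ℂ (homs V W))
  smul_comp _ _ _ r f g := Subtype.ext (LinearMap.comp_smul g.1 r f.1)
  comp_smul _ _ _ f r g := Subtype.ext (LinearMap.smul_comp r g.1 f.1)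

/-- `V` is irreducible: it is nonzero, and its only graded submodules are `0` and `V`. -/
def IsIrreducible (V : SuperModule B P) : Prop :=
  Nontrivial V.carrier ∧
    ∀ N : Submodule ℂ V.carrier,
      (∀ (b : B), ∀ v ∈ N, V.ρ b v ∈ N) →
      (∀ v ∈ N, ∃ v₀ ∈ N ⊓ V.part 0, ∃ v₁ ∈ N ⊓ V.part 1, v = v₀ + v₁) →
      N = ⊥ ∨ N = ⊤

end SuperModule

/-- Supermodules over `U_ξ sl(2|1)`. -/
abbrev UModule (ℓ : ℕ) := SuperModule (U ℓ) (U.part ℓ)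

/-- Supermodules over `U_ξ^H sl(2|1)`. -/
abbrev UHModule (ℓ : ℕ) := SuperModule (UH ℓ) (UH.part ℓ)

/-- A `U_ξ^H sl(2|1)`-module seen as a `U_ξ sl(2|1)`-module. -/
noncomputable def UHModule.restrict {ℓ : ℕ} (V : UHModule ℓ) : UModule ℓ where
  carrier := V.carrier
  ρ := V.ρ.comp (incl ℓ)
  part := V.part
  isInternal := V.isInternal
  map_mem i j b v hb hv := V.map_mem i j (incl ℓ b) v (incl_mem_part ℓ hb) hv

namespace UHModule

variable {ℓ : ℕ}

/-- The action of `k i`. -/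
noncomputable def k (V : UHModule ℓ) (i : Fin 2) : Module.End ℂ V.carrier :=
  V.ρ (UH.gen ℓ (GenH.base (Gen.k i)))

/-- The action of `e i`. -/
noncomputable def e (V : UHModule ℓ) (i : Fin 2) : Module.End ℂ V.carrier :=
  V.ρ (UH.gen ℓ (GenH.base (Gen.e i)))

/-- The action of `f i`. -/
noncomputable def f (V : UHModule ℓ) (i : Fin 2) : Module.End ℂ V.carrier :=
  V.ρ (UH.gen ℓ (GenH.base (Gen.f i)))

/-- The action of `h i`. -/
noncomputable def h (V : UHModule ℓ) (i : Fin 2) : Module.End ℂ V.carrier :=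
  V.ρ (UH.gen ℓ (GenH.h i))

/-- The objects of `𝒞^H`: finite dimensional nilpotent modules (`e₁ ^ ℓ = f₁ ^ ℓ = 0`) on which
the `h i` are diagonalizable with `k i = ξ ^ (h i)`. -/
structure IsNilpotentWeight (V : UHModule ℓ) : Prop where
  finite : FiniteDimensional ℂ V.carrier
  e_pow : V.e 0 ^ ℓ = 0
  f_pow : V.f 0 ^ ℓ = 0
  diagonalizable : ∀ i, ⨆ c : ℂ, (V.h i).eigenspace c = ⊤
  k_eq : ∀ (i : Fin 2) (c : ℂ) (v : V.carrier), V.h i v = c • v → V.k i v = xiPow ℓ c • v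

/-- `V` is typical: as a `U_ξ sl(2|1)`-module it is simple of dimension `4 ℓ`. -/
def IsTypical (V : UHModule ℓ) : Prop :=
  V.restrict.IsIrreducible ∧ Module.finrank ℂ V.carrier = 4 * ℓ

end UHModule

/-- The group `G = ℂ/ℤ × ℂ/ℤ`. -/
abbrev G : Type := Fin 2 → ℂ ⧸ AddSubgroup.zmultiples (1 : ℂ)

/-- The class of `μ ∈ ℂ²` in `G`. -/
def toG (μ : Fin 2 → ℂ) : G := fun i => QuotientAddGroup.mk (μ i)

/-- All weights `c` of `V` (joint eigenvalues of `h₁, h₂`) lie in the coset `g`. -/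
def UHModule.HasWeightsIn {ℓ : ℕ} (V : UHModule ℓ) (g : G) : Prop :=
  ∀ (c : Fin 2 → ℂ) (v : V.carrier), v ≠ 0 → (∀ i, V.h i v = c i • v) → toG c = g

/-- The category `𝒞^H`. -/
abbrev CH (ℓ : ℕ) := ObjectProperty.FullSubcategory fun V : UHModule ℓ => V.IsNilpotentWeight

/-- The graded piece `𝒞^H_g` of `𝒞^H`. -/
abbrev CHPiece (ℓ : ℕ) (g : G) :=
  ObjectProperty.FullSubcategory fun V : UHModule ℓ => V.IsNilpotentWeight ∧ V.HasWeightsIn g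

/-- The set `G_s` of those `g` for which `𝒞^H_g` contains a simple atypical module. -/
def Gs (ℓ : ℕ) : Set G := {g | ∃ V : CHPiece ℓ g, V.obj.IsIrreducible ∧ ¬ V.obj.IsTypical}

/-- The relations `e₁ ^ ℓ = f₁ ^ ℓ = 0` and `k i ^ ℓ = ξ ^ (ℓ μ i)` on `U_ξ sl(2|1)`. -/
inductive RelA (ℓ : ℕ) (μ : Fin 2 → ℂ) : U ℓ → U ℓ → Prop
  | e_pow : RelA ℓ μ (U.gen ℓ (Gen.e 0) ^ ℓ) 0
  | f_pow : RelA ℓ μ (U.gen ℓ (Gen.f 0) ^ ℓ) 0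
  | k_pow (i : Fin 2) :
      RelA ℓ μ (U.gen ℓ (Gen.k i) ^ ℓ) (algebraMap ℂ (U ℓ) (xiPow ℓ (ℓ * μ i)))

/-- The algebra `𝒜 = U_ξ sl(2|1) / (e₁ ^ ℓ, f₁ ^ ℓ, k₁ ^ ℓ - ξ ^ (ℓ μ₁), k₂ ^ ℓ - ξ ^ (ℓ μ₂))`. -/
abbrev A (ℓ : ℕ) (μ : Fin 2 → ℂ) : Type := RingQuot (RelA ℓ μ)

end QuantumSl21

/-! Write `e₃ = e₁ e₂ - ξ e₂ e₁` and `f₃` for the non-simple root vectors. The relations reduce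
words in the `e i` to the `4ℓ` monomials `e₂^a e₃^b e₁^n` with `a, b ≤ 1` and `n < ℓ`, and similarly
for the `f i`. Let `E` and `F` be the monomials of highest degree, `e₂ e₃ e₁^(ℓ-1)` and `f₂ f₃
f₁^(ℓ-1)`; the generators of the same sign kill them from both sides.

Everything rests on the element `E F`. Let `V` be typical with highest weight vector `v`. The `4ℓ`
monomials in the `f i` applied to `v` span a submodule, hence all of `V`, so they are linearly
independent and `F v ≠ 0`. Since `F v` is killed by the `f i`, the same argument with the `e i`
gives `E F v ≠ 0` (`topE_topF_ne_zero`).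

Projectivity. In any object, `E F` turns a weight vector into a highest weight vector of the same
weight, or into zero. Given `f : V ⟶ X` and a surjection `p : W ⟶ X`, lift `f v` to a weight vector
`w`. Then `E F w` lies over `f (E F v)`, and the submodule of `V ⊕ W` generated by `(E F v, E F w)`
has dimension at most `4ℓ` and maps onto `V`: it is the graph of a lift of `f` (`exists_hom`,
`exists_lift`).

Semisimplicity. Outside `G_s` every irreducible object is typical, so an irreducible quotient always
splits off. Induction on the dimension and Schur's lemma give the rest.

The algebra. Explicit Kac modules of dimension `4ℓ` are built for the `ℓ²` highest weights `μ + n`,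
`0 ≤ n i < ℓ`. An irreducible quotient of one is typical, so has the same dimension, and the Kac
module itself is typical. Multiplying `E F` by projectors built from powers of the `k i` gives an
element acting with rank one on a single chosen Kac module and by zero on the others. By a Burnside
argument `𝒜` maps onto the product of the `ℓ²` endomorphism algebras, while the triangular
decomposition bounds its dimension by `ℓ² (4ℓ)²`, so the map is bijective. -/

namespace QuantumSl21

/-! ### Subalgebras generated by simple root vectors -/

section Borel

/-- The relations between the simple root vectors of one sign in a quotient of `U_ξ sl(2|1)`
in which the `ℓ`-th power of the even one vanishes. -/
structure IsBorel (ℓ : ℕ) (q : ℂ) {B : Type} [Ring B] [Algebra ℂ B] (x : Fin 2 → B) : Prop where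
  ne_zero : q ≠ 0
  one_add_sq_ne_zero : 1 + q ^ 2 ≠ 0
  serre : x 0 ^ 2 * x 1 - (q + q⁻¹) • (x 0 * x 1 * x 0) + x 1 * x 0 ^ 2 = 0
  sq : x 1 * x 1 = 0
  pow : x 0 ^ ℓ = 0

/-- The non-simple root vector. -/
def rootVec (q : ℂ) {B : Type} [Ring B] [Algebra ℂ B] (x : Fin 2 → B) : B :=
  x 0 * x 1 - q • (x 1 * x 0)

/-- The ordered monomials in the odd root vectors. -/
def oddMonomial (q : ℂ) {B : Type} [Ring B] [Algebra ℂ B] (x : Fin 2 → B) : Fin 4 → B :=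
  ![1, x 1, rootVec q x, x 1 * rootVec q x]

/-- The ordered monomial of highest degree. -/
def topMonomial (ℓ : ℕ) (q : ℂ) {B : Type} [Ring B] [Algebra ℂ B] (x : Fin 2 → B) : B :=
  oddMonomial q x 3 * x 0 ^ (ℓ - 1)

namespace IsBorel

variable {ℓ : ℕ} {q : ℂ} {B : Type} [Ring B] [Algebra ℂ B] {x : Fin 2 → B}

theorem even_mul_odd : x 0 * x 1 = q • (x 1 * x 0) + rootVec q x := by
  simp [rootVec]

theorem even_mul_rootVec (hx : IsBorel ℓ q x) : x 0 * rootVec q x = q⁻¹ • (rootVec q x * x 0) := by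
  have h := hx.serre
  have hq := hx.ne_zero
  rw [← sub_eq_zero, ← h]
  simp only [rootVec, mul_sub, sub_mul, smul_sub, mul_smul_comm, smul_mul_assoc, smul_smul,
    inv_mul_cancel₀ hq, one_smul, add_smul, pow_two, mul_assoc]
  abel

theorem rootVec_mul_odd (hx : IsBorel ℓ q x) : rootVec q x * x 1 = -(q • (x 1 * rootVec q x)) := by
  have h := hx.sq
  have h2 : ∀ b : B, x 1 * (x 1 * b) = 0 := fun b => by rw [← mul_assoc, h, zero_mul]
  simp only [rootVec, mul_sub, sub_mul, smul_sub, mul_smul_comm, smul_mul_assoc,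
    mul_assoc, h, h2, mul_zero, smul_zero]
  abel

/-- With `y` the root vector and `D = x 0 * x 1 * y - x 1 * y * x 0`, expanding the left factor of
`y * y` gives `D`, and expanding the right factor gives `-q² D`. Hence `(1 + q²) y² = 0`. -/
theorem rootVec_mul_self (hx : IsBorel ℓ q x) : rootVec q x * rootVec q x = 0 := by
  have h1 := hx.even_mul_rootVec
  have h2 := hx.rootVec_mul_odd
  have hq := hx.ne_zero
  set y := rootVec q x
  have e1 : y * y = x 0 * x 1 * y - x 1 * y * x 0 := by
    have h0 : y * y = (x 0 * x 1 - q • (x 1 * x 0)) * y := rfl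
    rw [h0, sub_mul, smul_mul_assoc, mul_assoc (x 1), h1, mul_smul_comm, smul_smul,
      mul_inv_cancel₀ hq, one_smul, ← mul_assoc (x 1)]
  have e2 : y * y = -((q ^ 2) • (x 0 * x 1 * y - x 1 * y * x 0)) := by
    have h1' : y * x 0 = q • (x 0 * y) := by rw [h1, smul_smul, mul_inv_cancel₀ hq, one_smul]
    have h0 : y * y = y * (x 0 * x 1 - q • (x 1 * x 0)) := rfl
    rw [h0, mul_sub, mul_smul_comm, ← mul_assoc, ← mul_assoc, h1', h2, smul_mul_assoc,
      mul_assoc, h2]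
    simp only [mul_neg, mul_smul_comm, neg_mul, smul_mul_assoc, smul_neg, smul_sub, smul_smul,
      mul_assoc, pow_two]
    abel
  have e3 : (1 + q ^ 2) • (y * y) = 0 := by
    rw [add_smul, one_smul]
    nth_rewrite 1 [e2]
    rw [e1]; abel
  exact (smul_eq_zero.1 e3).resolve_left hx.one_add_sq_ne_zero

theorem even_mul_odd_rootVec (hx : IsBorel ℓ q x) :
    x 0 * (x 1 * rootVec q x) = x 1 * rootVec q x * x 0 := by
  rw [← mul_assoc, even_mul_odd, add_mul, hx.rootVec_mul_self, add_zero, smul_mul_assoc,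
    mul_assoc (x 1), hx.even_mul_rootVec, mul_smul_comm, smul_smul, mul_inv_cancel₀ hx.ne_zero,
    one_smul, mul_assoc]

theorem even_mul_topMonomial (hx : IsBorel ℓ q x) (hℓ : 1 ≤ ℓ) :
    x 0 * topMonomial ℓ q x = 0 := by
  have : x 0 * (x 1 * rootVec q x) = x 1 * rootVec q x * x 0 := hx.even_mul_odd_rootVec
  simp only [topMonomial, oddMonomial, Matrix.cons_val]
  rw [← mul_assoc, this, mul_assoc, ← pow_succ', Nat.sub_add_cancel hℓ, hx.pow, mul_zero]

theorem odd_mul_topMonomial (hx : IsBorel ℓ q x) : x 1 * topMonomial ℓ q x = 0 := by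
  simp only [topMonomial, oddMonomial, Matrix.cons_val]
  rw [← mul_assoc, ← mul_assoc, hx.sq, zero_mul, zero_mul]

theorem topMonomial_mul_even (hx : IsBorel ℓ q x) (hℓ : 1 ≤ ℓ) :
    topMonomial ℓ q x * x 0 = 0 := by
  rw [topMonomial, mul_assoc, ← pow_succ, Nat.sub_add_cancel hℓ, hx.pow, mul_zero]

/-- The product of the two odd root vectors commutes with `x 0`, so it can be moved to the right
end, where `x 1` passes `rootVec q x` up to a scalar and meets the other `x 1`. -/
theorem topMonomial_mul_odd (hx : IsBorel ℓ q x) : topMonomial ℓ q x * x 1 = 0 := by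
  have h : Commute (x 0) (x 1 * rootVec q x) := hx.even_mul_odd_rootVec
  have h2 := (h.pow_left (ℓ - 1)).eq
  simp only [topMonomial, oddMonomial, Matrix.cons_val]
  rw [← h2, mul_assoc, mul_assoc, hx.rootVec_mul_odd, mul_neg, mul_smul_comm, ← mul_assoc (x 1),
    hx.sq, zero_mul, smul_zero, neg_zero, mul_zero]

end IsBorel

/-! ### Spans of ordered monomials: stability and dimension -/

variable {M : Type} [AddCommGroup M] [Module ℂ M]

/-- The span of the ordered monomials applied to the vectors of `Z`. -/
def monomialSpan (ℓ : ℕ) (q : ℂ) (x : Fin 2 → Module.End ℂ M) (Z : Submodule ℂ M) :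
    Submodule ℂ M :=
  ⨆ p : Fin 4 × Fin ℓ, Z.map (oddMonomial q x p.1 * x 0 ^ (p.2 : ℕ))

variable {ℓ : ℕ} {q : ℂ} {x : Fin 2 → Module.End ℂ M} {Z : Submodule ℂ M}

theorem monomialSpan_le {P : Submodule ℂ M} (hZ : Z ≤ P) (hP : ∀ j, ∀ v ∈ P, x j v ∈ P) :
    monomialSpan ℓ q x Z ≤ P := by
  have hpow : ∀ (n : ℕ), ∀ v ∈ P, (x 0 ^ n) v ∈ P := by
    intro n
    induction n with
    | zero => intro v hv; simpa using hv
    | succ n ih => intro v hv; rw [pow_succ', Module.End.mul_apply]; exact hP _ _ (ih v hv)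
  have hr : ∀ v ∈ P, rootVec q x v ∈ P := fun v hv => by
    simp only [rootVec, LinearMap.sub_apply, Module.End.mul_apply, LinearMap.smul_apply]
    exact sub_mem (hP _ _ (hP _ _ hv)) (P.smul_mem _ (hP _ _ (hP _ _ hv)))
  refine iSup_le fun ⟨j, a⟩ => ?_
  rintro _ ⟨z, hz, rfl⟩
  rw [Module.End.mul_apply]
  have hz' := hpow a z (hZ hz)
  fin_cases j
  · simpa [oddMonomial] using hz'
  · exact hP _ _ hz'
  · exact hr _ hz'
  · exact hP _ _ (hr _ hz')

/-- Frees later arguments from the bound on the exponent: powers from `ℓ` on vanish. -/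
theorem IsBorel.mem_monomialSpan (hx : IsBorel ℓ q x) (j : Fin 4) (n : ℕ) {z : M} (hz : z ∈ Z) :
    oddMonomial q x j ((x 0 ^ n) z) ∈ monomialSpan ℓ q x Z := by
  by_cases hn : n < ℓ
  · exact Submodule.mem_iSup_of_mem (j, ⟨n, hn⟩) ⟨z, hz, rfl⟩
  · rw [← Nat.sub_add_cancel (not_lt.1 hn), pow_add, hx.pow]
    simp

theorem IsBorel.le_monomialSpan (hx : IsBorel ℓ q x) : Z ≤ monomialSpan ℓ q x Z := fun z hz => by
  simpa [oddMonomial] using hx.mem_monomialSpan 0 0 hz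

/-- This is the spanning half of a PBW theorem: `x 0` passes the odd factors up to scalars and a
correction that is again an ordered monomial, while `x 1` on the left either completes an odd
monomial or kills it. -/
theorem IsBorel.monomialSpan_stable (hx : IsBorel ℓ q x) (j : Fin 2) {v : M}
    (hv : v ∈ monomialSpan ℓ q x Z) : x j v ∈ monomialSpan ℓ q x Z := by
  suffices h : monomialSpan ℓ q x Z ≤ (monomialSpan ℓ q x Z).comap (x j) from h hv
  refine iSup_le fun ⟨i, a⟩ => ?_
  rintro _ ⟨z, hz, rfl⟩
  have key : ∀ (n : ℕ) (w : M), x 0 ((x 0 ^ n) w) = (x 0 ^ (n + 1)) w := fun n w => by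
    rw [pow_succ']; rfl
  have m (i : Fin 4) (n : ℕ) := hx.mem_monomialSpan i n hz
  have m0 := m 0 (a + 1)
  have m1 := m 1 (a + 1)
  have m2 := m 2 (a + 1)
  have m3 := m 3 (a + 1)
  have n1 := m 1 a
  have n2 := m 2 a
  have n3 := m 3 a
  set S := monomialSpan ℓ q x Z
  simp only [oddMonomial, Matrix.cons_val, ← key, Module.End.one_apply] at m0 m1 m2 m3 n1 n2 n3
  rw [Submodule.mem_comap, Module.End.mul_apply]
  simp only
  set w := (x 0 ^ (a : ℕ)) z
  have sq (v : M) : x 1 (x 1 v) = 0 := LinearMap.congr_fun hx.sq v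
  have r1 (v : M) : x 0 (x 1 v) = q • x 1 (x 0 v) + rootVec q x v :=
    LinearMap.congr_fun (IsBorel.even_mul_odd (q := q) (x := x)) v
  have r2 (v : M) : x 0 (rootVec q x v) = q⁻¹ • rootVec q x (x 0 v) :=
    LinearMap.congr_fun hx.even_mul_rootVec v
  have r3 (v : M) : x 0 (x 1 (rootVec q x v)) = x 1 (rootVec q x (x 0 v)) :=
    LinearMap.congr_fun hx.even_mul_odd_rootVec v
  obtain rfl | rfl : j = 0 ∨ j = 1 := by omega
  · fin_cases i
    · exact m0
    · change x 0 (x 1 w) ∈ S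
      rw [r1]
      exact add_mem (S.smul_mem _ m1) n2
    · change x 0 (rootVec q x w) ∈ S
      rw [r2]
      exact S.smul_mem _ m2
    · change x 0 (x 1 (rootVec q x w)) ∈ S
      rw [r3]
      exact m3
  · fin_cases i
    · exact n1
    · change x 1 (x 1 w) ∈ S
      rw [sq]; exact S.zero_mem
    · exact n3
    · change x 1 (x 1 (rootVec q x w)) ∈ S
      rw [sq]; exact S.zero_mem

/-- Stability of the span of monomials under an operator that commutes with the root vectors up to
scalars and to terms in the root vectors themselves. -/
theorem IsBorel.monomialSpan_stable_of_commute (hx : IsBorel ℓ q x) (T : Module.End ℂ M)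
    (a b : Fin 2 → ℂ) (hT : ∀ j, T * x j = a j • (x j * T) + b j • x j)
    (hZ : ∀ z ∈ Z, T z ∈ Z) {v : M} (hv : v ∈ monomialSpan ℓ q x Z) :
    T v ∈ monomialSpan ℓ q x Z := by
  -- The intersection is needed for the induction: the rule for `T (x j v)` involves both `x j (T
  -- v)` and `x j v`, so both `v` and `T v` must be known to lie in the span.
  suffices h : monomialSpan ℓ q x Z ≤
      monomialSpan ℓ q x Z ⊓ (monomialSpan ℓ q x Z).comap T from (h hv).2
  refine monomialSpan_le (fun z hz => ⟨hx.le_monomialSpan hz, hx.le_monomialSpan (hZ z hz)⟩) ?_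
  rintro j v ⟨h1, h2⟩
  refine ⟨hx.monomialSpan_stable j h1, ?_⟩
  have := LinearMap.congr_fun (hT j) v
  simp only [Module.End.mul_apply, LinearMap.add_apply, LinearMap.smul_apply] at this
  change T (x j v) ∈ monomialSpan ℓ q x Z
  rw [this]
  exact add_mem (Submodule.smul_mem _ _ (hx.monomialSpan_stable j h2))
    (Submodule.smul_mem _ _ (hx.monomialSpan_stable j h1))

/-- Stability of the span of monomials under root vectors of the opposite sign. -/
theorem IsBorel.monomialSpan_stable_of_opposite (hx : IsBorel ℓ q x)
    (y : Module.End ℂ M) (a : Fin 2 → ℂ) (d : Fin 2 → Module.End ℂ M)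
    (hy : ∀ j, y * x j = a j • (x j * y) + d j)
    (hd : ∀ j, ∀ v ∈ monomialSpan ℓ q x Z, d j v ∈ monomialSpan ℓ q x Z)
    (hZ : ∀ z ∈ Z, y z ∈ Z) {v : M} (hv : v ∈ monomialSpan ℓ q x Z) :
    y v ∈ monomialSpan ℓ q x Z := by
  suffices h : monomialSpan ℓ q x Z ≤
      monomialSpan ℓ q x Z ⊓ (monomialSpan ℓ q x Z).comap y from (h hv).2
  refine monomialSpan_le (fun z hz => ⟨hx.le_monomialSpan hz, hx.le_monomialSpan (hZ z hz)⟩) ?_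
  rintro j v ⟨h1, h2⟩
  refine ⟨hx.monomialSpan_stable j h1, ?_⟩
  have := LinearMap.congr_fun (hy j) v
  simp only [Module.End.mul_apply, LinearMap.add_apply, LinearMap.smul_apply] at this
  change y (x j v) ∈ monomialSpan ℓ q x Z
  rw [this]
  exact add_mem (Submodule.smul_mem _ _ (hx.monomialSpan_stable j h2)) (hd j v h1)

theorem finrank_iSup_le {ι : Type} [Fintype ι] (N : ι → Submodule ℂ M) (d : ℕ)
    (hf : ∀ i, FiniteDimensional ℂ (N i)) (hN : ∀ i, Module.finrank ℂ (N i) ≤ d) :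
    Module.finrank ℂ (⨆ i, N i : Submodule ℂ M) ≤ Fintype.card ι * d := by
  classical
  have : ∀ s : Finset ι, Module.finrank ℂ (s.sup N : Submodule ℂ M) ≤ s.card * d := by
    intro s
    induction s using Finset.induction_on with
    | empty => simp
    | insert i s hi ih =>
      rw [Finset.sup_insert, Finset.card_insert_of_notMem hi, add_mul, one_mul, add_comm]
      exact (Submodule.finrank_add_le_finrank_add_finrank _ _).trans (add_le_add (hN i) ih)
  rw [← Finset.sup_univ_eq_iSup]
  exact this _

instance [hZ : FiniteDimensional ℂ Z] : FiniteDimensional ℂ (monomialSpan ℓ q x Z) := by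
  unfold monomialSpan; infer_instance

theorem finrank_monomialSpan_le [FiniteDimensional ℂ Z] :
    Module.finrank ℂ (monomialSpan ℓ q x Z) ≤ 4 * ℓ * Module.finrank ℂ Z := by
  have := finrank_iSup_le (fun p : Fin 4 × Fin ℓ =>
    Z.map (oddMonomial q x p.1 * x 0 ^ (p.2 : ℕ))) (Module.finrank ℂ Z)
    (fun _ => inferInstance) (fun _ => Submodule.finrank_map_le _ _)
  rw [monomialSpan]
  simpa only [Fintype.card_prod, Fintype.card_fin] using this

/-- If the `4 ℓ` ordered monomials applied to `v` span a space of dimension `4 ℓ`, then the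
highest one does not kill `v`. -/
theorem topMonomial_ne_zero (hℓ : 1 ≤ ℓ) {v : M}
    (h : 4 * ℓ ≤ Module.finrank ℂ (monomialSpan ℓ q x (ℂ ∙ v))) : topMonomial ℓ q x v ≠ 0 := by
  intro h0
  have hs : monomialSpan ℓ q x (ℂ ∙ v) = Submodule.span ℂ (Set.range fun p : Fin 4 × Fin ℓ =>
      (oddMonomial q x p.1 * x 0 ^ (p.2 : ℕ)) v) := by
    simp only [monomialSpan, Submodule.map_span, Set.image_singleton, Submodule.span_range_eq_iSup]
  have hli : LinearIndependent ℂ fun p : Fin 4 × Fin ℓ =>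
      (oddMonomial q x p.1 * x 0 ^ (p.2 : ℕ)) v := by
    rw [linearIndependent_iff_card_le_finrank_span]
    rw [Set.finrank, ← hs]
    simpa using h
  exact hli.ne_zero ((3, ⟨ℓ - 1, by omega⟩) : Fin 4 × Fin ℓ) h0

end Borel

/-! ### Supermodules in terms of the parity involution -/

section Parity

/-- The sign `(-1) ^ i`. -/
def sgn (i : ZMod 2) : ℂ := if i = 0 then 1 else -1

@[simp] theorem sgn_zero : sgn 0 = 1 := rfl

@[simp] theorem sgn_one : sgn 1 = -1 := by simp [sgn]

theorem zmod_two_eq (i : ZMod 2) : i = 0 ∨ i = 1 := by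
  revert i; decide

theorem sgn_add (i j : ZMod 2) : sgn (i + j) = sgn i * sgn j := by
  have h : (1 + 1 : ZMod 2) = 0 := rfl
  obtain rfl | rfl := zmod_two_eq i <;> obtain rfl | rfl := zmod_two_eq j <;> simp [h]

/-- An operator that commutes up to sign with the generators does so with all homogeneous
elements. -/
theorem sgn_commute_of_mem_superPart {X B C : Type} [Ring B] [Algebra ℂ B] [Ring C] [Algebra ℂ C]
    {par : X → ZMod 2} {gen : X → B} (ρ : B →ₐ[ℂ] C) (s : C)
    (h : ∀ x, s * ρ (gen x) = sgn (par x) • (ρ (gen x) * s)) {i : ZMod 2} {b : B}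
    (hb : b ∈ superPart par gen i) : s * ρ b = sgn i • (ρ b * s) := by
  refine Submodule.span_induction (p := fun b _ => s * ρ b = sgn i • (ρ b * s)) ?_ ?_ ?_ ?_ hb
  · rintro _ ⟨w, hw, rfl⟩
    subst hw
    clear hb
    induction w with
    | nil => simp
    | cons x w ih =>
      simp only [List.map_cons, List.sum_cons, List.prod_cons, map_mul] at ih ⊢
      rw [← mul_assoc, h, smul_mul_assoc, mul_assoc, ih, mul_smul_comm, smul_smul, sgn_add,
        mul_assoc]
  · simp
  · intro x y _ _ hx hy
    rw [map_add, mul_add, hx, hy, add_mul, smul_add]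
  · intro a x _ hx
    rw [map_smul, mul_smul_comm, hx, smul_mul_assoc, smul_comm]

theorem gen_mem_superPart {X B : Type} [Ring B] [Algebra ℂ B]
    (par : X → ZMod 2) (gen : X → B) (x : X) : gen x ∈ superPart par gen (par x) :=
  Submodule.subset_span ⟨[x], by simp, by simp⟩

/-- A subspace stable under generators is stable under the algebra they generate. -/
theorem stable_of_adjoin {B M : Type} [Ring B] [Algebra ℂ B] [AddCommGroup M] [Module ℂ M]
    {s : Set B} (hs : Algebra.adjoin ℂ s = ⊤) (ρ : B →ₐ[ℂ] Module.End ℂ M) {N : Submodule ℂ M}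
    (h : ∀ b ∈ s, ∀ v ∈ N, ρ b v ∈ N) (b : B) : ∀ v ∈ N, ρ b v ∈ N := by
  have hb : b ∈ Algebra.adjoin ℂ s := hs ▸ Algebra.mem_top
  induction hb using Algebra.adjoin_induction with
  | mem x hx => exact h x hx
  | algebraMap r => intro v hv; simpa [Module.algebraMap_end_apply] using N.smul_mem r hv
  | add x y _ _ hx hy => intro v hv; simpa using add_mem (hx v hv) (hy v hv)
  | mul x y _ _ hx hy => intro v hv; simpa using hx _ (hy v hv)

theorem adjoin_range_mkAlgHom {X : Type} (r : FreeAlgebra ℂ X → FreeAlgebra ℂ X → Prop) :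
    Algebra.adjoin ℂ (Set.range fun x => RingQuot.mkAlgHom ℂ r (FreeAlgebra.ι ℂ x)) = ⊤ := by
  have := AlgHom.map_adjoin (RingQuot.mkAlgHom ℂ r) (Set.range (FreeAlgebra.ι ℂ))
  rw [FreeAlgebra.adjoin_range_ι, ← Set.range_comp] at this
  rw [← Function.comp_def, ← this, Algebra.map_top]
  exact (AlgHom.range_eq_top _).2 (RingQuot.mkAlgHom_surjective ℂ r)

theorem U.adjoin_gen (ℓ : ℕ) : Algebra.adjoin ℂ (Set.range (U.gen ℓ)) = ⊤ :=
  adjoin_range_mkAlgHom _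

theorem UH.adjoin_gen (ℓ : ℕ) : Algebra.adjoin ℂ (Set.range (UH.gen ℓ)) = ⊤ :=
  adjoin_range_mkAlgHom _

end Parity

/-! ### The parity involution, graded submodules and quotients -/

namespace SuperModule

variable {B : Type} [Ring B] [Algebra ℂ B] {P : ZMod 2 → Submodule ℂ B}

theorem isCompl_part (V : SuperModule B P) : IsCompl (V.part 0) (V.part 1) :=
  (DirectSum.isInternal_submodule_iff_isCompl V.part (i := 0) (j := 1) (by decide)
    (by ext i; simpa using (zmod_two_eq i))).1 V.isInternal

/-- The parity involution. -/
noncomputable def sigma (V : SuperModule B P) : Module.End ℂ V.carrier :=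
  (V.part 0).subtype ∘ₗ (V.part 0).projectionOnto (V.part 1) V.isCompl_part -
    (V.part 1).subtype ∘ₗ (V.part 1).projectionOnto (V.part 0) V.isCompl_part.symm

theorem sigma_of_mem (V : SuperModule B P) {i : ZMod 2} {v : V.carrier} (hv : v ∈ V.part i) :
    V.sigma v = sgn i • v := by
  obtain rfl | rfl := zmod_two_eq i
  · have h1 := Submodule.projectionOnto_apply_left V.isCompl_part ⟨v, hv⟩
    have h2 := Submodule.projectionOnto_apply_right V.isCompl_part.symm ⟨v, hv⟩
    simp only at h1 h2
    simp [sigma, h1, h2]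
  · have h1 := Submodule.projectionOnto_apply_left V.isCompl_part.symm ⟨v, hv⟩
    have h2 := Submodule.projectionOnto_apply_right V.isCompl_part ⟨v, hv⟩
    simp only at h1 h2
    simp [sigma, h1, h2]

theorem exists_add (V : SuperModule B P) (v : V.carrier) :
    ∃ v₀ ∈ V.part 0, ∃ v₁ ∈ V.part 1, v = v₀ + v₁ := by
  have : v ∈ V.part 0 ⊔ V.part 1 := V.isCompl_part.sup_eq_top ▸ Submodule.mem_top
  obtain ⟨a, ha, b, hb, h⟩ := Submodule.mem_sup.1 this
  exact ⟨a, ha, b, hb, h.symm⟩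

theorem sigma_sigma (V : SuperModule B P) (v : V.carrier) : V.sigma (V.sigma v) = v := by
  obtain ⟨a, ha, b, hb, rfl⟩ := V.exists_add v
  simp [V.sigma_of_mem ha, V.sigma_of_mem hb]

/-- Encodes the grading in one diagonalizable operator. Gradedness of submodules and evenness of
maps then become compatibility with `sigma`, treated in the same way as the operators `h i`. -/
theorem mem_part_iff (V : SuperModule B P) {i : ZMod 2} {v : V.carrier} :
    v ∈ V.part i ↔ V.sigma v = sgn i • v := by
  refine ⟨V.sigma_of_mem, fun h => ?_⟩
  obtain ⟨a, ha, b, hb, rfl⟩ := V.exists_add v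
  rw [map_add, V.sigma_of_mem ha, V.sigma_of_mem hb] at h
  obtain rfl | rfl := zmod_two_eq i
  · have : (2 : ℂ) • b = 0 := by
      simp only [sgn_zero, sgn_one, one_smul, neg_smul] at h
      rw [two_smul]
      have := congrArg (fun t => a + b - t) h
      simpa using this
    rw [(smul_eq_zero.1 this).resolve_left two_ne_zero, add_zero]
    exact ha
  · have : (2 : ℂ) • a = 0 := by
      simp only [sgn_zero, sgn_one, one_smul, neg_smul] at h
      rw [two_smul]
      rw [← neg_add_cancel (a + b), ← h]; abel
    rw [(smul_eq_zero.1 this).resolve_left two_ne_zero, zero_add]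
    exact hb

theorem sigma_mul_rho (V : SuperModule B P) {i : ZMod 2} {b : B} (hb : b ∈ P i) :
    V.sigma * V.ρ b = sgn i • (V.ρ b * V.sigma) := by
  ext v
  have key (j : ZMod 2) (w : V.carrier) (hw : w ∈ V.part j) :
      V.sigma (V.ρ b w) = sgn i • V.ρ b (V.sigma w) := by
    rw [V.sigma_of_mem (V.map_mem i j b w hb hw), V.sigma_of_mem hw, map_smul, smul_smul, sgn_add]
  obtain ⟨a, ha, c, hc, rfl⟩ := V.exists_add v
  simp only [Module.End.mul_apply, LinearMap.smul_apply, map_add, key _ _ ha,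
    key _ _ hc]

theorem mem_homs_iff {V W : SuperModule B P} {f : V.carrier →ₗ[ℂ] W.carrier} :
    f ∈ homs V W ↔ (∀ b v, f (V.ρ b v) = W.ρ b (f v)) ∧ ∀ v, f (V.sigma v) = W.sigma (f v) := by
  refine ⟨fun h => ⟨h.1, fun v => ?_⟩, fun h => ⟨h.1, fun i v hv => ?_⟩⟩
  · obtain ⟨a, ha, b, hb, rfl⟩ := V.exists_add v
    simp [V.sigma_of_mem ha, V.sigma_of_mem hb, W.sigma_of_mem (h.2 _ _ ha),
      W.sigma_of_mem (h.2 _ _ hb)]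
  · rw [mem_part_iff] at hv ⊢
    rw [← h.2, hv, map_smul]

/-- The homogeneous components of `v` are `(v ± σ v) / 2`, so a subspace contains them along with
`v` exactly when it is stable under `σ`. -/
theorem isIrreducible_iff (V : SuperModule B P) :
    V.IsIrreducible ↔ Nontrivial V.carrier ∧ ∀ N : Submodule ℂ V.carrier,
      (∀ (b : B), ∀ v ∈ N, V.ρ b v ∈ N) → (∀ v ∈ N, V.sigma v ∈ N) → N = ⊥ ∨ N = ⊤ := by
  have key (N : Submodule ℂ V.carrier) : (∀ v ∈ N, V.sigma v ∈ N) ↔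
      (∀ v ∈ N, ∃ v₀ ∈ N ⊓ V.part 0, ∃ v₁ ∈ N ⊓ V.part 1, v = v₀ + v₁) := by
    constructor
    · intro h v hv
      refine ⟨(2⁻¹ : ℂ) • (v + V.sigma v), ⟨N.smul_mem _ (add_mem hv (h v hv)), ?_⟩,
        (2⁻¹ : ℂ) • (v - V.sigma v), ⟨N.smul_mem _ (sub_mem hv (h v hv)), ?_⟩, ?_⟩
      · change _ ∈ V.part 0
        rw [mem_part_iff]
        simp [sigma_sigma, add_comm]
      · change _ ∈ V.part 1
        rw [mem_part_iff, map_smul, map_sub, sigma_sigma, sgn_one, neg_one_smul, ← smul_neg,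
          neg_sub]
      · rw [← smul_add, add_add_sub_cancel, ← two_smul ℂ v, smul_smul, inv_mul_cancel₀ two_ne_zero,
          one_smul]
    · intro h v hv
      obtain ⟨a, ha, b, hb, rfl⟩ := h v hv
      rw [map_add, V.sigma_of_mem ha.2, V.sigma_of_mem hb.2]
      exact add_mem (N.smul_mem _ ha.1) (N.smul_mem _ hb.1)
  simp only [IsIrreducible, key]

/-- The supermodule given by a representation and a parity involution. -/
abbrev ofInvolution {M : Type} [AddCommGroup M] [Module ℂ M] (ρ : B →ₐ[ℂ] Module.End ℂ M)
    (s : Module.End ℂ M) (hs : ∀ v, s (s v) = v)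
    (h : ∀ (i : ZMod 2) (b : B), b ∈ P i → s * ρ b = sgn i • (ρ b * s)) : SuperModule B P where
  carrier := M
  ρ := ρ
  part i := s.eigenspace (sgn i)
  isInternal := by
    refine (DirectSum.isInternal_submodule_iff_isCompl _ (i := 0) (j := 1) (by decide)
      (by ext i; simpa using (zmod_two_eq i))).2 ⟨?_, ?_⟩
    · exact Module.End.disjoint_genEigenspace _ (by norm_num) _ _
    · rw [codisjoint_iff, Submodule.eq_top_iff']
      intro v
      refine Submodule.mem_sup.2 ⟨(2⁻¹ : ℂ) • (v + s v), ?_, (2⁻¹ : ℂ) • (v - s v), ?_, ?_⟩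
      · rw [Module.End.mem_eigenspace_iff]
        simp [hs, add_comm]
      · rw [Module.End.mem_eigenspace_iff, map_smul, map_sub, hs, sgn_one, neg_one_smul, ← smul_neg,
          neg_sub]
      · rw [← smul_add, add_add_sub_cancel, ← two_smul ℂ v, smul_smul, inv_mul_cancel₀ two_ne_zero,
          one_smul]
  map_mem i j b v hb hv := by
    rw [Module.End.mem_eigenspace_iff] at hv ⊢
    have := LinearMap.congr_fun (h i b hb) v
    simp only [Module.End.mul_apply, LinearMap.smul_apply] at this
    rw [this, hv, map_smul, smul_smul, sgn_add]

theorem sigma_eq (V : SuperModule B P) (s : Module.End ℂ V.carrier)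
    (hs : ∀ i, ∀ v ∈ V.part i, s v = sgn i • v) : V.sigma = s := by
  refine LinearMap.ext fun v => ?_
  obtain ⟨a, ha, b, hb, rfl⟩ := V.exists_add v
  rw [map_add, map_add, sigma_of_mem _ ha, sigma_of_mem _ hb, hs _ _ ha, hs _ _ hb]

theorem sigma_ofInvolution {M : Type} [AddCommGroup M] [Module ℂ M] (ρ : B →ₐ[ℂ] Module.End ℂ M)
    (s : Module.End ℂ M) (hs : ∀ v, s (s v) = v)
    (h : ∀ (i : ZMod 2) (b : B), b ∈ P i → s * ρ b = sgn i • (ρ b * s)) :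
    (ofInvolution (P := P) ρ s hs h).sigma = s :=
  sigma_eq _ _ fun _ _ hv => Module.End.mem_eigenspace_iff.1 hv

/-- The representation on the quotient by a stable subspace. -/
def quotientRep {M : Type} [AddCommGroup M] [Module ℂ M] (ρ : B →ₐ[ℂ] Module.End ℂ M)
    (N : Submodule ℂ M) (hN : ∀ (b : B), ∀ v ∈ N, ρ b v ∈ N) : B →ₐ[ℂ] Module.End ℂ (M ⧸ N) where
  toFun b := N.mapQ N (ρ b) (hN b)
  map_one' := by ext v; simp
  map_mul' a b := by ext v; simp
  map_zero' := by ext v; simp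
  map_add' a b := by ext v; simp
  commutes' r := by ext v; simp [Module.algebraMap_end_apply]

/-- The quotient of a supermodule by a graded submodule. -/
noncomputable def quotient (V : SuperModule B P) (N : Submodule ℂ V.carrier)
    (hN : ∀ (b : B), ∀ v ∈ N, V.ρ b v ∈ N) (hs : ∀ v ∈ N, V.sigma v ∈ N) : SuperModule B P :=
  ofInvolution (quotientRep V.ρ N hN) (N.mapQ N V.sigma hs)
    (fun v => by
      obtain ⟨v, rfl⟩ := N.mkQ_surjective v
      simp [sigma_sigma])
    (fun i b hb => by
      ext v
      have := LinearMap.congr_fun (V.sigma_mul_rho hb) v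
      simp only [Module.End.mul_apply, LinearMap.smul_apply] at this
      simp [quotientRep, this])

section Quotient

variable (V : SuperModule B P) (N : Submodule ℂ V.carrier)
    (hN : ∀ (b : B), ∀ v ∈ N, V.ρ b v ∈ N) (hs : ∀ v ∈ N, V.sigma v ∈ N)

/-- The projection to the quotient, as a linear map. -/
noncomputable def mkQ : V.carrier →ₗ[ℂ] (V.quotient N hN hs).carrier := N.mkQ

theorem mkQ_surjective : Function.Surjective (V.mkQ N hN hs) := N.mkQ_surjective

theorem ker_mkQ : LinearMap.ker (V.mkQ N hN hs) = N := N.ker_mkQ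

theorem mkQ_rho (b : B) (v : V.carrier) :
    V.mkQ N hN hs (V.ρ b v) = (V.quotient N hN hs).ρ b (V.mkQ N hN hs v) := rfl

theorem mkQ_mem_homs : V.mkQ N hN hs ∈ homs V (V.quotient N hN hs) := by
  refine ⟨V.mkQ_rho N hN hs, fun i v hv => ?_⟩
  change N.mkQ v ∈ Module.End.eigenspace (N.mapQ N V.sigma hs) (sgn i)
  rw [Module.End.mem_eigenspace_iff]
  simp [V.sigma_of_mem hv]

theorem mkQ_sigma (v : V.carrier) :
    V.mkQ N hN hs (V.sigma v) = (V.quotient N hN hs).sigma (V.mkQ N hN hs v) :=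
  (mem_homs_iff.1 (V.mkQ_mem_homs N hN hs)).2 v

/-- The projection to the quotient. -/
noncomputable def proj : V ⟶ V.quotient N hN hs :=
  ⟨V.mkQ N hN hs, V.mkQ_mem_homs N hN hs⟩

end Quotient

/-- A nonzero finite dimensional supermodule has a maximal proper graded submodule. -/
theorem exists_irreducible_quotient (V : SuperModule B P) [FiniteDimensional ℂ V.carrier]
    [Nontrivial V.carrier] :
    ∃ (N : Submodule ℂ V.carrier) (hN : ∀ (b : B), ∀ v ∈ N, V.ρ b v ∈ N)
      (hs : ∀ v ∈ N, V.sigma v ∈ N), (V.quotient N hN hs).IsIrreducible := by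
  let S : Set (Submodule ℂ V.carrier) :=
    {N | (∀ (b : B), ∀ v ∈ N, V.ρ b v ∈ N) ∧ (∀ v ∈ N, V.sigma v ∈ N) ∧ N ≠ ⊤}
  have hS : S.Nonempty := ⟨⊥, by simp [S, bot_ne_top]⟩
  obtain ⟨N, ⟨hN, hs, hne⟩, hmax⟩ := WellFounded.has_min
    (IsWellFounded.wf (r := ((· > ·) : Submodule ℂ V.carrier → _ → Prop))) S hS
  refine ⟨N, hN, hs, (isIrreducible_iff _).2 ⟨?_, fun K hK hKs => ?_⟩⟩
  · exact Submodule.Quotient.nontrivial_iff.2 hne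
  · by_contra! h
    have hsurj := V.mkQ_surjective N hN hs
    refine hmax (K.comap (V.mkQ N hN hs)) ⟨fun b v hv => ?_, fun v hv => ?_, fun ht => ?_⟩ ?_
    · rw [Submodule.mem_comap, mkQ_rho]; exact hK b _ hv
    · rw [Submodule.mem_comap, mkQ_sigma]; exact hKs _ hv
    · refine h.2 (Submodule.eq_top_iff'.2 fun w => ?_)
      obtain ⟨v, rfl⟩ := hsurj w
      exact (ht ▸ Submodule.mem_top : v ∈ K.comap (V.mkQ N hN hs))
    · refine lt_of_le_of_ne (fun v hv => ?_) fun heq => h.1 ((Submodule.eq_bot_iff _).2 fun w hw => ?_)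
      · have : V.mkQ N hN hs v = 0 := by rw [← LinearMap.mem_ker, ker_mkQ]; exact hv
        rw [Submodule.mem_comap, this]; exact K.zero_mem
      · obtain ⟨v, rfl⟩ := hsurj w
        have hv : v ∈ N := by rw [heq]; exact hw
        rw [← LinearMap.mem_ker, ker_mkQ]; exact hv

end SuperModule

/-! ### The root of unity -/

section Root

variable {ℓ : ℕ}

theorem xiPow_add (x y : ℂ) : xiPow ℓ (x + y) = xiPow ℓ x * xiPow ℓ y := by
  rw [xiPow, xiPow, xiPow, ← Complex.exp_add]
  congr 1
  ring

@[simp] theorem xiPow_zero : xiPow ℓ 0 = 1 := by simp [xiPow]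

theorem xiPow_ne_zero (x : ℂ) : xiPow ℓ x ≠ 0 := Complex.exp_ne_zero _

theorem xiPow_neg (x : ℂ) : xiPow ℓ (-x) = (xiPow ℓ x)⁻¹ := by
  exact eq_inv_of_mul_eq_one_left (by rw [← xiPow_add, neg_add_cancel, xiPow_zero])

theorem xi_ne_zero : xi ℓ ≠ 0 := xiPow_ne_zero _

theorem xiPow_natCast_mul (n : ℕ) (x : ℂ) : xiPow ℓ (n * x) = xiPow ℓ x ^ n := by
  rw [xiPow, xiPow, ← Complex.exp_nat_mul]
  congr 1
  ring

theorem xiPow_natCast (n : ℕ) : xiPow ℓ n = xi ℓ ^ n := by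
  rw [xi, ← xiPow_natCast_mul, mul_one]

theorem xiPow_intCast (n : ℤ) : xiPow ℓ n = xi ℓ ^ n := by
  obtain ⟨m, rfl | rfl⟩ := n.eq_nat_or_neg
  · simp [xiPow_natCast]
  · simp [xiPow_natCast, xiPow_neg]

theorem isPrimitiveRoot_xi (hℓ : 3 ≤ ℓ) : IsPrimitiveRoot (xi ℓ) ℓ := by
  have := Complex.isPrimitiveRoot_exp ℓ (by omega)
  rwa [xi, xiPow, mul_one]

/-- Otherwise the order `ℓ ≥ 3` of `ξ` divides `4`, so `ℓ = 4`, which is not odd. This is what makes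
the odd root vectors `e₃` and `f₃` square to zero. -/
theorem one_add_xi_sq_ne_zero (hℓ : 3 ≤ ℓ) (hodd : Odd ℓ) : 1 + xi ℓ ^ 2 ≠ 0 := by
  intro h
  have h4 : xi ℓ ^ 4 = 1 := by
    have : xi ℓ ^ 2 = -1 := by linear_combination h
    calc xi ℓ ^ 4 = (xi ℓ ^ 2) ^ 2 := by ring
      _ = 1 := by rw [this]; norm_num
  have h1 := (isPrimitiveRoot_xi hℓ).dvd_of_pow_eq_one 4 h4
  have h2 := Nat.le_of_dvd (by norm_num) h1
  interval_cases ℓ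
  · omega
  · exact absurd hodd (by decide)

theorem xi_sub_inv_ne_zero (hℓ : 3 ≤ ℓ) : xi ℓ - (xi ℓ)⁻¹ ≠ 0 := by
  intro h
  have h2 : xi ℓ ^ 2 = 1 := by
    have h0 := xi_ne_zero (ℓ := ℓ)
    field_simp at h
    linear_combination h
  have h1 := (isPrimitiveRoot_xi hℓ).dvd_of_pow_eq_one 2 h2
  have h2 := Nat.le_of_dvd (by norm_num) h1
  omega

end Root

/-! ### Relations in representations of `U_ξ sl(2|1)` -/

section Relations

variable {ℓ : ℕ} {B : Type} [Ring B] [Algebra ℂ B] (φ : U ℓ →ₐ[ℂ] B)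

theorem map_rel {a b : FreeAlgebra ℂ Gen} (h : Rel ℓ a b) :
    φ (RingQuot.mkAlgHom ℂ (Rel ℓ) a) = φ (RingQuot.mkAlgHom ℂ (Rel ℓ) b) := by
  rw [RingQuot.mkAlgHom_rel ℂ h]

theorem k_mul_kinv (i : Fin 2) : φ (U.gen ℓ (.k i)) * φ (U.gen ℓ (.kinv i)) = 1 := by
  simpa [U.gen] using map_rel φ (Rel.k_kinv i)

theorem kinv_mul_k (i : Fin 2) : φ (U.gen ℓ (.kinv i)) * φ (U.gen ℓ (.k i)) = 1 := by
  simpa [U.gen] using map_rel φ (Rel.kinv_k i)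

theorem k_mul_k (i j : Fin 2) : φ (U.gen ℓ (.k i)) * φ (U.gen ℓ (.k j)) =
    φ (U.gen ℓ (.k j)) * φ (U.gen ℓ (.k i)) := by
  have h : φ (U.gen ℓ (.k 0)) * φ (U.gen ℓ (.k 1)) = φ (U.gen ℓ (.k 1)) * φ (U.gen ℓ (.k 0)) := by
    simpa [U.gen] using map_rel φ Rel.k_comm
  fin_cases i <;> fin_cases j <;> first | rfl | exact h | exact h.symm

theorem k_mul_e (i j : Fin 2) : φ (U.gen ℓ (.k i)) * φ (U.gen ℓ (.e j)) =
    (xi ℓ ^ cartan i j) • (φ (U.gen ℓ (.e j)) * φ (U.gen ℓ (.k i))) := by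
  have h : φ (U.gen ℓ (.k i)) * φ (U.gen ℓ (.e j)) * φ (U.gen ℓ (.kinv i)) =
      (xi ℓ ^ cartan i j) • φ (U.gen ℓ (.e j)) := by
    simpa [U.gen] using map_rel φ (Rel.k_e i j)
  rw [← smul_mul_assoc, ← h, mul_assoc _ (φ (U.gen ℓ (.kinv i))), kinv_mul_k, mul_one]

theorem k_mul_f (i j : Fin 2) : φ (U.gen ℓ (.k i)) * φ (U.gen ℓ (.f j)) =
    (xi ℓ ^ (-cartan i j)) • (φ (U.gen ℓ (.f j)) * φ (U.gen ℓ (.k i))) := by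
  have h : φ (U.gen ℓ (.k i)) * φ (U.gen ℓ (.f j)) * φ (U.gen ℓ (.kinv i)) =
      (xi ℓ ^ (-cartan i j)) • φ (U.gen ℓ (.f j)) := by
    simpa [U.gen] using map_rel φ (Rel.k_f i j)
  rw [← smul_mul_assoc, ← h, mul_assoc _ (φ (U.gen ℓ (.kinv i))), kinv_mul_k, mul_one]

theorem inv_mul_of_mul {k k' x : B} {a : ℂ} (ha : a ≠ 0) (h1 : k * k' = 1) (h2 : k' * k = 1)
    (h : k * x = a • (x * k)) : k' * x = a⁻¹ • (x * k') := by
  have : k' * (k * x) * k' = a • (k' * (x * k) * k') := by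
    rw [h, mul_smul_comm, smul_mul_assoc]
  rw [← mul_assoc, h2, one_mul, mul_assoc, mul_assoc x, h1, mul_one] at this
  rw [this, smul_smul, inv_mul_cancel₀ ha, one_smul]

theorem kinv_mul_e (i j : Fin 2) : φ (U.gen ℓ (.kinv i)) * φ (U.gen ℓ (.e j)) =
    (xi ℓ ^ cartan i j)⁻¹ • (φ (U.gen ℓ (.e j)) * φ (U.gen ℓ (.kinv i))) :=
  inv_mul_of_mul (zpow_ne_zero _ xi_ne_zero) (k_mul_kinv φ i) (kinv_mul_k φ i) (k_mul_e φ i j)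

theorem kinv_mul_f (i j : Fin 2) : φ (U.gen ℓ (.kinv i)) * φ (U.gen ℓ (.f j)) =
    (xi ℓ ^ (-cartan i j))⁻¹ • (φ (U.gen ℓ (.f j)) * φ (U.gen ℓ (.kinv i))) :=
  inv_mul_of_mul (zpow_ne_zero _ xi_ne_zero) (k_mul_kinv φ i) (kinv_mul_k φ i) (k_mul_f φ i j)

/-- The sign of the exchange of `e i` and `f j`. -/
def exchangeSign (i j : Fin 2) : ℂ := if i = 1 ∧ j = 1 then -1 else 1

/-- The supercommutator of `e i` and `f j`. -/
noncomputable def exchangeTerm (i j : Fin 2) : B :=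
  if i = j then (xi ℓ - (xi ℓ)⁻¹)⁻¹ • (φ (U.gen ℓ (.k i)) - φ (U.gen ℓ (.kinv i))) else 0

theorem e_mul_f (i j : Fin 2) : φ (U.gen ℓ (.e i)) * φ (U.gen ℓ (.f j)) =
    exchangeSign i j • (φ (U.gen ℓ (.f j)) * φ (U.gen ℓ (.e i))) + exchangeTerm φ i j := by
  have h1 := map_rel φ Rel.e_f_even
  have h2 := map_rel φ Rel.e_f_odd
  have h3 := map_rel φ Rel.e0_f1
  have h4 := map_rel φ Rel.e1_f0
  fin_cases i <;> fin_cases j <;> simp [exchangeSign, exchangeTerm, U.gen] at h1 h2 h3 h4 ⊢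
  · rw [← h1]; abel
  · exact sub_eq_zero.1 h3
  · exact sub_eq_zero.1 h4
  · rw [← h2]; abel

theorem f_mul_e (i j : Fin 2) : φ (U.gen ℓ (.f i)) * φ (U.gen ℓ (.e j)) =
    exchangeSign i j • (φ (U.gen ℓ (.e j)) * φ (U.gen ℓ (.f i))) +
      (-exchangeSign i j) • exchangeTerm φ i j := by
  have h1 := e_mul_f φ j i
  have h2 : exchangeSign j i = exchangeSign i j := by simp only [exchangeSign, and_comm]
  have h3 : (exchangeTerm φ j i : B) = exchangeTerm φ i j := by
    by_cases h : i = j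
    · rw [h]
    · simp [exchangeTerm, h, Ne.symm h]
  have h4 : exchangeSign i j * exchangeSign i j = 1 := by
    rw [exchangeSign]; split_ifs <;> simp
  rw [h1, h2, h3, smul_add, smul_smul, h4, one_smul, neg_smul, add_neg_cancel_right]

theorem isBorel_e (hℓ : 3 ≤ ℓ) (hodd : Odd ℓ) (h : φ (U.gen ℓ (.e 0)) ^ ℓ = 0) :
    IsBorel ℓ (xi ℓ) fun i => φ (U.gen ℓ (.e i)) where
  ne_zero := xi_ne_zero
  one_add_sq_ne_zero := one_add_xi_sq_ne_zero hℓ hodd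
  serre := by simpa [U.gen] using map_rel φ Rel.serre_e
  sq := by simpa [U.gen, pow_two] using map_rel φ Rel.e_sq
  pow := h

theorem isBorel_f (hℓ : 3 ≤ ℓ) (hodd : Odd ℓ) (h : φ (U.gen ℓ (.f 0)) ^ ℓ = 0) :
    IsBorel ℓ (xi ℓ) fun i => φ (U.gen ℓ (.f i)) where
  ne_zero := xi_ne_zero
  one_add_sq_ne_zero := one_add_xi_sq_ne_zero hℓ hodd
  serre := by simpa [U.gen] using map_rel φ Rel.serre_f
  sq := by simpa [U.gen, pow_two] using map_rel φ Rel.f_sq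
  pow := h

theorem U.stable_of_gen {M : Type} [AddCommGroup M] [Module ℂ M]
    (φ : U ℓ →ₐ[ℂ] Module.End ℂ M) {N : Submodule ℂ M}
    (hk : ∀ i, ∀ v ∈ N, φ (U.gen ℓ (.k i)) v ∈ N) (hk' : ∀ i, ∀ v ∈ N, φ (U.gen ℓ (.kinv i)) v ∈ N)
    (he : ∀ i, ∀ v ∈ N, φ (U.gen ℓ (.e i)) v ∈ N) (hf : ∀ i, ∀ v ∈ N, φ (U.gen ℓ (.f i)) v ∈ N)
    (b : U ℓ) : ∀ v ∈ N, φ b v ∈ N := by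
  refine stable_of_adjoin (U.adjoin_gen ℓ) φ ?_ b
  rintro _ ⟨x, rfl⟩
  cases x with
  | k i => exact hk i
  | kinv i => exact hk' i
  | e i => exact he i
  | f i => exact hf i

/-- Triangular decomposition: moving `e i` past `f j` costs a sign and a combination of `k i` and
its inverse, and these preserve the span. So if `Z` is stable under the nonnegative part, the
`f`-monomials applied to `Z` already give a submodule. -/
theorem monomialSpan_f_stable (hℓ : 3 ≤ ℓ) (hodd : Odd ℓ) {M : Type} [AddCommGroup M] [Module ℂ M]
    (φ : U ℓ →ₐ[ℂ] Module.End ℂ M) (h : φ (U.gen ℓ (.f 0)) ^ ℓ = 0) {Z : Submodule ℂ M}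
    (hk : ∀ i, ∀ v ∈ Z, φ (U.gen ℓ (.k i)) v ∈ Z) (hk' : ∀ i, ∀ v ∈ Z, φ (U.gen ℓ (.kinv i)) v ∈ Z)
    (he : ∀ i, ∀ v ∈ Z, φ (U.gen ℓ (.e i)) v ∈ Z) (b : U ℓ) :
    ∀ v ∈ monomialSpan ℓ (xi ℓ) (fun i => φ (U.gen ℓ (.f i))) Z,
      φ b v ∈ monomialSpan ℓ (xi ℓ) (fun i => φ (U.gen ℓ (.f i))) Z := by
  have hB := isBorel_f φ hℓ hodd h
  have k1 (i : Fin 2) : ∀ v ∈ monomialSpan ℓ (xi ℓ) (fun i => φ (U.gen ℓ (.f i))) Z,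
      φ (U.gen ℓ (.k i)) v ∈ monomialSpan ℓ (xi ℓ) (fun i => φ (U.gen ℓ (.f i))) Z := fun v hv =>
    hB.monomialSpan_stable_of_commute _ (fun j => xi ℓ ^ (-cartan i j)) 0
      (fun j => by simpa using k_mul_f φ i j) (hk i) hv
  have k2 (i : Fin 2) : ∀ v ∈ monomialSpan ℓ (xi ℓ) (fun i => φ (U.gen ℓ (.f i))) Z,
      φ (U.gen ℓ (.kinv i)) v ∈ monomialSpan ℓ (xi ℓ) (fun i => φ (U.gen ℓ (.f i))) Z := fun v hv =>
    hB.monomialSpan_stable_of_commute _ (fun j => (xi ℓ ^ (-cartan i j))⁻¹) 0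
      (fun j => by simpa using kinv_mul_f φ i j) (hk' i) hv
  refine U.stable_of_gen φ k1 k2 (fun i v hv => ?_) (fun i v hv => hB.monomialSpan_stable i hv) b
  refine hB.monomialSpan_stable_of_opposite _ (exchangeSign i) (exchangeTerm φ i) (e_mul_f φ i)
    (fun j v hv => ?_) (he i) hv
  rw [exchangeTerm]
  split_ifs with hij
  · exact Submodule.smul_mem _ _ (sub_mem (k1 i v hv) (k2 i v hv))
  · exact Submodule.zero_mem _

theorem monomialSpan_e_stable (hℓ : 3 ≤ ℓ) (hodd : Odd ℓ) {M : Type} [AddCommGroup M] [Module ℂ M]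
    (φ : U ℓ →ₐ[ℂ] Module.End ℂ M) (h : φ (U.gen ℓ (.e 0)) ^ ℓ = 0) {Z : Submodule ℂ M}
    (hk : ∀ i, ∀ v ∈ Z, φ (U.gen ℓ (.k i)) v ∈ Z) (hk' : ∀ i, ∀ v ∈ Z, φ (U.gen ℓ (.kinv i)) v ∈ Z)
    (hf : ∀ i, ∀ v ∈ Z, φ (U.gen ℓ (.f i)) v ∈ Z) (b : U ℓ) :
    ∀ v ∈ monomialSpan ℓ (xi ℓ) (fun i => φ (U.gen ℓ (.e i))) Z,
      φ b v ∈ monomialSpan ℓ (xi ℓ) (fun i => φ (U.gen ℓ (.e i))) Z := by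
  have hB := isBorel_e φ hℓ hodd h
  have k1 (i : Fin 2) : ∀ v ∈ monomialSpan ℓ (xi ℓ) (fun i => φ (U.gen ℓ (.e i))) Z,
      φ (U.gen ℓ (.k i)) v ∈ monomialSpan ℓ (xi ℓ) (fun i => φ (U.gen ℓ (.e i))) Z := fun v hv =>
    hB.monomialSpan_stable_of_commute _ (fun j => xi ℓ ^ cartan i j) 0
      (fun j => by simpa using k_mul_e φ i j) (hk i) hv
  have k2 (i : Fin 2) : ∀ v ∈ monomialSpan ℓ (xi ℓ) (fun i => φ (U.gen ℓ (.e i))) Z,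
      φ (U.gen ℓ (.kinv i)) v ∈ monomialSpan ℓ (xi ℓ) (fun i => φ (U.gen ℓ (.e i))) Z := fun v hv =>
    hB.monomialSpan_stable_of_commute _ (fun j => (xi ℓ ^ cartan i j)⁻¹) 0
      (fun j => by simpa using kinv_mul_e φ i j) (hk' i) hv
  refine U.stable_of_gen φ k1 k2 (fun i v hv => hB.monomialSpan_stable i hv) (fun i v hv => ?_) b
  refine hB.monomialSpan_stable_of_opposite _ (exchangeSign i)
    (fun j => (-exchangeSign i j) • exchangeTerm φ i j) (f_mul_e φ i) (fun j v hv => ?_) (hf i) hv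
  refine Submodule.smul_mem _ _ ?_
  rw [exchangeTerm]
  split_ifs with hij
  · exact Submodule.smul_mem _ _ (sub_mem (k1 i v hv) (k2 i v hv))
  · exact Submodule.zero_mem _

end Relations

/-! ### The monomial of highest degree -/

section Top

variable {B : Type} [Ring B] [Algebra ℂ B]

/-- Weights add along products. The factors `x 1`, `rootVec q x` and `x 0 ^ (ℓ - 1)` have weights `b
1`, `b 0 + b 1` and `(ℓ - 1) b 0`. -/
theorem topMonomial_commute_add {ℓ : ℕ} (hℓ : 1 ≤ ℓ) (q : ℂ) {x : Fin 2 → B} {T : B}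
    {b : Fin 2 → ℂ} (h : ∀ j, T * x j = x j * T + b j • x j) :
    T * topMonomial ℓ q x = topMonomial ℓ q x * T + (ℓ * b 0 + 2 * b 1) • topMonomial ℓ q x := by
  have mul {y z : B} {c d : ℂ} (hy : T * y = y * T + c • y) (hz : T * z = z * T + d • z) :
      T * (y * z) = y * z * T + (c + d) • (y * z) := by
    rw [← mul_assoc, hy, add_mul, mul_assoc, hz, mul_add, smul_mul_assoc, mul_smul_comm, add_smul,
      ← mul_assoc]
    abel
  have hr : T * rootVec q x = rootVec q x * T + (b 0 + b 1) • rootVec q x := by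
    rw [rootVec, mul_sub, mul_smul_comm, mul (h 0) (h 1), mul (h 1) (h 0), add_comm (b 1)]
    simp only [smul_add, smul_sub, sub_mul, smul_mul_assoc, smul_comm q (b 0 + b 1)]
    abel
  have hp : ∀ n : ℕ, T * x 0 ^ n = x 0 ^ n * T + (n * b 0) • x 0 ^ n := by
    intro n
    induction n with
    | zero => simp
    | succ n ih => rw [pow_succ, mul ih (h 0)]; congr 2; push_cast; ring
  have := mul (mul (h 1) hr) (hp (ℓ - 1))
  rw [topMonomial]
  simp only [oddMonomial, Matrix.cons_val]
  rw [this]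
  congr 2
  push_cast [hℓ]
  ring

/-- The monomial has exactly two odd factors, `x 1` and `rootVec q x`, so the signs cancel. -/
theorem topMonomial_commute_sign {ℓ : ℕ} (q : ℂ) {x : Fin 2 → B} {s : B}
    (h0 : s * x 0 = x 0 * s) (h1 : s * x 1 = -(x 1 * s)) :
    s * topMonomial ℓ q x = topMonomial ℓ q x * s := by
  have hr : s * rootVec q x = -(rootVec q x * s) := by
    rw [rootVec, mul_sub, mul_smul_comm, ← mul_assoc, ← mul_assoc, h0, h1, mul_assoc, h1, neg_mul,
      mul_assoc (x 1) s, h0]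
    simp only [sub_mul, smul_mul_assoc, mul_neg, smul_neg, mul_assoc]
    abel
  have hp : s * x 0 ^ (ℓ - 1) = x 0 ^ (ℓ - 1) * s := (Commute.pow_right h0 _)
  simp only [topMonomial, oddMonomial, Matrix.cons_val]
  rw [← mul_assoc, ← mul_assoc, h1, neg_mul, mul_assoc (x 1) s, hr, mul_assoc _ _ s, ← hp]
  simp only [mul_neg, neg_neg, mul_assoc]

theorem map_topMonomial {C : Type} [Ring C] [Algebra ℂ C] (φ : B →ₐ[ℂ] C) (ℓ : ℕ) (q : ℂ)
    (x : Fin 2 → B) : φ (topMonomial ℓ q x) = topMonomial ℓ q fun i => φ (x i) := by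
  simp [topMonomial, oddMonomial, rootVec]

end Top

/-! ### Diagonalizable operators -/

section Diagonalizable

variable {W X : Type} [AddCommGroup W] [Module ℂ W] [AddCommGroup X] [Module ℂ X]

/-- Eigenvectors lift along linear maps that intertwine a diagonalizable operator with another
one. -/
theorem exists_eigenvector_lift [FiniteDimensional ℂ W] {T : Module.End ℂ W} {S : Module.End ℂ X}
    {f : W →ₗ[ℂ] X} (hf : ∀ w, f (T w) = S (f w)) (hT : ⨆ c : ℂ, T.eigenspace c = ⊤)
    {w : W} {c : ℂ} (hw : S (f w) = c • f w) {P : Submodule ℂ W} (hP : ∀ v ∈ P, T v ∈ P)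
    (hwP : w ∈ P) : ∃ w' ∈ P, T w' = c • w' ∧ f w' = f w := by
  classical
  have h1 : w ∈ ⨆ c : ℂ, P ⊓ T.eigenspace c := by
    have := Submodule.inf_iSup_genEigenspace hP 1
    change w ∈ ⨆ c : ℂ, P ⊓ T.genEigenspace c 1
    rw [← this]
    exact ⟨hwP, (hT ▸ Submodule.mem_top : w ∈ ⨆ c : ℂ, T.eigenspace c)⟩
  obtain ⟨g, hg, hsum⟩ := (Submodule.mem_iSup_iff_exists_finsupp _ _).1 h1
  -- The `c`-component of `w` is the lift: `f w - f (g c)` lies in the `c`-eigenspace of `S` and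
  -- also in the sum of the other eigenspaces, hence vanishes.
  refine ⟨g c, (hg c).1, Module.End.mem_eigenspace_iff.1 (hg c).2, ?_⟩
  have hfg (d : ℂ) : f (g d) ∈ S.eigenspace d := by
    rw [Module.End.mem_eigenspace_iff, ← hf, Module.End.mem_eigenspace_iff.1 (hg d).2, map_smul]
  have h2 : f w - f (g c) ∈ S.eigenspace c :=
    sub_mem (Module.End.mem_eigenspace_iff.2 hw) (hfg c)
  have h3 : f w - f (g c) ∈ ⨆ d, ⨆ (_ : d ≠ c), S.eigenspace d := by
    have : f w - f (g c) = ∑ d ∈ g.support.erase c, f (g d) := by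
      rw [← hsum, Finsupp.sum, map_sum, sub_eq_iff_eq_add]
      by_cases hc : c ∈ g.support
      · rw [Finset.sum_erase_add _ _ hc]
      · rw [Finset.erase_eq_of_notMem hc, Finsupp.notMem_support_iff.1 hc]
        simp
    rw [this]
    refine sum_mem fun d hd => ?_
    have hd : d ≠ c := (Finset.mem_erase.1 hd).1
    exact Submodule.mem_iSup_of_mem d (Submodule.mem_iSup_of_mem hd (hfg d))
  have h4 := Submodule.disjoint_def.1 (S.eigenspaces_iSupIndep c) _ h2 h3
  exact (sub_eq_zero.1 h4).symm

theorem exists_inf_eigenspace_ne_bot [FiniteDimensional ℂ W] {T : Module.End ℂ W}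
    (hT : ⨆ c : ℂ, T.eigenspace c = ⊤) {P : Submodule ℂ W} (hP : ∀ v ∈ P, T v ∈ P)
    (hne : P ≠ ⊥) : ∃ c : ℂ, P ⊓ T.eigenspace c ≠ ⊥ := by
  by_contra! h
  apply hne
  have := Submodule.inf_iSup_genEigenspace hP 1
  rw [show ⨆ c : ℂ, T.genEigenspace c 1 = ⊤ from hT, inf_top_eq] at this
  rw [this]
  exact iSup_eq_bot.2 h

end Diagonalizable

theorem SuperModule.iSup_eigenspace_sigma {B : Type} [Ring B] [Algebra ℂ B]
    {P : ZMod 2 → Submodule ℂ B} (V : SuperModule B P) : ⨆ c : ℂ, V.sigma.eigenspace c = ⊤ := by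
  rw [Submodule.eq_top_iff']
  intro v
  obtain ⟨a, ha, b, hb, rfl⟩ := V.exists_add v
  exact add_mem
    (Submodule.mem_iSup_of_mem _ (Module.End.mem_eigenspace_iff.2 (V.sigma_of_mem ha)))
    (Submodule.mem_iSup_of_mem _ (Module.End.mem_eigenspace_iff.2 (V.sigma_of_mem hb)))

/-! ### Weight vectors -/

namespace UHModule

variable {ℓ : ℕ}

theorem restrict_rho (V : UHModule ℓ) (x : Gen) :
    V.restrict.ρ (U.gen ℓ x) = V.ρ (UH.gen ℓ (.base x)) := by
  change V.ρ (incl ℓ (U.gen ℓ x)) = _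
  rw [incl_gen]

/-- The action of `(k i)⁻¹`. -/
noncomputable def kinv (V : UHModule ℓ) (i : Fin 2) : Module.End ℂ V.carrier :=
  V.ρ (UH.gen ℓ (GenH.base (Gen.kinv i)))

end UHModule

section RelationsH

variable {ℓ : ℕ} {B : Type} [Ring B] [Algebra ℂ B] (φ : UH ℓ →ₐ[ℂ] B)

theorem h_mul_e (i j : Fin 2) : φ (UH.gen ℓ (.h i)) * φ (UH.gen ℓ (.base (.e j))) =
    φ (UH.gen ℓ (.base (.e j))) * φ (UH.gen ℓ (.h i)) +
      (cartan i j : ℂ) • φ (UH.gen ℓ (.base (.e j))) := by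
  have h := congrArg φ (RingQuot.mkAlgHom_rel ℂ (RelH.h_e (ℓ := ℓ) i j))
  simp only [map_sub, map_mul, map_smul] at h
  rw [sub_eq_iff_eq_add, add_comm] at h
  exact h

theorem h_mul_f (i j : Fin 2) : φ (UH.gen ℓ (.h i)) * φ (UH.gen ℓ (.base (.f j))) =
    φ (UH.gen ℓ (.base (.f j))) * φ (UH.gen ℓ (.h i)) +
      (-(cartan i j : ℂ)) • φ (UH.gen ℓ (.base (.f j))) := by
  have h := congrArg φ (RingQuot.mkAlgHom_rel ℂ (RelH.h_f (ℓ := ℓ) i j))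
  simp only [map_sub, map_mul, map_smul] at h
  rw [sub_eq_iff_eq_add, add_comm] at h
  exact h

theorem h_mul_h (i j : Fin 2) : φ (UH.gen ℓ (.h i)) * φ (UH.gen ℓ (.h j)) =
    φ (UH.gen ℓ (.h j)) * φ (UH.gen ℓ (.h i)) := by
  have h := congrArg φ (RingQuot.mkAlgHom_rel ℂ (RelH.h_h (ℓ := ℓ) i j))
  simp only [map_sub, map_mul, map_zero] at h
  exact sub_eq_zero.1 h

end RelationsH

/-! ### Weight vectors and existence of highest weight vectors -/

namespace UHModule

variable {ℓ : ℕ}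

theorem sigma_mul_gen (V : UHModule ℓ) (x : GenH) :
    V.sigma * V.ρ (UH.gen ℓ x) = sgn x.parity • (V.ρ (UH.gen ℓ x) * V.sigma) :=
  V.sigma_mul_rho (gen_mem_superPart _ _ x)

theorem sigma_mul_h (V : UHModule ℓ) (i : Fin 2) : V.sigma * V.h i = V.h i * V.sigma := by
  have := V.sigma_mul_gen (.h i)
  simp only [GenH.parity, sgn_zero, one_smul] at this
  exact this

/-- A homogeneous weight vector: a joint eigenvector of `h₁`, `h₂` and the parity involution. -/
structure IsWeightVector (V : UHModule ℓ) (c : Fin 2 → ℂ) (t : ℂ) (v : V.carrier) : Prop where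
  h : ∀ i, V.h i v = c i • v
  sigma : V.sigma v = t • v

/-- A vector killed by the `e i`. -/
structure IsHighestWeightVector (V : UHModule ℓ) (c : Fin 2 → ℂ) (t : ℂ) (v : V.carrier) : Prop
    extends V.IsWeightVector c t v where
  e : ∀ i, V.e i v = 0

variable {V : UHModule ℓ} {c : Fin 2 → ℂ} {t : ℂ} {v : V.carrier}

theorem IsWeightVector.e_apply (hv : V.IsWeightVector c t v) (j : Fin 2) :
    V.IsWeightVector (fun i => c i + cartan i j) (sgn (Gen.parity (.e j)) * t) (V.e j v) where
  h i := by
    have := LinearMap.congr_fun (h_mul_e V.ρ i j) v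
    change V.h i (V.e j v) = V.e j (V.h i v) + (cartan i j : ℂ) • V.e j v at this
    rw [this, hv.h, map_smul, add_smul]
  sigma := by
    have := LinearMap.congr_fun (V.sigma_mul_gen (.base (.e j))) v
    change V.sigma (V.e j v) = sgn (Gen.parity (.e j)) • V.e j (V.sigma v) at this
    rw [this, hv.sigma, map_smul, smul_smul]

theorem IsNilpotentWeight.k_apply (hV : V.IsNilpotentWeight) (hv : V.IsWeightVector c t v)
    (i : Fin 2) : V.k i v = xiPow ℓ (c i) • v := hV.k_eq i _ _ (hv.h i)

theorem IsNilpotentWeight.kinv_apply (hV : V.IsNilpotentWeight) (hv : V.IsWeightVector c t v)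
    (i : Fin 2) : V.kinv i v = (xiPow ℓ (c i))⁻¹ • v := by
  have h1 := LinearMap.congr_fun (kinv_mul_k V.restrict.ρ i) v
  rw [restrict_rho, restrict_rho] at h1
  change V.kinv i (V.k i v) = v at h1
  rw [hV.k_apply hv, map_smul] at h1
  rw [eq_inv_smul_iff₀ (xiPow_ne_zero _), h1]

theorem IsNilpotentWeight.isBorel_e (hℓ : 3 ≤ ℓ) (hodd : Odd ℓ) (hV : V.IsNilpotentWeight) :
    IsBorel ℓ (xi ℓ) V.e := by
  have h := QuantumSl21.isBorel_e V.restrict.ρ hℓ hodd (by rw [restrict_rho]; exact hV.e_pow)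
  simp only [restrict_rho] at h
  exact h

theorem IsNilpotentWeight.isBorel_f (hℓ : 3 ≤ ℓ) (hodd : Odd ℓ) (hV : V.IsNilpotentWeight) :
    IsBorel ℓ (xi ℓ) V.f := by
  have h := QuantumSl21.isBorel_f V.restrict.ρ hℓ hodd (by rw [restrict_rho]; exact hV.f_pow)
  simp only [restrict_rho] at h
  exact h

theorem IsNilpotentWeight.exists_weightVector (hV : V.IsNilpotentWeight)
    [hn : Nontrivial V.carrier] : ∃ c t v, v ≠ 0 ∧ V.IsWeightVector c t v := by
  have := hV.finite
  have hs (i : Fin 2) (v : V.carrier) : V.h i (V.sigma v) = V.sigma (V.h i v) :=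
    (LinearMap.congr_fun (V.sigma_mul_h i) v).symm
  have hh (v : V.carrier) : V.h 1 (V.h 0 v) = V.h 0 (V.h 1 v) :=
    LinearMap.congr_fun (h_mul_h V.ρ 1 0) v
  obtain ⟨t, ht⟩ := exists_inf_eigenspace_ne_bot V.iSup_eigenspace_sigma
    (P := ⊤) (by simp) top_ne_bot
  rw [top_inf_eq] at ht
  obtain ⟨c₀, h0⟩ := exists_inf_eigenspace_ne_bot (hV.diagonalizable 0)
    (P := V.sigma.eigenspace t) (fun v hv => by
      rw [Module.End.mem_eigenspace_iff] at hv ⊢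
      rw [← hs, hv, map_smul]) ht
  obtain ⟨c₁, h1⟩ := exists_inf_eigenspace_ne_bot (hV.diagonalizable 1)
    (P := V.sigma.eigenspace t ⊓ (V.h 0).eigenspace c₀) (fun v hv => by
      simp only [Submodule.mem_inf, Module.End.mem_eigenspace_iff] at hv ⊢
      rw [← hs, hv.1, map_smul, ← hh, hv.2, map_smul]
      exact ⟨rfl, rfl⟩) h0
  obtain ⟨v, hv, hne⟩ := Submodule.exists_mem_ne_zero_of_ne_bot h1
  simp only [Submodule.mem_inf, Module.End.mem_eigenspace_iff] at hv
  refine ⟨![c₀, c₁], t, v, hne, ⟨fun i => ?_, hv.1.1⟩⟩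
  fin_cases i
  · exact hv.1.2
  · exact hv.2

theorem IsNilpotentWeight.exists_highestWeightVector (hℓ : 3 ≤ ℓ) (hodd : Odd ℓ)
    (hV : V.IsNilpotentWeight) [hn : Nontrivial V.carrier] :
    ∃ c t v, v ≠ 0 ∧ V.IsHighestWeightVector c t v := by
  have hB := hV.isBorel_e hℓ hodd
  obtain ⟨c, t, v, hne, hv⟩ := hV.exists_weightVector
  -- If `e₁` killed no nonzero weight vector, no power of it would kill `v`, against `e₁ ^ ℓ = 0`.
  have hkill : ∃ c t v, v ≠ 0 ∧ V.IsWeightVector c t v ∧ V.e 0 v = 0 := by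
    by_contra! h
    have : ∀ n : ℕ, ∃ c t, (V.e 0 ^ n) v ≠ 0 ∧ V.IsWeightVector c t ((V.e 0 ^ n) v) := by
      intro n
      induction n with
      | zero => exact ⟨c, t, by simpa using hne, by simpa using hv⟩
      | succ n ih =>
        obtain ⟨c, t, h1, h2⟩ := ih
        rw [pow_succ', Module.End.mul_apply]
        exact ⟨_, _, h _ _ _ h1 h2, h2.e_apply 0⟩
    obtain ⟨_, _, h1, _⟩ := this ℓ
    exact h1 (by rw [hV.e_pow]; rfl)
  obtain ⟨c, t, v, hne, hv, h0⟩ := hkill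
  have hr (w : V.carrier) (hw : V.e 0 w = 0) :
      rootVec (xi ℓ) V.e w = V.e 0 (V.e 1 w) := by
    simp [rootVec, hw]
  -- On the kernel of `e₁` the operator `e₁ e₂` agrees with `e₃`. If `e₃ v ≠ 0`, it replaces `v`:
  -- `e₁ e₃ v = ξ⁻¹ e₃ e₁ v = 0`, and `e₃² = 0` gives the last condition. Afterwards either `v` or
  -- `e₂ v` is a highest weight vector.
  have hkill_odd : ∃ c t v, v ≠ 0 ∧ V.IsWeightVector c t v ∧ V.e 0 v = 0 ∧ V.e 0 (V.e 1 v) = 0 := by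
    by_cases h : V.e 0 (V.e 1 v) = 0
    · exact ⟨c, t, v, hne, hv, h0, h⟩
    · have h3 : V.e 0 (V.e 0 (V.e 1 v)) = 0 := by
        have := LinearMap.congr_fun hB.even_mul_rootVec v
        simp only [Module.End.mul_apply, LinearMap.smul_apply, hr v h0, h0, map_zero,
          smul_zero] at this
        exact this
      refine ⟨_, _, _, h, (hv.e_apply 1).e_apply 0, h3, ?_⟩
      rw [← hr _ h3, ← hr v h0]
      exact LinearMap.congr_fun hB.rootVec_mul_self v
  obtain ⟨c, t, v, hne, hv, h0, h3⟩ := hkill_odd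
  by_cases h : V.e 1 v = 0
  · refine ⟨c, t, v, hne, ⟨hv, fun i => ?_⟩⟩
    fin_cases i
    · exact h0
    · exact h
  · refine ⟨_, _, _, h, ⟨hv.e_apply 1, fun i => ?_⟩⟩
    fin_cases i
    · exact h3
    · exact LinearMap.congr_fun hB.sq v

end UHModule

theorem forall_mem_span_singleton_of_eigenvector {M : Type} [AddCommGroup M] [Module ℂ M]
    {T : Module.End ℂ M} {a : ℂ} {v : M} (h : T v = a • v) : ∀ z ∈ (ℂ ∙ v), T z ∈ (ℂ ∙ v) := by
  intro z hz
  obtain ⟨r, rfl⟩ := Submodule.mem_span_singleton.1 hz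
  rw [map_smul, h]
  exact Submodule.smul_mem _ _ (Submodule.smul_mem _ _ (Submodule.mem_span_singleton_self v))

theorem forall_mem_span_singleton_of_apply_eq_zero {M : Type} [AddCommGroup M] [Module ℂ M]
    {T : Module.End ℂ M} {v : M} (h : T v = 0) : ∀ z ∈ (ℂ ∙ v), T z ∈ (ℂ ∙ v) :=
  forall_mem_span_singleton_of_eigenvector (a := 0) (by simpa using h)

/-! ### The element `E F` and the lifting property of typical modules -/

namespace UHModule

variable {ℓ : ℕ} {V W X : UHModule ℓ} {c : Fin 2 → ℂ} {t : ℂ} {v : V.carrier}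

theorem sigma_mul_e (V : UHModule ℓ) (j : Fin 2) :
    V.sigma * V.e j = sgn (Gen.parity (.e j)) • (V.e j * V.sigma) :=
  V.sigma_mul_gen (.base (.e j))

theorem sigma_mul_f (V : UHModule ℓ) (j : Fin 2) :
    V.sigma * V.f j = sgn (Gen.parity (.f j)) • (V.f j * V.sigma) :=
  V.sigma_mul_gen (.base (.f j))

/-- The monomial of highest degree in the `e i`, acting on `V`. -/
noncomputable def topE (V : UHModule ℓ) : Module.End ℂ V.carrier := topMonomial ℓ (xi ℓ) V.e

/-- The monomial of highest degree in the `f i`, acting on `V`. -/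
noncomputable def topF (V : UHModule ℓ) : Module.End ℂ V.carrier := topMonomial ℓ (xi ℓ) V.f

theorem topE_eq (V : UHModule ℓ) :
    V.topE = V.ρ (topMonomial ℓ (xi ℓ) fun i => UH.gen ℓ (.base (.e i))) :=
  (map_topMonomial V.ρ ℓ (xi ℓ) _).symm

theorem topF_eq (V : UHModule ℓ) :
    V.topF = V.ρ (topMonomial ℓ (xi ℓ) fun i => UH.gen ℓ (.base (.f i))) :=
  (map_topMonomial V.ρ ℓ (xi ℓ) _).symm

theorem IsWeightVector.topF_apply (hℓ : 1 ≤ ℓ) (hv : V.IsWeightVector c t v) :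
    V.IsWeightVector (fun i => c i - (ℓ * cartan i 0 + 2 * cartan i 1)) t (V.topF v) where
  h i := by
    have := LinearMap.congr_fun (topMonomial_commute_add hℓ (xi ℓ) (fun j => h_mul_f V.ρ i j)) v
    change V.h i (V.topF v) = V.topF (V.h i v) +
      ((ℓ : ℂ) * -(cartan i 0 : ℂ) + 2 * -(cartan i 1 : ℂ)) • V.topF v at this
    rw [this, hv.h, map_smul, ← add_smul]
    congr 1
    ring
  sigma := by
    have := LinearMap.congr_fun (topMonomial_commute_sign (ℓ := ℓ) (xi ℓ) (x := V.f) (s := V.sigma)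
      (by rw [V.sigma_mul_f]; simp [Gen.parity]) (by rw [V.sigma_mul_f]; simp [Gen.parity])) v
    change V.sigma (V.topF v) = V.topF (V.sigma v) at this
    rw [this, hv.sigma, map_smul]

theorem IsWeightVector.topE_apply (hℓ : 1 ≤ ℓ) (hv : V.IsWeightVector c t v) :
    V.IsWeightVector (fun i => c i + (ℓ * cartan i 0 + 2 * cartan i 1)) t (V.topE v) where
  h i := by
    have := LinearMap.congr_fun (topMonomial_commute_add hℓ (xi ℓ) (fun j => h_mul_e V.ρ i j)) v
    change V.h i (V.topE v) = V.topE (V.h i v) +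
      ((ℓ : ℂ) * (cartan i 0 : ℂ) + 2 * (cartan i 1 : ℂ)) • V.topE v at this
    rw [this, hv.h, map_smul, ← add_smul]
  sigma := by
    have := LinearMap.congr_fun (topMonomial_commute_sign (ℓ := ℓ) (xi ℓ) (x := V.e) (s := V.sigma)
      (by rw [V.sigma_mul_e]; simp [Gen.parity]) (by rw [V.sigma_mul_e]; simp [Gen.parity])) v
    change V.sigma (V.topE v) = V.topE (V.sigma v) at this
    rw [this, hv.sigma, map_smul]

/-- `topE` restores the weight that `topF` removes, and the `e i` kill `topE` from the left. No
assumption of being typical enters, so this applies to any object through which a map is to be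
lifted; the resulting vector may be zero. -/
theorem IsNilpotentWeight.topE_topF_apply (hℓ : 3 ≤ ℓ) (hodd : Odd ℓ) (hV : V.IsNilpotentWeight)
    (hv : V.IsWeightVector c t v) : V.IsHighestWeightVector c t (V.topE (V.topF v)) where
  toIsWeightVector := by
    have := (hv.topF_apply (by omega)).topE_apply (by omega)
    simpa only [sub_add_cancel] using this
  e i := by
    have hB := hV.isBorel_e hℓ hodd
    obtain rfl | rfl : i = 0 ∨ i = 1 := by omega
    · exact LinearMap.congr_fun (hB.even_mul_topMonomial (by omega)) _
    · exact LinearMap.congr_fun hB.odd_mul_topMonomial _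

theorem IsNilpotentWeight.f_topF_apply (hℓ : 3 ≤ ℓ) (hodd : Odd ℓ) (hV : V.IsNilpotentWeight)
    (v : V.carrier) (i : Fin 2) : V.f i (V.topF v) = 0 := by
  have hB := hV.isBorel_f hℓ hodd
  obtain rfl | rfl : i = 0 ∨ i = 1 := by omega
  · exact LinearMap.congr_fun (hB.even_mul_topMonomial (by omega)) _
  · exact LinearMap.congr_fun hB.odd_mul_topMonomial _

theorem IsTypical.eq_top (hT : V.IsTypical) {N : Submodule ℂ V.carrier}
    (hN : ∀ b : U ℓ, ∀ v ∈ N, V.restrict.ρ b v ∈ N) (hs : ∀ v ∈ N, V.sigma v ∈ N)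
    (hv : v ∈ N) (hne : v ≠ 0) : N = ⊤ := by
  refine (((SuperModule.isIrreducible_iff _).1 hT.1).2 N hN hs).resolve_left fun h => hne ?_
  rw [h] at hv
  exact hv

theorem IsTypical.monomialSpan_f (hℓ : 3 ≤ ℓ) (hodd : Odd ℓ) (hT : V.IsTypical)
    (hV : V.IsNilpotentWeight) (hv : V.IsHighestWeightVector c t v) (hne : v ≠ 0) :
    monomialSpan ℓ (xi ℓ) V.f (ℂ ∙ v) = ⊤ := by
  have hB := hV.isBorel_f hℓ hodd
  have h := monomialSpan_f_stable hℓ hodd V.restrict.ρ (by rw [restrict_rho]; exact hV.f_pow)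
    (Z := ℂ ∙ v)
    (fun i => by
      rw [restrict_rho]
      exact forall_mem_span_singleton_of_eigenvector (hV.k_apply hv.toIsWeightVector i))
    (fun i => by
      rw [restrict_rho]
      exact forall_mem_span_singleton_of_eigenvector (hV.kinv_apply hv.toIsWeightVector i))
    (fun i => by
      rw [restrict_rho]
      exact forall_mem_span_singleton_of_apply_eq_zero (hv.e i))
  simp only [restrict_rho] at h
  exact hT.eq_top h (fun w hw => hB.monomialSpan_stable_of_commute _ _ 0
    (fun j => by simpa using V.sigma_mul_f j)
    (forall_mem_span_singleton_of_eigenvector hv.sigma) hw)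
    (hB.le_monomialSpan (Submodule.mem_span_singleton_self v)) hne

theorem IsTypical.monomialSpan_e (hℓ : 3 ≤ ℓ) (hodd : Odd ℓ) (hT : V.IsTypical)
    (hV : V.IsNilpotentWeight) (hv : V.IsWeightVector c t v) (hf : ∀ i, V.f i v = 0)
    (hne : v ≠ 0) : monomialSpan ℓ (xi ℓ) V.e (ℂ ∙ v) = ⊤ := by
  have hB := hV.isBorel_e hℓ hodd
  have h := monomialSpan_e_stable hℓ hodd V.restrict.ρ (by rw [restrict_rho]; exact hV.e_pow)
    (Z := ℂ ∙ v)
    (fun i => by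
      rw [restrict_rho]
      exact forall_mem_span_singleton_of_eigenvector (hV.k_apply hv i))
    (fun i => by
      rw [restrict_rho]
      exact forall_mem_span_singleton_of_eigenvector (hV.kinv_apply hv i))
    (fun i => by
      rw [restrict_rho]
      exact forall_mem_span_singleton_of_apply_eq_zero (hf i))
  simp only [restrict_rho] at h
  exact hT.eq_top h (fun w hw => hB.monomialSpan_stable_of_commute _ _ 0
    (fun j => by simpa using V.sigma_mul_e j)
    (forall_mem_span_singleton_of_eigenvector hv.sigma) hw)
    (hB.le_monomialSpan (Submodule.mem_span_singleton_self v)) hne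

/-- The dimension `4ℓ` is used twice. It forces the `f`-monomials on `v` to be independent, so `topF
v ≠ 0`; this is a lowest weight vector, and it forces the `e`-monomials on it to be independent as
well. -/
theorem IsTypical.topE_topF_ne_zero (hℓ : 3 ≤ ℓ) (hodd : Odd ℓ) (hT : V.IsTypical)
    (hV : V.IsNilpotentWeight) (hv : V.IsHighestWeightVector c t v) (hne : v ≠ 0) :
    V.topE (V.topF v) ≠ 0 := by
  have h1 : V.topF v ≠ 0 := topMonomial_ne_zero (by omega) (by
    rw [hT.monomialSpan_f hℓ hodd hV hv hne, finrank_top, hT.2])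
  exact topMonomial_ne_zero (by omega) (by
    rw [hT.monomialSpan_e hℓ hodd hV (hv.topF_apply (by omega)) (hV.f_topF_apply hℓ hodd v) h1,
      finrank_top, hT.2])

/-- The operators `sigma`, `h 0` and `h 1` commute and are diagonalizable. The lift is corrected for
one after another, each time inside the joint eigenspace already reached. -/
theorem IsNilpotentWeight.exists_weightVector_lift (hW : W.IsNilpotentWeight)
    {p : W.carrier →ₗ[ℂ] X.carrier} (hp : p ∈ SuperModule.homs W X)
    (hsurj : Function.Surjective p) {x : X.carrier} (hx : X.IsWeightVector c t x) :
    ∃ w, W.IsWeightVector c t w ∧ p w = x := by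
  have := hW.finite
  rw [SuperModule.mem_homs_iff] at hp
  have hs (i : Fin 2) (v : W.carrier) : W.h i (W.sigma v) = W.sigma (W.h i v) :=
    (LinearMap.congr_fun (W.sigma_mul_h i) v).symm
  have hh (v : W.carrier) : W.h 1 (W.h 0 v) = W.h 0 (W.h 1 v) :=
    LinearMap.congr_fun (h_mul_h W.ρ 1 0) v
  obtain ⟨w, rfl⟩ := hsurj x
  obtain ⟨w₁, -, h1, e1⟩ := exists_eigenvector_lift hp.2 W.iSup_eigenspace_sigma hx.sigma
    (P := ⊤) (by simp) (Submodule.mem_top)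
  obtain ⟨w₂, h2, h3, e2⟩ := exists_eigenvector_lift (hp.1 (UH.gen ℓ (.h 0)))
    (hW.diagonalizable 0) (w := w₁) (c := c 0) (by rw [e1]; exact hx.h 0)
    (P := W.sigma.eigenspace t) (fun v hv => by
      rw [Module.End.mem_eigenspace_iff] at hv ⊢
      change W.sigma (W.h 0 v) = t • W.h 0 v
      rw [← hs, hv, map_smul]) (Module.End.mem_eigenspace_iff.2 h1)
  obtain ⟨w₃, h4, h5, e3⟩ := exists_eigenvector_lift (hp.1 (UH.gen ℓ (.h 1)))
    (hW.diagonalizable 1) (w := w₂) (c := c 1) (by rw [e2, e1]; exact hx.h 1)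
    (P := W.sigma.eigenspace t ⊓ (W.h 0).eigenspace (c 0)) (fun v hv => by
      simp only [Submodule.mem_inf, Module.End.mem_eigenspace_iff] at hv ⊢
      change W.sigma (W.h 1 v) = t • W.h 1 v ∧ W.h 0 (W.h 1 v) = c 0 • W.h 1 v
      rw [← hs, hv.1, map_smul, ← hh, hv.2, map_smul]
      exact ⟨rfl, rfl⟩) ⟨h2, Module.End.mem_eigenspace_iff.2 h3⟩
  simp only [Submodule.mem_inf, Module.End.mem_eigenspace_iff] at h4
  refine ⟨w₃, ⟨fun i => ?_, h4.1⟩, by rw [e3, e2, e1]⟩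
  fin_cases i
  · exact h4.2
  · exact h5

/-- A homomorphism from a typical module is determined by its value on a highest weight vector,
which may be any highest weight vector of the same weight. -/
theorem IsTypical.exists_hom (hℓ : 3 ≤ ℓ) (hodd : Odd ℓ) (hT : V.IsTypical)
    (hV : V.IsNilpotentWeight) (hW : W.IsNilpotentWeight) (hv : V.IsHighestWeightVector c t v)
    (hne : v ≠ 0) {w : W.carrier} (hw : W.IsHighestWeightVector c t w) :
    ∃ g ∈ SuperModule.homs V W, g v = w := by
  have := hV.finite
  have := hW.finite
  let Φ : UH ℓ →ₐ[ℂ] Module.End ℂ (V.carrier × W.carrier) :=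
    (LinearMap.prodMapAlgHom ℂ V.carrier W.carrier).comp (V.ρ.prod W.ρ)
  have hΦ (b : UH ℓ) (a : V.carrier) (d : W.carrier) : Φ b (a, d) = (V.ρ b a, W.ρ b d) := rfl
  let x : Fin 2 → Module.End ℂ (V.carrier × W.carrier) := fun i => Φ (UH.gen ℓ (.base (.f i)))
  let S : Module.End ℂ (V.carrier × W.carrier) := V.sigma.prodMap W.sigma
  -- The submodule of `V ⊕ W` generated by `(v, w)`; it turns out to be the graph of the
  -- homomorphism.
  let N := monomialSpan ℓ (xi ℓ) x (ℂ ∙ (v, w))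
  have hφ (y : Gen) : (Φ.comp (incl ℓ)) (U.gen ℓ y) = Φ (UH.gen ℓ (.base y)) := by
    rw [AlgHom.comp_apply, incl_gen]
  have hpow : Φ (UH.gen ℓ (.base (.f 0))) ^ ℓ = 0 := by
    rw [← map_pow]
    refine LinearMap.ext fun a => ?_
    change (V.ρ _ a.1, W.ρ _ a.2) = 0
    rw [map_pow, map_pow]
    change ((V.f 0 ^ ℓ) a.1, (W.f 0 ^ ℓ) a.2) = 0
    rw [hV.f_pow, hW.f_pow]
    rfl
  have hB : IsBorel ℓ (xi ℓ) x := by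
    have := isBorel_f (Φ.comp (incl ℓ)) hℓ hodd (by rw [hφ]; exact hpow)
    simp only [hφ] at this
    exact this
  have hvw : (v, w) ∈ N := hB.le_monomialSpan (Submodule.mem_span_singleton_self _)
  have hU : ∀ b : U ℓ, ∀ a ∈ N, Φ (incl ℓ b) a ∈ N := by
    have := monomialSpan_f_stable hℓ hodd (Φ.comp (incl ℓ)) (by rw [hφ]; exact hpow)
      (Z := ℂ ∙ (v, w))
      (fun i => by
        rw [hφ]
        refine forall_mem_span_singleton_of_eigenvector (a := xiPow ℓ (c i)) ?_
        rw [hΦ, Prod.smul_mk]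
        exact congrArg₂ Prod.mk (hV.k_apply hv.toIsWeightVector i)
          (hW.k_apply hw.toIsWeightVector i))
      (fun i => by
        rw [hφ]
        refine forall_mem_span_singleton_of_eigenvector (a := (xiPow ℓ (c i))⁻¹) ?_
        rw [hΦ, Prod.smul_mk]
        exact congrArg₂ Prod.mk (hV.kinv_apply hv.toIsWeightVector i)
          (hW.kinv_apply hw.toIsWeightVector i))
      (fun i => by
        rw [hφ]
        refine forall_mem_span_singleton_of_apply_eq_zero ?_
        rw [hΦ]
        exact congrArg₂ Prod.mk (hv.e i) (hw.e i))
    simp only [hφ] at this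
    exact this
  have hN : ∀ b : UH ℓ, ∀ a ∈ N, Φ b a ∈ N := by
    refine stable_of_adjoin (UH.adjoin_gen ℓ) Φ ?_
    rintro _ ⟨y, rfl⟩
    cases y with
    | base y => rw [← incl_gen]; exact hU _
    | h i =>
      intro a ha
      refine hB.monomialSpan_stable_of_commute _ 1 (fun j => -(cartan i j : ℂ))
        (fun j => by rw [Pi.one_apply, one_smul]; exact h_mul_f Φ i j)
        (forall_mem_span_singleton_of_eigenvector (a := c i) ?_) ha
      rw [hΦ, Prod.smul_mk]
      exact congrArg₂ Prod.mk (hv.h i) (hw.h i)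
  have hS : ∀ a ∈ N, S a ∈ N := by
    intro a ha
    refine hB.monomialSpan_stable_of_commute _ (fun j => sgn (Gen.parity (.f j))) 0 (fun j => ?_)
        (forall_mem_span_singleton_of_eigenvector (a := t) ?_) ha
    · refine LinearMap.ext fun a => ?_
      simp only [Pi.zero_apply, zero_smul, add_zero]
      exact congrArg₂ Prod.mk (LinearMap.congr_fun (V.sigma_mul_f j) a.1)
        (LinearMap.congr_fun (W.sigma_mul_f j) a.2)
    · change (V.sigma v, W.sigma w) = t • (v, w)
      rw [hv.sigma, hw.sigma, Prod.smul_mk]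
  let π : N →ₗ[ℂ] V.carrier := LinearMap.fst ℂ _ _ ∘ₗ N.subtype
  have hsurj : Function.Surjective π := by
    rw [← LinearMap.range_eq_top]
    refine hT.eq_top (v := v) ?_ ?_ ⟨⟨(v, w), hvw⟩, rfl⟩ hne
    · rintro b _ ⟨a, rfl⟩
      exact ⟨⟨_, hU b a a.2⟩, rfl⟩
    · rintro _ ⟨a, rfl⟩
      exact ⟨⟨_, hS a a.2⟩, rfl⟩
  have hle : Module.finrank ℂ N ≤ Module.finrank ℂ V.carrier := by
    rw [hT.2]
    refine finrank_monomialSpan_le.trans ?_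
    have := finrank_span_le_card (R := ℂ) ({(v, w)} : Set (V.carrier × W.carrier))
    simp only [Set.toFinset_singleton, Finset.card_singleton] at this
    calc _ ≤ 4 * ℓ * 1 := Nat.mul_le_mul_left _ this
      _ = _ := mul_one _
  -- `N` is spanned by the `4ℓ` monomials applied to one vector, and `V` has dimension exactly `4ℓ`,
  -- so the surjection `π` is injective. This is what makes `N` a graph.
  have hinj : Function.Injective π :=
    (LinearMap.injective_iff_surjective_of_finrank_eq_finrank
      (le_antisymm hle (LinearMap.finrank_le_finrank_of_surjective hsurj))).2 hsurj
  let ε : N ≃ₗ[ℂ] V.carrier := LinearEquiv.ofBijective π ⟨hinj, hsurj⟩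
  let g : V.carrier →ₗ[ℂ] W.carrier := LinearMap.snd ℂ _ _ ∘ₗ N.subtype ∘ₗ ε.symm.toLinearMap
  have hg (n : N) : g n.1.1 = n.1.2 := by
    change (ε.symm (ε n)).1.2 = n.1.2
    rw [ε.symm_apply_apply]
  refine ⟨g, SuperModule.mem_homs_iff.2 ⟨fun b a => ?_, fun a => ?_⟩, hg ⟨(v, w), hvw⟩⟩
  · obtain ⟨n, rfl⟩ := hsurj a
    exact (hg ⟨_, hN b n n.2⟩).trans (congrArg (W.ρ b) (hg n).symm)
  · obtain ⟨n, rfl⟩ := hsurj a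
    exact (hg ⟨_, hS n n.2⟩).trans (congrArg W.sigma (hg n).symm)

theorem IsTypical.hom_ext (hℓ : 3 ≤ ℓ) (hodd : Odd ℓ) (hT : V.IsTypical)
    (hV : V.IsNilpotentWeight) (hv : V.IsHighestWeightVector c t v) (hne : v ≠ 0)
    {f g : V.carrier →ₗ[ℂ] X.carrier} (hf : f ∈ SuperModule.homs V X)
    (hg : g ∈ SuperModule.homs V X) (h : f v = g v) : f = g := by
  rw [← LinearMap.eqLocus_eq_top, eq_top_iff, ← hT.monomialSpan_f hℓ hodd hV hv hne]
  refine monomialSpan_le ?_ fun j a ha => ?_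
  · rw [Submodule.span_singleton_le_iff_mem]; exact h
  · rw [LinearMap.mem_eqLocus] at ha ⊢
    exact (hf.1 _ a).trans ((congrArg _ ha).trans (hg.1 _ a).symm)

/-- Homomorphisms from a typical module lift along surjections. -/
theorem IsTypical.exists_lift (hℓ : 3 ≤ ℓ) (hodd : Odd ℓ) (hT : V.IsTypical)
    (hV : V.IsNilpotentWeight) (hW : W.IsNilpotentWeight) (f : V ⟶ X) (p : W ⟶ X)
    (hsurj : Function.Surjective p.1) : ∃ g : V ⟶ W, g ≫ p = f := by
  have hnt : Nontrivial V.carrier := hT.1.1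
  obtain ⟨c, t, v, hne, hv⟩ := hV.exists_highestWeightVector hℓ hodd
  have hf := SuperModule.mem_homs_iff.1 f.2
  have hx : X.IsWeightVector c t (f.1 v) :=
    ⟨fun i => (hf.1 _ v).symm.trans ((congrArg f.1 (hv.h i)).trans (map_smul f.1 _ _)),
      by rw [← hf.2, hv.sigma, map_smul]⟩
  obtain ⟨w, hw, hwx⟩ := hW.exists_weightVector_lift p.2 hsurj hx
  -- The lift `w` need not be killed by the `e i`. Both `v` and `w` are therefore replaced by their
  -- images under `E F`, an element of the algebra and so compatible with `f` and `p`; on `V` the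
  -- new vector is still nonzero.
  have hv' := hV.topE_topF_apply hℓ hodd hv.toIsWeightVector
  have hne' := hT.topE_topF_ne_zero hℓ hodd hV hv hne
  obtain ⟨g, hg, hgv⟩ := hT.exists_hom hℓ hodd hV hW hv' hne' (hW.topE_topF_apply hℓ hodd hw)
  refine ⟨⟨g, hg⟩, Subtype.ext (hT.hom_ext hℓ hodd hV hv' hne' (Subtype.property _) f.2 ?_)⟩
  change p.1 (g _) = f.1 _
  rw [hgv]
  simp only [topE_eq, topF_eq]
  rw [p.2.1, p.2.1, f.2.1, f.2.1, hwx]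

end UHModule

/-! ### Direct sums and simple objects in linear categories -/

section Linear

universe v u

variable {C : Type u} [Category.{v} C] [Preadditive C]

theorem isDirectSum_cons {W Q R : C} {s : Q ⟶ W} {p : W ⟶ Q} {t : R ⟶ W} {q : W ⟶ R}
    (sp : s ≫ p = 𝟙 Q) (tq : t ≫ q = 𝟙 R) (sq : s ≫ q = 0) (tp : t ≫ p = 0)
    (h1 : p ≫ s + q ≫ t = 𝟙 W) {n : ℕ} {S : Fin n → C} (h : IsDirectSum R S) :
    IsDirectSum W (Fin.cons Q S : Fin (n + 1) → C) := by
  obtain ⟨f, g, hfg, hne, hsum⟩ := h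
  refine ⟨fun i => Fin.cases (motive := fun i => (Fin.cons Q S : Fin (n + 1) → C) i ⟶ W)
      s (fun i => f i ≫ t) i,
    fun i => Fin.cases (motive := fun i => W ⟶ (Fin.cons Q S : Fin (n + 1) → C) i)
      p (fun i => q ≫ g i) i, ?_, ?_, ?_⟩
  · intro i
    induction i using Fin.cases with
    | zero => exact sp
    | succ i =>
      change (f i ≫ t) ≫ q ≫ g i = 𝟙 (S i)
      rw [Category.assoc, reassoc_of% tq, hfg]
  · intro i j hij
    induction i using Fin.cases with
    | zero =>
      induction j using Fin.cases with
      | zero => exact absurd rfl hij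
      | succ j =>
        change s ≫ q ≫ g j = 0
        rw [reassoc_of% sq, Limits.zero_comp]
    | succ i =>
      induction j using Fin.cases with
      | zero =>
        change (f i ≫ t) ≫ p = 0
        rw [Category.assoc, tp, Limits.comp_zero]
      | succ j =>
        change (f i ≫ t) ≫ q ≫ g j = 0
        rw [Category.assoc, reassoc_of% tq, hne i j fun h => hij (congrArg Fin.succ h)]
  · rw [Fin.sum_univ_succ]
    change p ≫ s + ∑ i : Fin n, (q ≫ g i) ≫ f i ≫ t = 𝟙 W
    rw [← h1]
    congr 1
    have : ∀ i, (q ≫ g i) ≫ f i ≫ t = q ≫ (g i ≫ f i) ≫ t := fun i => by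
      simp only [Category.assoc]
    simp only [this]
    rw [← Preadditive.comp_sum, ← Preadditive.sum_comp, hsum, Category.id_comp]

variable [Linear ℂ C]

theorem isSimpleObject_of_forall {V : C} (h0 : 𝟙 V ≠ 0) (h : ∀ f : V ⟶ V, ∃ c : ℂ, f = c • 𝟙 V) :
    IsSimpleObject V := by
  have : Nontrivial (End V) := ⟨⟨𝟙 V, 0, h0⟩⟩
  refine ⟨(AlgEquiv.ofBijective (Algebra.ofId ℂ (End V)) ⟨(Algebra.ofId ℂ (End V)).injective,
    fun f => ?_⟩).symm⟩
  obtain ⟨c, hc⟩ := h f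
  exact ⟨c, by rw [Algebra.ofId_apply, Algebra.algebraMap_eq_smul_one]; exact hc.symm⟩

theorem IsSimpleObject.id_ne_zero {V : C} (h : IsSimpleObject V) : 𝟙 V ≠ 0 := by
  obtain ⟨e⟩ := h
  intro h0
  have h1 : (1 : End V) = 0 := h0
  have h2 := congrArg e h1
  rw [map_one, map_zero] at h2
  exact one_ne_zero h2

theorem IsSimpleObject.eq_zero_or_id {V : C} (h : IsSimpleObject V) (f : V ⟶ V) (hf : f ≫ f = f) :
    f = 0 ∨ f = 𝟙 V := by
  obtain ⟨e⟩ := h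
  have h1 : e (f : End V) * e f = e f := by
    rw [← map_mul]; exact congrArg e hf
  rcases eq_or_ne (e f) 0 with h | h
  · exact Or.inl (e.injective (h.trans (map_zero e).symm))
  · exact Or.inr (e.injective ((mul_right_cancel₀ h (h1.trans (one_mul _).symm)).trans (map_one e).symm))

end Linear

/-! ### Morphisms between irreducible supermodules -/

namespace SuperModule

variable {B : Type} [Ring B] [Algebra ℂ B] {P : ZMod 2 → Submodule ℂ B} {V W X : SuperModule B P}

theorem IsIrreducible.of_bijective (hW : W.IsIrreducible) {p : V.carrier →ₗ[ℂ] W.carrier}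
    (hp : p ∈ homs V W) (hb : Function.Bijective p) : V.IsIrreducible := by
  rw [isIrreducible_iff] at hW ⊢
  rw [mem_homs_iff] at hp
  have := hW.1
  refine ⟨hb.2.nontrivial, fun N hN hs => ?_⟩
  refine (hW.2 (N.map p) ?_ ?_).imp (fun h => ?_) (fun h => ?_)
  · rintro b _ ⟨v, hv, rfl⟩
    exact ⟨_, hN b v hv, hp.1 b v⟩
  · rintro _ ⟨v, hv, rfl⟩
    exact ⟨_, hs v hv, hp.2 v⟩
  · rw [← Submodule.comap_map_eq_of_injective hb.1 N, h, Submodule.comap_bot,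
      LinearMap.ker_eq_bot.2 hb.1]
  · rw [← Submodule.comap_map_eq_of_injective hb.1 N, h, Submodule.comap_top]

theorem exists_desc (N : Submodule ℂ V.carrier) (hN : ∀ (b : B), ∀ v ∈ N, V.ρ b v ∈ N)
    (hs : ∀ v ∈ N, V.sigma v ∈ N) (f : V ⟶ X) (hf : N ≤ LinearMap.ker f.1) :
    ∃ t : V.quotient N hN hs ⟶ X, V.proj N hN hs ≫ t = f := by
  let t : (V.quotient N hN hs).carrier →ₗ[ℂ] X.carrier := N.liftQ f.1 hf
  have ht (v : V.carrier) : t (V.mkQ N hN hs v) = f.1 v := N.liftQ_apply _ _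
  have hf' := mem_homs_iff.1 f.2
  refine ⟨⟨t, mem_homs_iff.2 ⟨fun b v => ?_, fun v => ?_⟩⟩, Subtype.ext (LinearMap.ext ht)⟩
  · obtain ⟨v, rfl⟩ := V.mkQ_surjective N hN hs v
    rw [← mkQ_rho, ht, ht, hf'.1]
  · obtain ⟨v, rfl⟩ := V.mkQ_surjective N hN hs v
    rw [← mkQ_sigma, ht, ht, hf'.2]

theorem ker_stable (f : V ⟶ X) : (∀ (b : B), ∀ v ∈ LinearMap.ker f.1, V.ρ b v ∈ LinearMap.ker f.1) ∧
    ∀ v ∈ LinearMap.ker f.1, V.sigma v ∈ LinearMap.ker f.1 := by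
  have hf := mem_homs_iff.1 f.2
  refine ⟨fun b v hv => ?_, fun v hv => ?_⟩
  · rw [LinearMap.mem_ker] at hv ⊢
    rw [hf.1, hv, map_zero]
  · rw [LinearMap.mem_ker] at hv ⊢
    rw [hf.2, hv, map_zero]

theorem range_stable (f : V ⟶ X) :
    (∀ (b : B), ∀ v ∈ LinearMap.range f.1, X.ρ b v ∈ LinearMap.range f.1) ∧
    ∀ v ∈ LinearMap.range f.1, X.sigma v ∈ LinearMap.range f.1 := by
  have hf := mem_homs_iff.1 f.2
  refine ⟨?_, ?_⟩
  · rintro b _ ⟨v, rfl⟩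
    exact ⟨_, hf.1 b v⟩
  · rintro _ ⟨v, rfl⟩
    exact ⟨_, hf.2 v⟩

theorem IsIrreducible.bijective (hV : V.IsIrreducible) (hX : X.IsIrreducible) {f : V ⟶ X}
    (hf : f.1 ≠ 0) : Function.Bijective f.1 := by
  rw [isIrreducible_iff] at hV hX
  refine ⟨?_, ?_⟩
  · rw [← LinearMap.ker_eq_bot]
    refine (hV.2 _ (ker_stable f).1 (ker_stable f).2).resolve_right fun h => hf ?_
    exact LinearMap.ker_eq_top.1 h
  · rw [← LinearMap.range_eq_top]
    refine (hX.2 _ (range_stable f).1 (range_stable f).2).resolve_left fun h => hf ?_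
    exact LinearMap.range_eq_bot.1 h

theorem exists_inverse {f : V ⟶ X} (hf : Function.Bijective f.1) :
    ∃ g : X ⟶ V, f ≫ g = 𝟙 V ∧ g ≫ f = 𝟙 X := by
  let ε : V.carrier ≃ₗ[ℂ] X.carrier := LinearEquiv.ofBijective f.1 hf
  have h1 (v : V.carrier) : ε.symm (f.1 v) = v := ε.symm_apply_apply v
  have h2 (x : X.carrier) : f.1 (ε.symm x) = x := ε.apply_symm_apply x
  have hf' := mem_homs_iff.1 f.2
  refine ⟨⟨ε.symm.toLinearMap, mem_homs_iff.2 ⟨fun b x => ?_, fun x => ?_⟩⟩,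
    Subtype.ext (LinearMap.ext h1), Subtype.ext (LinearMap.ext h2)⟩
  · obtain ⟨v, rfl⟩ := hf.2 x
    rw [← hf'.1, LinearEquiv.coe_coe, h1, h1]
  · obtain ⟨v, rfl⟩ := hf.2 x
    rw [← hf'.2, LinearEquiv.coe_coe, h1, h1]

/-- **Schur's lemma**. -/
theorem IsIrreducible.exists_eq_smul [FiniteDimensional ℂ V.carrier] (hV : V.IsIrreducible)
    (f : V ⟶ V) : ∃ c : ℂ, f = c • 𝟙 V := by
  have := hV.1
  obtain ⟨c, hc⟩ := Module.End.exists_eigenvalue f.1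
  refine ⟨c, ?_⟩
  rw [← sub_eq_zero]
  by_contra h
  have h1 := (hV.bijective hV (f := f - c • 𝟙 V) fun h0 => h (Subtype.ext h0)).1
  obtain ⟨v, hv⟩ := hc.exists_hasEigenvector
  refine hv.2 (h1 ?_)
  rw [map_zero]
  change f.1 v - c • v = 0
  rw [hv.apply_eq_smul, sub_self]

end SuperModule

/-! ### Quotients of nilpotent weight modules -/

namespace UHModule

variable {ℓ : ℕ} {V X : UHModule ℓ}

theorem IsNilpotentWeight.of_surjective (hV : V.IsNilpotentWeight)
    {p : V.carrier →ₗ[ℂ] X.carrier} (hp : p ∈ SuperModule.homs V X)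
    (hsurj : Function.Surjective p) : X.IsNilpotentWeight := by
  have := hV.finite
  have hpow (y : UH ℓ) (h : V.ρ y ^ ℓ = 0) : X.ρ y ^ ℓ = 0 := by
    refine LinearMap.ext fun x => ?_
    obtain ⟨v, rfl⟩ := hsurj x
    rw [← map_pow] at h ⊢
    rw [← hp.1, h, LinearMap.zero_apply, LinearMap.zero_apply, map_zero]
  refine ⟨Module.Finite.of_surjective p hsurj, hpow _ hV.e_pow, hpow _ hV.f_pow, fun i => ?_,
    fun i c x hx => ?_⟩
  · have h := congrArg (Submodule.map p) (hV.diagonalizable i)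
    rw [Submodule.map_top, LinearMap.range_eq_top.2 hsurj, Submodule.map_iSup] at h
    rw [eq_top_iff, ← h]
    refine iSup_mono fun c => ?_
    rintro _ ⟨v, hv, rfl⟩
    rw [Module.End.mem_eigenspace_iff]
    exact (hp.1 _ v).symm.trans ((congrArg p (Module.End.mem_eigenspace_iff.1 hv)).trans
      (map_smul p c v))
  · obtain ⟨v, rfl⟩ := hsurj x
    -- The identity `k i = ξ ^ (h i)` is known on eigenvectors upstairs only, so the eigenvector
    -- downstairs is first lifted to one.
    obtain ⟨w, -, hw, hwv⟩ := exists_eigenvector_lift (hp.1 (UH.gen ℓ (.h i)))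
      (hV.diagonalizable i) hx (P := ⊤) (by simp) Submodule.mem_top
    rw [← hwv]
    exact (hp.1 _ w).symm.trans ((congrArg p (hV.k_eq i c w hw)).trans (map_smul p _ w))

theorem HasWeightsIn.of_surjective (hV : V.IsNilpotentWeight) {g : G} (hg : V.HasWeightsIn g)
    {p : V.carrier →ₗ[ℂ] X.carrier} (hp : p ∈ SuperModule.homs V X)
    (hsurj : Function.Surjective p) : X.HasWeightsIn g := by
  have := hV.finite
  intro c x hne hx
  obtain ⟨v, rfl⟩ := hsurj x
  have hh (v : V.carrier) : V.h 1 (V.h 0 v) = V.h 0 (V.h 1 v) :=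
    LinearMap.congr_fun (h_mul_h V.ρ 1 0) v
  obtain ⟨w, -, h0, e0⟩ := exists_eigenvector_lift (hp.1 (UH.gen ℓ (.h 0)))
    (hV.diagonalizable 0) (hx 0) (P := ⊤) (by simp) Submodule.mem_top
  obtain ⟨u, hu, h1, e1⟩ := exists_eigenvector_lift (hp.1 (UH.gen ℓ (.h 1)))
    (hV.diagonalizable 1) (w := w) (c := c 1) (by rw [e0]; exact hx 1)
    (P := (V.h 0).eigenspace (c 0)) (fun v hv => by
      rw [Module.End.mem_eigenspace_iff] at hv ⊢
      exact (hh v).symm.trans ((congrArg _ hv).trans (map_smul _ _ _)))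
    (Module.End.mem_eigenspace_iff.2 h0)
  refine hg c u (fun h => hne ?_) fun i => ?_
  · rw [← e0, ← e1, h, map_zero]
  · fin_cases i
    · exact Module.End.mem_eigenspace_iff.1 hu
    · exact h1

end UHModule

/-! ### Projectivity and semisimplicity -/

section Categories

variable {ℓ : ℕ}

/-- A typical module is projective. -/
theorem projective_of_isTypical (hℓ : 3 ≤ ℓ) (hodd : Odd ℓ) (V : CH ℓ) (hV : V.obj.IsTypical) :
    Projective V := by
  refine ⟨fun {W X} f p hp => ?_⟩
  -- Epimorphisms are surjective: the projection of `X` onto its quotient by the range of `p` is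
  -- zero after composing with `p`, hence zero.
  have hsurj : Function.Surjective p.hom.1 := by
    have hs := SuperModule.range_stable p.hom
    let Q : CH ℓ := ⟨X.obj.quotient _ hs.1 hs.2, X.property.of_surjective
      (SuperModule.mkQ_mem_homs _ _ _ _) (SuperModule.mkQ_surjective _ _ _ _)⟩
    let q : X ⟶ Q := ObjectProperty.homMk (X.obj.proj _ hs.1 hs.2)
    have hq : q = 0 := by
      rw [← cancel_epi p, Limits.comp_zero]
      refine ObjectProperty.hom_ext _ (Subtype.ext (LinearMap.ext fun w => ?_))
      change X.obj.mkQ _ hs.1 hs.2 (p.hom.1 w) = 0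
      rw [← LinearMap.mem_ker, SuperModule.ker_mkQ]
      exact ⟨w, rfl⟩
    rw [← LinearMap.range_eq_top, Submodule.eq_top_iff']
    intro x
    rw [← SuperModule.ker_mkQ X.obj _ hs.1 hs.2]
    exact LinearMap.congr_fun (congrArg (fun r : X ⟶ Q => r.hom.1) hq) x
  obtain ⟨g, hg⟩ := hV.exists_lift hℓ hodd V.property W.property f.hom p.hom hsurj
  exact ⟨ObjectProperty.homMk g, ObjectProperty.hom_ext _ hg⟩

variable {g : G}

theorem CHPiece.hom_ext {V W : CHPiece ℓ g} {f f' : V ⟶ W}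
    (h : ∀ v, f.hom.1 v = f'.hom.1 v) : f = f' :=
  ObjectProperty.hom_ext _ (Subtype.ext (LinearMap.ext h))

theorem CHPiece.cancel_surjective {V W X : CHPiece ℓ g} {p : V ⟶ W}
    (hp : Function.Surjective p.hom.1) {f f' : W ⟶ X} (h : p ≫ f = p ≫ f') : f = f' := by
  refine CHPiece.hom_ext fun w => ?_
  obtain ⟨v, rfl⟩ := hp w
  exact LinearMap.congr_fun (congrArg (fun r : V ⟶ X => r.hom.1) h) v

/-- The quotient of an object of `𝒞^H_g`. -/
noncomputable def CHPiece.quotient (W : CHPiece ℓ g) (N : Submodule ℂ W.obj.carrier)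
    (hN : ∀ (b : UH ℓ), ∀ v ∈ N, W.obj.ρ b v ∈ N) (hs : ∀ v ∈ N, W.obj.sigma v ∈ N) :
    CHPiece ℓ g :=
  ⟨W.obj.quotient N hN hs, W.property.1.of_surjective (SuperModule.mkQ_mem_homs _ _ _ _)
    (SuperModule.mkQ_surjective _ _ _ _), W.property.2.of_surjective W.property.1
    (SuperModule.mkQ_mem_homs _ _ _ _) (SuperModule.mkQ_surjective _ _ _ _)⟩

theorem CHPiece.isSimpleObject (V : CHPiece ℓ g) (hV : V.obj.IsIrreducible) :
    IsSimpleObject V := by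
  have := hV.1
  have := V.property.1.finite
  refine isSimpleObject_of_forall (fun h => ?_) fun f => ?_
  · obtain ⟨v, hv⟩ := exists_ne (0 : V.obj.carrier)
    exact hv (LinearMap.congr_fun (congrArg (fun r : V ⟶ V => r.hom.1) h) v)
  · obtain ⟨c, hc⟩ := hV.exists_eq_smul f.hom
    exact ⟨c, ObjectProperty.hom_ext _ hc⟩

/-- If the irreducible objects are typical, then every nonzero object has an irreducible direct
summand. -/
theorem CHPiece.exists_retract (hℓ : 3 ≤ ℓ) (hodd : Odd ℓ)
    (H : ∀ V : CHPiece ℓ g, V.obj.IsIrreducible → V.obj.IsTypical)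
    (W : CHPiece ℓ g) [Nontrivial W.obj.carrier] :
    ∃ (Q : CHPiece ℓ g) (p : W ⟶ Q) (s : Q ⟶ W), Q.obj.IsIrreducible ∧ s ≫ p = 𝟙 Q := by
  have := W.property.1.finite
  obtain ⟨N, hN, hs, hQ⟩ := W.obj.exists_irreducible_quotient
  let Q : CHPiece ℓ g := W.quotient N hN hs
  obtain ⟨s, hs⟩ := (H Q hQ).exists_lift hℓ hodd Q.property.1 W.property.1 (𝟙 Q.obj)
    (W.obj.proj N hN hs) (SuperModule.mkQ_surjective _ _ _ _)
  exact ⟨Q, ObjectProperty.homMk (W.obj.proj N hN _), ObjectProperty.homMk s, hQ,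
    ObjectProperty.hom_ext _ hs⟩

/-- A nonzero `V` has an irreducible retract `Q`, and the idempotent `p ≫ s` lies in `End V ≅ ℂ`, so
it is `0` or `1`. It is not `0` because `Q ≠ 0`; hence `V` is isomorphic to `Q`. -/
theorem CHPiece.isIrreducible_of_isSimpleObject (hℓ : 3 ≤ ℓ) (hodd : Odd ℓ)
    (H : ∀ V : CHPiece ℓ g, V.obj.IsIrreducible → V.obj.IsTypical)
    (V : CHPiece ℓ g) (hV : IsSimpleObject V) :
    V.obj.IsIrreducible := by
  have hnt : Nontrivial V.obj.carrier := by
    rw [← not_subsingleton_iff_nontrivial]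
    intro h
    exact hV.id_ne_zero (CHPiece.hom_ext fun v => Subsingleton.elim _ _)
  obtain ⟨Q, p, s, hQ, hsp⟩ := CHPiece.exists_retract hℓ hodd H V
  have h2 : (p ≫ s) ≫ p ≫ s = p ≫ s := by
    rw [Category.assoc, reassoc_of% hsp]
  have h1 : p ≫ s = 𝟙 V := by
    refine (hV.eq_zero_or_id _ h2).resolve_left fun h0 => ?_
    refine (CHPiece.isSimpleObject Q hQ).id_ne_zero ?_
    have h3 : s ≫ p ≫ s ≫ p = 0 := by
      rw [reassoc_of% h0, Limits.zero_comp, Limits.comp_zero]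
    rwa [reassoc_of% hsp, hsp] at h3
  have e1 (v : V.obj.carrier) : s.hom.1 (p.hom.1 v) = v :=
    LinearMap.congr_fun (congrArg (fun r : V ⟶ V => r.hom.1) h1) v
  have e2 (x : Q.obj.carrier) : p.hom.1 (s.hom.1 x) = x :=
    LinearMap.congr_fun (congrArg (fun r : Q ⟶ Q => r.hom.1) hsp) x
  exact hQ.of_bijective p.hom.2
    ⟨Function.LeftInverse.injective e1, Function.RightInverse.surjective e2⟩

/-- Induction on the dimension: an irreducible retract `Q` splits off, and its complement is
realised as the quotient of `W` by the image of `Q`, so that only quotients have to be known to stay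
in the category. -/
theorem CHPiece.exists_isDirectSum (hℓ : 3 ≤ ℓ) (hodd : Odd ℓ)
    (H : ∀ V : CHPiece ℓ g, V.obj.IsIrreducible → V.obj.IsTypical)
    (n : ℕ) : ∀ W : CHPiece ℓ g,
    Module.finrank ℂ W.obj.carrier ≤ n →
    ∃ (m : ℕ) (S : Fin m → CHPiece ℓ g), (∀ i, IsSimpleObject (S i)) ∧ IsDirectSum W S := by
  induction n with
  | zero =>
    intro W hW
    have := W.property.1.finite
    have := Module.finrank_zero_iff.1 (Nat.le_zero.1 hW)
    exact ⟨0, Fin.elim0, fun i => i.elim0, fun i => i.elim0, fun i => i.elim0, fun i => i.elim0,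
      fun i => i.elim0, CHPiece.hom_ext fun v => Subsingleton.elim _ _⟩
  | succ n ih =>
    intro W hW
    have := W.property.1.finite
    rcases subsingleton_or_nontrivial W.obj.carrier with hsub | hnt
    · exact ih W (by rw [Module.finrank_zero_of_subsingleton]; exact Nat.zero_le _)
    obtain ⟨Q, p, s, hQ, hsp⟩ := CHPiece.exists_retract hℓ hodd H W
    have hst := SuperModule.range_stable s.hom
    let R : CHPiece ℓ g := W.quotient _ hst.1 hst.2
    let q : W ⟶ R := ObjectProperty.homMk (W.obj.proj _ hst.1 hst.2)
    have hq : Function.Surjective q.hom.1 := SuperModule.mkQ_surjective _ _ hst.1 hst.2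
    have sq : s ≫ q = 0 := CHPiece.hom_ext fun x => by
      change W.obj.mkQ _ hst.1 hst.2 (s.hom.1 x) = 0
      rw [← LinearMap.mem_ker, SuperModule.ker_mkQ]
      exact ⟨x, rfl⟩
    have hs1 : s ≫ (𝟙 W - p ≫ s) = 0 := by
      rw [Preadditive.comp_sub, reassoc_of% hsp, Category.comp_id, sub_self]
    -- The complementary idempotent kills the image of `s`, hence factors through `R`; the factor
    -- `t` is the inclusion of the complement.
    obtain ⟨t, ht⟩ := SuperModule.exists_desc _ hst.1 hst.2 (𝟙 W - p ≫ s).hom (by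
      rintro _ ⟨x, rfl⟩
      exact LinearMap.congr_fun (congrArg (fun r : Q ⟶ W => r.hom.1) hs1) x)
    let t' : R ⟶ W := ObjectProperty.homMk t
    have qt : q ≫ t' = 𝟙 W - p ≫ s := ObjectProperty.hom_ext _ ht
    have hlt : Module.finrank ℂ R.obj.carrier ≤ n := by
      have h1 : Module.finrank ℂ R.obj.carrier + Module.finrank ℂ (LinearMap.range s.hom.1) =
        Module.finrank ℂ W.obj.carrier := Submodule.finrank_quotient_add_finrank _
      have h2 : 0 < Module.finrank ℂ (LinearMap.range s.hom.1) := by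
        rw [Module.finrank_pos_iff, Submodule.nontrivial_iff_ne_bot]
        intro h
        refine (CHPiece.isSimpleObject Q hQ).id_ne_zero ?_
        rw [← hsp, show s = 0 from ObjectProperty.hom_ext _ (Subtype.ext
          (LinearMap.range_eq_bot.1 h)), Limits.zero_comp]
      omega
    obtain ⟨m, S, hS, hR⟩ := ih R hlt
    refine ⟨m + 1, Fin.cons Q S, fun i => ?_, isDirectSum_cons (t := t') (q := q) hsp ?_ sq ?_ ?_ hR⟩
    · induction i using Fin.cases with
      | zero => exact CHPiece.isSimpleObject Q hQ
      | succ i => exact hS i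
    · refine CHPiece.cancel_surjective hq ?_
      rw [reassoc_of% qt, Preadditive.sub_comp, Category.assoc, sq]
      simp
    · refine CHPiece.cancel_surjective hq ?_
      rw [reassoc_of% qt, Preadditive.sub_comp, Category.assoc, hsp]
      simp
    · rw [qt]; abel

theorem CHPiece.isSemisimpleCategory (hℓ : 3 ≤ ℓ) (hodd : Odd ℓ)
    (H : ∀ V : CHPiece ℓ g, V.obj.IsIrreducible → V.obj.IsTypical) :
    IsSemisimpleCategory (CHPiece ℓ g) := by
  refine ⟨fun W => CHPiece.exists_isDirectSum hℓ hodd H _ W le_rfl, fun V W hV hW hVW f => ?_⟩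
  by_contra hf
  have hb := (CHPiece.isIrreducible_of_isSimpleObject hℓ hodd H V hV).bijective
    (CHPiece.isIrreducible_of_isSimpleObject hℓ hodd H W hW) (f := f.hom)
    fun h => hf (ObjectProperty.hom_ext _ (Subtype.ext h))
  obtain ⟨k, h1, h2⟩ := SuperModule.exists_inverse hb
  exact hVW.false ⟨f, ObjectProperty.homMk k, ObjectProperty.hom_ext _ h1,
    ObjectProperty.hom_ext _ h2⟩

end Categories

/-! ### The Kac modules -/

namespace Kac

variable (ℓ : ℕ) (μ : Fin 2 → ℂ)

/-- The quantum number `[x]`. -/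
noncomputable def qnum (x : ℂ) : ℂ := (xi ℓ - (xi ℓ)⁻¹)⁻¹ * (xiPow ℓ x - xiPow ℓ (-x))

/-- Diagonal operators. -/
def diag {I : Type} (c : I → ℂ) : Module.End ℂ (I → ℂ) where
  toFun v a := c a * v a
  map_add' v w := by ext a; simp [mul_add]
  map_smul' r v := by ext a; simp [mul_left_comm]

@[simp] theorem diag_apply {I : Type} (c : I → ℂ) (v : I → ℂ) (a : I) :
    diag c v a = c a * v a := rfl

/-- The raising operator on the `ℓ`-dimensional Verma module of the even part. -/
noncomputable def E : Module.End ℂ (Fin ℓ → ℂ) where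
  toFun v a := if h : (a : ℕ) + 1 < ℓ then
    qnum ℓ ((a : ℕ) + 1) * qnum ℓ (μ 0 - (a : ℕ)) * v ⟨a + 1, h⟩ else 0
  map_add' v w := by ext a; by_cases h : (a : ℕ) + 1 < ℓ <;> simp [h, mul_add]
  map_smul' r v := by ext a; by_cases h : (a : ℕ) + 1 < ℓ <;> simp [h, mul_left_comm]

/-- The lowering operator on the `ℓ`-dimensional Verma module of the even part. -/
def F : Module.End ℂ (Fin ℓ → ℂ) where
  toFun v a := if 0 < (a : ℕ) then v ⟨a - 1, by omega⟩ else 0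
  map_add' v w := by ext a; by_cases h : 0 < (a : ℕ) <;> simp [h]
  map_smul' r v := by ext a; by_cases h : 0 < (a : ℕ) <;> simp [h]

/-- The weights of the `ℓ`-dimensional Verma module of the even part. -/
def evenWeight : Fin 2 → Fin ℓ → ℂ := ![fun a => μ 0 - 2 * (a : ℕ), fun a => μ 1 + (a : ℕ)]

/-- The operators of the Cartan part. -/
def H (i : Fin 2) : Module.End ℂ (Fin ℓ → ℂ) := diag (evenWeight ℓ μ i)

/-- Their exponentials. -/
noncomputable def K (i : Fin 2) : Module.End ℂ (Fin ℓ → ℂ) :=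
  diag fun a => xiPow ℓ (evenWeight ℓ μ i a)

/-- The inverses of the exponentials. -/
noncomputable def K' (i : Fin 2) : Module.End ℂ (Fin ℓ → ℂ) :=
  diag fun a => xiPow ℓ (-evenWeight ℓ μ i a)

variable {ℓ μ}

theorem diag_E {c : Fin ℓ → ℂ} {r s : ℂ}
    (h : ∀ (a : Fin ℓ) (h : (a : ℕ) + 1 < ℓ), c a = r * c ⟨a + 1, h⟩ + s) (v : Fin ℓ → ℂ) :
    diag c (E ℓ μ v) = r • E ℓ μ (diag c v) + s • E ℓ μ v := by
  ext a
  simp only [diag_apply, E, LinearMap.coe_mk, AddHom.coe_mk, Pi.add_apply, Pi.smul_apply,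
    smul_eq_mul]
  split_ifs with ha
  · rw [h a ha]; ring
  · ring

theorem diag_F {c : Fin ℓ → ℂ} {r s : ℂ}
    (h : ∀ (a : Fin ℓ), 0 < (a : ℕ) → c a = r * c ⟨a - 1, by omega⟩ + s) (v : Fin ℓ → ℂ) :
    diag c (F ℓ v) = r • F ℓ (diag c v) + s • F ℓ v := by
  ext a
  simp only [diag_apply, F, LinearMap.coe_mk, AddHom.coe_mk, Pi.add_apply, Pi.smul_apply,
    smul_eq_mul]
  split_ifs with ha
  · rw [h a ha]; ring
  · ring

theorem xiPow_two : xiPow ℓ 2 = xi ℓ ^ 2 := by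
  exact_mod_cast xiPow_natCast (ℓ := ℓ) 2

theorem xiPow_one : xiPow ℓ 1 = xi ℓ := rfl

theorem H0_E (v : Fin ℓ → ℂ) : H ℓ μ 0 (E ℓ μ v) = E ℓ μ (H ℓ μ 0 v) + (2 : ℂ) • E ℓ μ v := by
  rw [H, diag_E (r := 1) (s := 2), one_smul]
  intro a h
  simp [evenWeight]; ring

theorem H1_E (v : Fin ℓ → ℂ) : H ℓ μ 1 (E ℓ μ v) = E ℓ μ (H ℓ μ 1 v) + (-1 : ℂ) • E ℓ μ v := by
  rw [H, diag_E (r := 1) (s := -1), one_smul]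
  intro a h
  simp [evenWeight]; ring

theorem H0_F (v : Fin ℓ → ℂ) : H ℓ μ 0 (F ℓ v) = F ℓ (H ℓ μ 0 v) + (-2 : ℂ) • F ℓ v := by
  rw [H, diag_F (r := 1) (s := -2), one_smul]
  intro a h
  simp [evenWeight, Nat.cast_sub (show 1 ≤ (a : ℕ) from h)]; ring

theorem H1_F (v : Fin ℓ → ℂ) : H ℓ μ 1 (F ℓ v) = F ℓ (H ℓ μ 1 v) + (1 : ℂ) • F ℓ v := by
  rw [H, diag_F (r := 1) (s := 1), one_smul]
  intro a h
  simp [evenWeight, Nat.cast_sub (show 1 ≤ (a : ℕ) from h)]; ring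

theorem K0_E (v : Fin ℓ → ℂ) : K ℓ μ 0 (E ℓ μ v) = xi ℓ ^ 2 • E ℓ μ (K ℓ μ 0 v) := by
  rw [K, diag_E (r := xi ℓ ^ 2) (s := 0), zero_smul, add_zero]
  intro a h
  rw [add_zero, ← xiPow_two, ← xiPow_add]
  congr 1
  simp [evenWeight]; ring

theorem K0'_E (v : Fin ℓ → ℂ) : K' ℓ μ 0 (E ℓ μ v) = (xi ℓ ^ 2)⁻¹ • E ℓ μ (K' ℓ μ 0 v) := by
  rw [K', diag_E (r := (xi ℓ ^ 2)⁻¹) (s := 0), zero_smul, add_zero]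
  intro a h
  rw [add_zero, ← xiPow_two, ← xiPow_neg, ← xiPow_add]
  congr 1
  simp [evenWeight]; ring

theorem K1_E (v : Fin ℓ → ℂ) : K ℓ μ 1 (E ℓ μ v) = (xi ℓ)⁻¹ • E ℓ μ (K ℓ μ 1 v) := by
  rw [K, diag_E (r := (xi ℓ)⁻¹) (s := 0), zero_smul, add_zero]
  intro a h
  rw [add_zero, ← xiPow_one, ← xiPow_neg, ← xiPow_add]
  congr 1
  simp [evenWeight]; ring

theorem K1'_E (v : Fin ℓ → ℂ) : K' ℓ μ 1 (E ℓ μ v) = xi ℓ • E ℓ μ (K' ℓ μ 1 v) := by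
  rw [K', diag_E (r := xi ℓ) (s := 0), zero_smul, add_zero]
  intro a h
  rw [add_zero, ← xiPow_one, ← xiPow_add]
  congr 1
  simp [evenWeight]; ring

theorem K0_F (v : Fin ℓ → ℂ) : K ℓ μ 0 (F ℓ v) = (xi ℓ ^ 2)⁻¹ • F ℓ (K ℓ μ 0 v) := by
  rw [K, diag_F (r := (xi ℓ ^ 2)⁻¹) (s := 0), zero_smul, add_zero]
  intro a h
  rw [add_zero, ← xiPow_two, ← xiPow_neg, ← xiPow_add]
  congr 1
  simp [evenWeight, Nat.cast_sub (show 1 ≤ (a : ℕ) from h)]; ring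

theorem K0'_F (v : Fin ℓ → ℂ) : K' ℓ μ 0 (F ℓ v) = xi ℓ ^ 2 • F ℓ (K' ℓ μ 0 v) := by
  rw [K', diag_F (r := xi ℓ ^ 2) (s := 0), zero_smul, add_zero]
  intro a h
  rw [add_zero, ← xiPow_two, ← xiPow_add]
  congr 1
  simp [evenWeight, Nat.cast_sub (show 1 ≤ (a : ℕ) from h)]; ring

theorem K1_F (v : Fin ℓ → ℂ) : K ℓ μ 1 (F ℓ v) = xi ℓ • F ℓ (K ℓ μ 1 v) := by
  rw [K, diag_F (r := xi ℓ) (s := 0), zero_smul, add_zero]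
  intro a h
  rw [add_zero, ← xiPow_one, ← xiPow_add]
  congr 1
  simp [evenWeight, Nat.cast_sub (show 1 ≤ (a : ℕ) from h)]; ring

theorem K1'_F (v : Fin ℓ → ℂ) : K' ℓ μ 1 (F ℓ v) = (xi ℓ)⁻¹ • F ℓ (K' ℓ μ 1 v) := by
  rw [K', diag_F (r := (xi ℓ)⁻¹) (s := 0), zero_smul, add_zero]
  intro a h
  rw [add_zero, ← xiPow_one, ← xiPow_neg, ← xiPow_add]
  congr 1
  simp [evenWeight, Nat.cast_sub (show 1 ≤ (a : ℕ) from h)]; ring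

theorem diag_diag {I : Type} (c d : I → ℂ) (v : I → ℂ) : diag c (diag d v) = diag d (diag c v) := by
  ext a; simp [mul_left_comm]

theorem K_K' (i : Fin 2) (v : Fin ℓ → ℂ) : K ℓ μ i (K' ℓ μ i v) = v := by
  ext a
  simp only [K, K', diag_apply]
  rw [← mul_assoc, ← xiPow_add, add_neg_cancel, xiPow_zero, one_mul]

theorem K'_K (i : Fin 2) (v : Fin ℓ → ℂ) : K' ℓ μ i (K ℓ μ i v) = v :=
  (diag_diag _ _ _).trans (K_K' i v)

/-- The coefficient identity behind `[E, F] = [h₁]`: on the basis vector of index `a` of the Verma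
module of highest weight `x`, the two products of quantum numbers are the eigenvalues of `E F` and
`F E`. -/
theorem qnum_identity (hℓ : 3 ≤ ℓ) (a x : ℂ) :
    qnum ℓ (a + 1) * qnum ℓ (x - a) - qnum ℓ a * qnum ℓ (x - (a - 1)) = qnum ℓ (x - 2 * a) := by
  have h := xi_sub_inv_ne_zero hℓ
  have hq := xi_ne_zero (ℓ := ℓ)
  have ha := xiPow_ne_zero (ℓ := ℓ) a
  have hx := xiPow_ne_zero (ℓ := ℓ) x
  simp only [qnum, sub_eq_add_neg, neg_add, neg_neg, two_mul, xiPow_add, xiPow_neg, xiPow_one] at h ⊢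
  have key : (xi ℓ * xiPow ℓ a - (xi ℓ)⁻¹ * (xiPow ℓ a)⁻¹) *
      (xiPow ℓ x * (xiPow ℓ a)⁻¹ - (xiPow ℓ x)⁻¹ * xiPow ℓ a) -
      (xiPow ℓ a - (xiPow ℓ a)⁻¹) * (xiPow ℓ x * ((xiPow ℓ a)⁻¹ * xi ℓ) -
        (xiPow ℓ x)⁻¹ * (xiPow ℓ a * (xi ℓ)⁻¹)) =
      (xi ℓ - (xi ℓ)⁻¹) * (xiPow ℓ x * ((xiPow ℓ a)⁻¹ * (xiPow ℓ a)⁻¹) -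
        (xiPow ℓ x)⁻¹ * (xiPow ℓ a * xiPow ℓ a)) := by
    field_simp
    ring
  have h' : xi ℓ - (xi ℓ)⁻¹ ≠ 0 := by rwa [sub_eq_add_neg]
  simp only [← sub_eq_add_neg] at *
  rw [← mul_right_inj' (mul_ne_zero h' h')]
  calc _ = (xi ℓ * xiPow ℓ a - (xi ℓ)⁻¹ * (xiPow ℓ a)⁻¹) *
      (xiPow ℓ x * (xiPow ℓ a)⁻¹ - (xiPow ℓ x)⁻¹ * xiPow ℓ a) -
      (xiPow ℓ a - (xiPow ℓ a)⁻¹) * (xiPow ℓ x * ((xiPow ℓ a)⁻¹ * xi ℓ) -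
        (xiPow ℓ x)⁻¹ * (xiPow ℓ a * (xi ℓ)⁻¹)) := by
        generalize xi ℓ - (xi ℓ)⁻¹ = d at h'
        field_simp
    _ = _ := by
        rw [key]
        generalize xi ℓ - (xi ℓ)⁻¹ = d at h'
        field_simp

theorem qnum_zero : qnum ℓ 0 = 0 := by simp [qnum]

theorem qnum_ell (hℓ : 3 ≤ ℓ) : qnum ℓ ℓ = 0 := by
  rw [qnum, xiPow_neg, xiPow_natCast, (isPrimitiveRoot_xi hℓ).pow_eq_one]
  simp

/-- The truncation is consistent at both ends: at `a = ℓ - 1` the missing term carries the factor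
`[ℓ] = 0`, and at `a = 0` the factor `[0] = 0`. -/
theorem E_F (hℓ : 3 ≤ ℓ) (v : Fin ℓ → ℂ) : E ℓ μ (F ℓ v) =
    F ℓ (E ℓ μ v) + (xi ℓ - (xi ℓ)⁻¹)⁻¹ • (K ℓ μ 0 v - K' ℓ μ 0 v) := by
  ext a
  have h1 : E ℓ μ (F ℓ v) a = qnum ℓ ((a : ℕ) + 1) * qnum ℓ (μ 0 - (a : ℕ)) * v a := by
    simp only [E, F, LinearMap.coe_mk, AddHom.coe_mk]
    by_cases h : (a : ℕ) + 1 < ℓ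
    · simp [h]
    · rw [dif_neg h]
      have : (a : ℕ) + 1 = ℓ := by omega
      have h2 : qnum ℓ ((a : ℕ) + 1) = 0 := by
        rw [show ((a : ℕ) : ℂ) + 1 = (ℓ : ℂ) by exact_mod_cast this, qnum_ell hℓ]
      rw [h2]; ring
  have h2 : F ℓ (E ℓ μ v) a = qnum ℓ (a : ℕ) * qnum ℓ (μ 0 - ((a : ℕ) - 1)) * v a := by
    simp only [E, F, LinearMap.coe_mk, AddHom.coe_mk]
    split_ifs with h h'
    · have h3 : (((a : ℕ) - 1 : ℕ) : ℂ) = (a : ℕ) - 1 := by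
        rw [Nat.cast_sub h]; simp
      rw [h3, sub_add_cancel]
      congr 2
      exact Fin.ext (by simp; omega)
    · omega
    · have : (a : ℕ) = 0 := by omega
      rw [this, Nat.cast_zero, qnum_zero]; ring
  have h3 := qnum_identity hℓ ((a : ℕ) : ℂ) (μ 0)
  rw [Pi.add_apply, h1, h2]
  simp only [K, K', Pi.smul_apply, Pi.sub_apply, diag_apply, evenWeight, Matrix.cons_val_zero,
    smul_eq_mul]
  rw [← sub_mul, ← mul_assoc]
  change _ = _ + qnum ℓ (μ 0 - 2 * (a : ℕ)) * v a
  rw [← h3]; ring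

theorem F_pow_apply (n : ℕ) (v : Fin ℓ → ℂ) (a : Fin ℓ) (h : (a : ℕ) < n) : (F ℓ ^ n) v a = 0 := by
  induction n generalizing a with
  | zero => omega
  | succ n ih =>
    rw [pow_succ', Module.End.mul_apply]
    simp only [F, LinearMap.coe_mk, AddHom.coe_mk]
    split_ifs with h'
    · exact ih _ (by simp; omega)
    · rfl

theorem F_pow : F ℓ ^ ℓ = 0 := LinearMap.ext fun v => funext fun a => F_pow_apply ℓ v a a.2

theorem E_pow_apply (n : ℕ) (v : Fin ℓ → ℂ) (a : Fin ℓ) (h : ℓ ≤ (a : ℕ) + n) :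
    (E ℓ μ ^ n) v a = 0 := by
  induction n generalizing a with
  | zero => omega
  | succ n ih =>
    rw [pow_succ', Module.End.mul_apply]
    simp only [E, LinearMap.coe_mk, AddHom.coe_mk]
    split_ifs with h'
    · exact mul_eq_zero_of_right _ (ih _ (by simp; omega))
    · rfl

theorem E_pow : E ℓ μ ^ ℓ = 0 :=
  LinearMap.ext fun v => funext fun a => E_pow_apply ℓ v a (by omega)

end Kac

/-! ### Operators on the Kac module and their relations -/

namespace Kac

variable (ℓ : ℕ) (μ : Fin 2 → ℂ)

/-- The operator on `M ⊕ M ⊕ M ⊕ M` with given components. -/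
def block {M : Type} [AddCommGroup M] [Module ℂ M] (T : Fin 4 → (Fin 4 → M) →ₗ[ℂ] M) :
    Module.End ℂ (Fin 4 → M) := LinearMap.pi T

/-- The space of the Kac module; the four components correspond to `1`, `f₂`, `f₃`, `f₂ f₃`. -/
abbrev Space : Type := Fin 4 → Fin ℓ → ℂ

/-- The projection to a component. -/
abbrev pr (i : Fin 4) : Space ℓ →ₗ[ℂ] (Fin ℓ → ℂ) := LinearMap.proj i

/-- The operator `[q k₂]`. -/
noncomputable def bracket (q : ℂ) : Module.End ℂ (Fin ℓ → ℂ) :=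
  (xi ℓ - (xi ℓ)⁻¹)⁻¹ • (q • K ℓ μ 1 - q⁻¹ • K' ℓ μ 1)

/-- The action of the `e i`. -/
noncomputable def opE : Fin 2 → Module.End ℂ (Space ℓ) :=
  -- For `w` in the even Verma module, where `e₂ w = 0`, and `[x] = (x - x⁻¹) / (ξ - ξ⁻¹)`, the
  -- relations give `e₁ f₃ w = f₃ e₁ w + f₂ k₁⁻¹ w`, `e₂ f₂ w = [k₂] w`, `e₂ f₃ w = -ξ f₁ k₂ w` and
  -- `e₂ f₂ f₃ w = f₃ [ξ k₂] w + ξ f₂ f₁ k₂ w`. Each entry collects what lands in its component.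
  ![block ![E ℓ μ ∘ₗ pr ℓ 0, E ℓ μ ∘ₗ pr ℓ 1 + K' ℓ μ 0 ∘ₗ pr ℓ 2, E ℓ μ ∘ₗ pr ℓ 2,
      E ℓ μ ∘ₗ pr ℓ 3],
    block ![bracket ℓ μ 1 ∘ₗ pr ℓ 1 - xi ℓ • (F ℓ ∘ₗ K ℓ μ 1 ∘ₗ pr ℓ 2),
      xi ℓ • (F ℓ ∘ₗ K ℓ μ 1 ∘ₗ pr ℓ 3), bracket ℓ μ (xi ℓ) ∘ₗ pr ℓ 3, 0]]

/-- The action of the `f i`. -/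
noncomputable def opF : Fin 2 → Module.End ℂ (Space ℓ) :=
  -- From `f₁ f₂ = ξ f₂ f₁ + f₃`, `f₁ f₃ = ξ⁻¹ f₃ f₁`, and the fact that `f₁` commutes with `f₂ f₃`.
  ![block ![F ℓ ∘ₗ pr ℓ 0, xi ℓ • (F ℓ ∘ₗ pr ℓ 1), pr ℓ 1 + (xi ℓ)⁻¹ • (F ℓ ∘ₗ pr ℓ 2),
      F ℓ ∘ₗ pr ℓ 3],
    block ![0, pr ℓ 0, 0, pr ℓ 2]]

/-- The action of the `k i`. -/
noncomputable def opK : Fin 2 → Module.End ℂ (Space ℓ) :=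
  ![block ![K ℓ μ 0 ∘ₗ pr ℓ 0, xi ℓ • (K ℓ μ 0 ∘ₗ pr ℓ 1), (xi ℓ)⁻¹ • (K ℓ μ 0 ∘ₗ pr ℓ 2),
      K ℓ μ 0 ∘ₗ pr ℓ 3],
    block ![K ℓ μ 1 ∘ₗ pr ℓ 0, K ℓ μ 1 ∘ₗ pr ℓ 1, xi ℓ • (K ℓ μ 1 ∘ₗ pr ℓ 2),
      xi ℓ • (K ℓ μ 1 ∘ₗ pr ℓ 3)]]

/-- The action of the `(k i)⁻¹`. -/
noncomputable def opK' : Fin 2 → Module.End ℂ (Space ℓ) :=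
  ![block ![K' ℓ μ 0 ∘ₗ pr ℓ 0, (xi ℓ)⁻¹ • (K' ℓ μ 0 ∘ₗ pr ℓ 1), xi ℓ • (K' ℓ μ 0 ∘ₗ pr ℓ 2),
      K' ℓ μ 0 ∘ₗ pr ℓ 3],
    block ![K' ℓ μ 1 ∘ₗ pr ℓ 0, K' ℓ μ 1 ∘ₗ pr ℓ 1, (xi ℓ)⁻¹ • (K' ℓ μ 1 ∘ₗ pr ℓ 2),
      (xi ℓ)⁻¹ • (K' ℓ μ 1 ∘ₗ pr ℓ 3)]]

/-- The action of the `h i`. -/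
noncomputable def opH : Fin 2 → Module.End ℂ (Space ℓ) :=
  ![block ![H ℓ μ 0 ∘ₗ pr ℓ 0, H ℓ μ 0 ∘ₗ pr ℓ 1 + pr ℓ 1, H ℓ μ 0 ∘ₗ pr ℓ 2 - pr ℓ 2,
      H ℓ μ 0 ∘ₗ pr ℓ 3],
    block ![H ℓ μ 1 ∘ₗ pr ℓ 0, H ℓ μ 1 ∘ₗ pr ℓ 1, H ℓ μ 1 ∘ₗ pr ℓ 2 + pr ℓ 2,
      H ℓ μ 1 ∘ₗ pr ℓ 3 + pr ℓ 3]]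

/-- The parity involution. -/
noncomputable def opSigma : Module.End ℂ (Space ℓ) :=
  block ![pr ℓ 0, -pr ℓ 1, -pr ℓ 2, pr ℓ 3]

variable {ℓ μ}

theorem block_ext {S T : Module.End ℂ (Space ℓ)} (h0 : ∀ v, S v 0 = T v 0)
    (h1 : ∀ v, S v 1 = T v 1) (h2 : ∀ v, S v 2 = T v 2) (h3 : ∀ v, S v 3 = T v 3) : S = T := by
  refine LinearMap.ext fun v => funext fun i => ?_
  fin_cases i
  exacts [h0 v, h1 v, h2 v, h3 v]

theorem block_apply {M : Type} [AddCommGroup M] [Module ℂ M] (T : Fin 4 → (Fin 4 → M) →ₗ[ℂ] M)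
    (v : Fin 4 → M) (i : Fin 4) : block T v i = T i v := rfl

theorem K_K (i j : Fin 2) (v : Fin ℓ → ℂ) : K ℓ μ i (K ℓ μ j v) = K ℓ μ j (K ℓ μ i v) :=
  diag_diag _ _ _

theorem K'_swap (i j : Fin 2) (v : Fin ℓ → ℂ) : K' ℓ μ i (K ℓ μ j v) = K ℓ μ j (K' ℓ μ i v) :=
  diag_diag _ _ _

theorem K'_K' (i j : Fin 2) (v : Fin ℓ → ℂ) : K' ℓ μ i (K' ℓ μ j v) = K' ℓ μ j (K' ℓ μ i v) :=
  diag_diag _ _ _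

theorem H_H (i j : Fin 2) (v : Fin ℓ → ℂ) : H ℓ μ i (H ℓ μ j v) = H ℓ μ j (H ℓ μ i v) :=
  diag_diag _ _ _

theorem H_K (i j : Fin 2) (v : Fin ℓ → ℂ) : H ℓ μ i (K ℓ μ j v) = K ℓ μ j (H ℓ μ i v) :=
  diag_diag _ _ _

theorem H_K' (i j : Fin 2) (v : Fin ℓ → ℂ) : H ℓ μ i (K' ℓ μ j v) = K' ℓ μ j (H ℓ μ i v) :=
  diag_diag _ _ _

theorem opK_mul_opK' (i : Fin 2) : opK ℓ μ i * opK' ℓ μ i = 1 := by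
  have hq := xi_ne_zero (ℓ := ℓ)
  fin_cases i <;> apply block_ext <;> intro v <;>
    simp [opK, opK', block_apply, K_K', smul_smul, hq]

theorem opK'_mul_opK (i : Fin 2) : opK' ℓ μ i * opK ℓ μ i = 1 := by
  have hq := xi_ne_zero (ℓ := ℓ)
  fin_cases i <;> apply block_ext <;> intro v <;>
    simp [opK, opK', block_apply, K'_K, smul_smul, hq]

theorem opK_comm : opK ℓ μ 0 * opK ℓ μ 1 = opK ℓ μ 1 * opK ℓ μ 0 := by
  apply block_ext <;> intro v <;>
    simp [opK, block_apply, K_K 0 1, smul_smul, mul_comm]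

theorem opK_mul_opE (i j : Fin 2) :
    opK ℓ μ i * opE ℓ μ j = (xi ℓ ^ cartan i j) • (opE ℓ μ j * opK ℓ μ i) := by
  have hq := xi_ne_zero (ℓ := ℓ)
  fin_cases i <;> fin_cases j <;> apply block_ext <;> intro v <;>
    simp [opK, opE, block_apply, cartan, bracket, K0_E, K1_E, K0_F, K1_F, K'_swap, K_K 0 1,
      K_K', -smul_add] <;>
    match_scalars <;> field_simp

theorem opK_mul_opF (i j : Fin 2) :
    opK ℓ μ i * opF ℓ j = (xi ℓ ^ (-cartan i j)) • (opF ℓ j * opK ℓ μ i) := by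
  have hq := xi_ne_zero (ℓ := ℓ)
  fin_cases i <;> fin_cases j <;> apply block_ext <;> intro v <;>
    simp [opK, opF, block_apply, cartan, K0_F, K1_F, -smul_add] <;>
    match_scalars <;> field_simp

theorem sq_sub_one_ne_zero (hℓ : 3 ≤ ℓ) : xi ℓ ^ 2 - 1 ≠ 0 := by
  have h := xi_sub_inv_ne_zero hℓ
  have hq := xi_ne_zero (ℓ := ℓ)
  intro h0
  apply h
  field_simp
  linear_combination h0

theorem inv_xi_sub_inv (hℓ : 3 ≤ ℓ) : (xi ℓ - (xi ℓ)⁻¹)⁻¹ = xi ℓ * (xi ℓ ^ 2 - 1)⁻¹ := by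
  have h := xi_sub_inv_ne_zero hℓ
  have hq := xi_ne_zero (ℓ := ℓ)
  have h2 := sq_sub_one_ne_zero hℓ
  field_simp

theorem opE_opF_even (hℓ : 3 ≤ ℓ) : opE ℓ μ 0 * opF ℓ 0 - opF ℓ 0 * opE ℓ μ 0 =
    (xi ℓ - (xi ℓ)⁻¹)⁻¹ • (opK ℓ μ 0 - opK' ℓ μ 0) := by
  have hq := xi_ne_zero (ℓ := ℓ)
  have hq2 := sq_sub_one_ne_zero hℓ
  rw [inv_xi_sub_inv hℓ]
  apply block_ext <;> intro v <;>
    simp [opK, opK', opF, opE, block_apply, E_F hℓ, K0'_F, inv_xi_sub_inv hℓ, -smul_add] <;>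
    match_scalars <;> field_simp <;> ring

theorem opE_opF_odd (hℓ : 3 ≤ ℓ) : opE ℓ μ 1 * opF ℓ 1 + opF ℓ 1 * opE ℓ μ 1 =
    (xi ℓ - (xi ℓ)⁻¹)⁻¹ • (opK ℓ μ 1 - opK' ℓ μ 1) := by
  rw [inv_xi_sub_inv hℓ]
  apply block_ext <;> intro v <;>
    simp [opK, opK', opF, opE, block_apply, bracket, inv_xi_sub_inv hℓ, -smul_add]

theorem opE0_opF1 : opE ℓ μ 0 * opF ℓ 1 - opF ℓ 1 * opE ℓ μ 0 = 0 := by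
  apply block_ext <;> intro v <;> simp [opF, opE, block_apply]

theorem opE1_opF0 (hℓ : 3 ≤ ℓ) : opE ℓ μ 1 * opF ℓ 0 - opF ℓ 0 * opE ℓ μ 1 = 0 := by
  have hq := xi_ne_zero (ℓ := ℓ)
  have hq2 := sq_sub_one_ne_zero hℓ
  apply block_ext <;> intro v <;>
    simp [opF, opE, block_apply, bracket, inv_xi_sub_inv hℓ, K1_F, K1'_F, -smul_add] <;>
    match_scalars <;> field_simp <;> ring

theorem opE_sq (hℓ : 3 ≤ ℓ) : opE ℓ μ 1 ^ 2 = 0 := by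
  have hq := xi_ne_zero (ℓ := ℓ)
  have hq2 := sq_sub_one_ne_zero hℓ
  rw [pow_two]
  apply block_ext <;> intro v <;>
    simp [opE, block_apply, bracket, inv_xi_sub_inv hℓ, K1_F, K1'_F, K_K', K'_K,
      -smul_add]
  match_scalars <;> field_simp <;> ring

theorem opF_sq : opF ℓ 1 ^ 2 = 0 := by
  rw [pow_two]
  apply block_ext <;> intro v <;> simp [opF, block_apply]

theorem opF_serre : opF ℓ 0 ^ 2 * opF ℓ 1 -
    (xi ℓ + (xi ℓ)⁻¹) • (opF ℓ 0 * opF ℓ 1 * opF ℓ 0) + opF ℓ 1 * opF ℓ 0 ^ 2 = 0 := by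
  have hq := xi_ne_zero (ℓ := ℓ)
  simp only [pow_two]
  apply block_ext <;> intro v <;> simp [opF, block_apply, -smul_add] <;>
    match_scalars <;> field_simp <;> ring

theorem opE_serre (hℓ : 3 ≤ ℓ) : opE ℓ μ 0 ^ 2 * opE ℓ μ 1 -
    (xi ℓ + (xi ℓ)⁻¹) • (opE ℓ μ 0 * opE ℓ μ 1 * opE ℓ μ 0) + opE ℓ μ 1 * opE ℓ μ 0 ^ 2 = 0 := by
  have hq := xi_ne_zero (ℓ := ℓ)
  have hq2 := sq_sub_one_ne_zero hℓ
  simp only [pow_two]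
  apply block_ext <;> intro v <;>
    simp [opE, block_apply, bracket, inv_xi_sub_inv hℓ, E_F hℓ, K1_E, K1'_E, K0_E,
      K0'_E, K'_swap, K'_K' 1 0, -smul_add] <;>
    match_scalars <;> field_simp <;> ring

theorem opH_opE (i j : Fin 2) :
    opH ℓ μ i * opE ℓ μ j - opE ℓ μ j * opH ℓ μ i = (cartan i j : ℂ) • opE ℓ μ j := by
  fin_cases i <;> fin_cases j <;> apply block_ext <;> intro v <;>
    simp [opH, opE, block_apply, cartan, bracket, H0_E, H1_E, H0_F, H1_F, H_K, H_K', -smul_add] <;>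
    module

theorem opH_opF (i j : Fin 2) :
    opH ℓ μ i * opF ℓ j - opF ℓ j * opH ℓ μ i = -(cartan i j : ℂ) • opF ℓ j := by
  fin_cases i <;> fin_cases j <;> apply block_ext <;> intro v <;>
    simp [opH, opF, block_apply, cartan, H0_F, H1_F, -smul_add] <;>
    module

theorem opH_opH (i j : Fin 2) : opH ℓ μ i * opH ℓ μ j - opH ℓ μ j * opH ℓ μ i = 0 := by
  fin_cases i <;> fin_cases j <;> apply block_ext <;> intro v <;>
    simp [opH, block_apply, H_H 0 1] <;> abel

theorem opH_opK (i j : Fin 2) : opH ℓ μ i * opK ℓ μ j - opK ℓ μ j * opH ℓ μ i = 0 := by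
  fin_cases i <;> fin_cases j <;> apply block_ext <;> intro v <;>
    simp [opH, opK, block_apply, H_K, -smul_add] <;> module

end Kac

/-- The `q`-binomial formula, cut off after the linear term in `b` because `b² = 0`. At a primitive
root of unity of order `n + 1` the remaining coefficient, a full geometric sum, vanishes. -/
theorem add_pow_of_mul_eq_smul_mul {B : Type} [Ring B] [Algebra ℂ B] {a b : B} {r : ℂ}
    (hab : a * b = r • (b * a)) (hb : b * b = 0) (n : ℕ) :
    (a + b) ^ (n + 1) = a ^ (n + 1) + (∑ i ∈ Finset.range (n + 1), r ^ i) • (b * a ^ n) := by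
  induction n with
  | zero => simp
  | succ n ih =>
    rw [pow_succ' (a + b), ih, add_mul, mul_add, mul_add, mul_smul_comm, mul_smul_comm,
      ← mul_assoc b b, hb, zero_mul, smul_zero, add_zero, ← mul_assoc a b, hab, smul_mul_assoc,
      mul_assoc b a, ← pow_succ', ← pow_succ', add_assoc, Finset.sum_range_succ' _ (n + 1),
      smul_smul, add_smul, Finset.sum_mul]
    simp only [pow_succ, pow_zero, one_smul]

theorem add_pow_eq_zero {ℓ : ℕ} {B : Type} [Ring B] [Algebra ℂ B] {a b : B} {r : ℂ}
    (hr : IsPrimitiveRoot r ℓ) (hℓ : 2 ≤ ℓ) (hab : a * b = r • (b * a)) (hb : b * b = 0)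
    (ha : a ^ ℓ = 0) : (a + b) ^ ℓ = 0 := by
  obtain ⟨n, rfl⟩ : ∃ n, ℓ = n + 1 := ⟨ℓ - 1, by omega⟩
  rw [add_pow_of_mul_eq_smul_mul hab hb, ha, hr.geom_sum_eq_zero (by omega), zero_smul, add_zero]

/-! ### The Kac module as a typical object -/

namespace Kac

variable (ℓ : ℕ) (μ : Fin 2 → ℂ)

/-- The action of the generators on the Kac module. -/
noncomputable def op : GenH → Module.End ℂ (Space ℓ)
  | .base (.k i) => opK ℓ μ i
  | .base (.kinv i) => opK' ℓ μ i
  | .base (.e i) => opE ℓ μ i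
  | .base (.f i) => opF ℓ i
  | .h i => opH ℓ μ i

variable {ℓ}

theorem lift_op_rel (hℓ : 3 ≤ ℓ) ⦃a b : FreeAlgebra ℂ GenH⦄ (r : RelH ℓ a b) :
    FreeAlgebra.lift ℂ (op ℓ μ) a = FreeAlgebra.lift ℂ (op ℓ μ) b := by
  cases r with
  | base r =>
    cases r with
    | k_comm => simpa [freeIncl, op] using opK_comm
    | k_kinv i => simpa [freeIncl, op] using opK_mul_opK' i
    | kinv_k i => simpa [freeIncl, op] using opK'_mul_opK i
    | k_e i j =>
      simp only [freeIncl, map_mul, map_smul, FreeAlgebra.lift_ι_apply, op]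
      rw [opK_mul_opE, smul_mul_assoc, mul_assoc, opK_mul_opK', mul_one]
    | k_f i j =>
      simp only [freeIncl, map_mul, map_smul, FreeAlgebra.lift_ι_apply, op]
      rw [opK_mul_opF, smul_mul_assoc, mul_assoc, opK_mul_opK', mul_one]
    | e_f_even =>
      simp only [freeIncl, map_mul, map_sub, map_smul, FreeAlgebra.lift_ι_apply, op]
      exact opE_opF_even hℓ
    | e_f_odd =>
      simp only [freeIncl, map_mul, map_sub, map_add, map_smul, FreeAlgebra.lift_ι_apply, op]
      exact opE_opF_odd hℓ
    | e0_f1 =>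
      simp only [freeIncl, map_mul, map_sub, map_zero, FreeAlgebra.lift_ι_apply, op]
      exact opE0_opF1
    | e1_f0 =>
      simp only [freeIncl, map_mul, map_sub, map_zero, FreeAlgebra.lift_ι_apply, op]
      exact opE1_opF0 hℓ
    | e_sq =>
      simp only [freeIncl, map_pow, map_zero, FreeAlgebra.lift_ι_apply, op]
      exact opE_sq hℓ
    | f_sq =>
      simp only [freeIncl, map_pow, map_zero, FreeAlgebra.lift_ι_apply, op]
      exact opF_sq
    | serre_e =>
      simp only [freeIncl, map_mul, map_sub, map_add, map_smul, map_pow, map_zero,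
        FreeAlgebra.lift_ι_apply, op]
      exact opE_serre hℓ
    | serre_f =>
      simp only [freeIncl, map_mul, map_sub, map_add, map_smul, map_pow, map_zero,
        FreeAlgebra.lift_ι_apply, op]
      exact opF_serre
  | h_e i j =>
    simp only [map_mul, map_sub, map_smul, FreeAlgebra.lift_ι_apply, op]
    exact opH_opE i j
  | h_f i j =>
    simp only [map_mul, map_sub, map_smul, FreeAlgebra.lift_ι_apply, op]
    exact opH_opF i j
  | h_h i j =>
    simp only [map_mul, map_sub, map_zero, FreeAlgebra.lift_ι_apply, op]
    exact opH_opH i j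
  | h_k i j =>
    simp only [map_mul, map_sub, map_zero, FreeAlgebra.lift_ι_apply, op]
    exact opH_opK i j

/-- The representation on the Kac module. -/
noncomputable def rep (hℓ : 3 ≤ ℓ) : UH ℓ →ₐ[ℂ] Module.End ℂ (Space ℓ) :=
  RingQuot.liftAlgHom ℂ ⟨FreeAlgebra.lift ℂ (op ℓ μ), lift_op_rel μ hℓ⟩

theorem rep_gen (hℓ : 3 ≤ ℓ) (x : GenH) : rep μ hℓ (UH.gen ℓ x) = op ℓ μ x := by
  simp [rep, UH.gen]

theorem opSigma_opSigma (v : Space ℓ) : opSigma ℓ (opSigma ℓ v) = v := by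
  ext i
  fin_cases i <;> simp [opSigma, block_apply]

theorem opSigma_op (x : GenH) :
    opSigma ℓ * op ℓ μ x = sgn x.parity • (op ℓ μ x * opSigma ℓ) := by
  rcases x with (⟨i⟩ | ⟨i⟩ | ⟨i⟩ | ⟨i⟩) | ⟨i⟩ <;> fin_cases i <;> apply block_ext <;> intro v <;>
    simp [opSigma, op, opK, opK', opE, opF, opH, block_apply, GenH.parity, Gen.parity] <;> abel

/-- The Kac module of highest weight `μ`. -/
noncomputable abbrev kac (hℓ : 3 ≤ ℓ) : UHModule ℓ :=
  SuperModule.ofInvolution (P := UH.part ℓ) (rep μ hℓ) (opSigma ℓ) opSigma_opSigma fun _ _ hb =>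
    sgn_commute_of_mem_superPart (rep μ hℓ) (opSigma ℓ)
      (fun x => by rw [rep_gen]; exact opSigma_op μ x) hb

variable {μ}

theorem kac_sigma (hℓ : 3 ≤ ℓ) : (kac μ hℓ).sigma = opSigma ℓ := SuperModule.sigma_ofInvolution _ _ _ _

theorem kac_e (hℓ : 3 ≤ ℓ) (i : Fin 2) : (kac μ hℓ).e i = opE ℓ μ i := rep_gen μ hℓ _

theorem kac_f (hℓ : 3 ≤ ℓ) (i : Fin 2) : (kac μ hℓ).f i = opF ℓ i := rep_gen μ hℓ _

theorem kac_k (hℓ : 3 ≤ ℓ) (i : Fin 2) : (kac μ hℓ).k i = opK ℓ μ i := rep_gen μ hℓ _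

theorem kac_h (hℓ : 3 ≤ ℓ) (i : Fin 2) : (kac μ hℓ).h i = opH ℓ μ i := rep_gen μ hℓ _

variable (ℓ μ) in
/-- The weights of the Kac module. -/
def weight (j : Fin 2) (i : Fin 4) (a : Fin ℓ) : ℂ :=
  evenWeight ℓ μ j a + ((![![0, 1, -1, 0], ![0, 0, 1, 1]] : Fin 2 → Fin 4 → ℤ) j i : ℤ)

theorem opH_apply (j : Fin 2) (v : Space ℓ) (i : Fin 4) (a : Fin ℓ) :
    opH ℓ μ j v i a = weight ℓ μ j i a * v i a := by
  fin_cases j <;> fin_cases i <;> simp [opH, block_apply, weight, H] <;> ring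

theorem opK_apply (j : Fin 2) (v : Space ℓ) (i : Fin 4) (a : Fin ℓ) :
    opK ℓ μ j v i a = xiPow ℓ (weight ℓ μ j i a) * v i a := by
  fin_cases j <;> fin_cases i <;>
    simp [opK, block_apply, weight, K, xiPow_add, xiPow_neg, xiPow_one] <;> ring

theorem xiPow_primitive (hℓ : 3 ≤ ℓ) (hodd : Odd ℓ) : IsPrimitiveRoot (xi ℓ ^ 2) ℓ :=
  (isPrimitiveRoot_xi hℓ).pow_of_coprime 2 (Nat.coprime_two_left.2 hodd)

theorem opE_pow (hℓ : 3 ≤ ℓ) (hodd : Odd ℓ) : opE ℓ μ 0 ^ ℓ = 0 := by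
  -- `e₁` is its block diagonal part plus the part from `f₃` to `f₂`, and `a b = ξ² b a`. Since `ℓ`
  -- is odd, `ξ²` is still a primitive `ℓ`-th root of unity.
  let a : Module.End ℂ (Space ℓ) :=
    block ![E ℓ μ ∘ₗ pr ℓ 0, E ℓ μ ∘ₗ pr ℓ 1, E ℓ μ ∘ₗ pr ℓ 2, E ℓ μ ∘ₗ pr ℓ 3]
  let b : Module.End ℂ (Space ℓ) := block ![0, K' ℓ μ 0 ∘ₗ pr ℓ 2, 0, 0]
  have h : opE ℓ μ 0 = a + b := by
    apply block_ext <;> intro v <;> simp [opE, a, b, block_apply]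
  rw [h]
  refine add_pow_eq_zero (xiPow_primitive hℓ hodd) (by omega) ?_ ?_ ?_
  · have hq := xi_ne_zero (ℓ := ℓ)
    apply block_ext <;> intro v <;> simp [a, b, block_apply, K0'_E, smul_smul, hq]
  · apply block_ext <;> intro v <;> simp [b, block_apply]
  · have key : ∀ (n : ℕ) (v : Space ℓ) (i : Fin 4), (a ^ n) v i = (E ℓ μ ^ n) (v i) := by
      intro n v i
      induction n with
      | zero => rfl
      | succ n ih =>
        rw [pow_succ', pow_succ', Module.End.mul_apply, Module.End.mul_apply, ← ih]
        fin_cases i <;> rfl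
    refine LinearMap.ext fun v => funext fun i => ?_
    rw [key, E_pow]
    rfl

theorem opF_pow (hℓ : 3 ≤ ℓ) (hodd : Odd ℓ) : opF ℓ 0 ^ ℓ = 0 := by
  have hq := xi_ne_zero (ℓ := ℓ)
  -- The same splitting for `f₁`, now with the off-diagonal part from `f₂` to `f₃` and `a b = ξ⁻² b
  -- a`.
  let c : Fin 4 → ℂ := ![1, xi ℓ, (xi ℓ)⁻¹, 1]
  let a : Module.End ℂ (Space ℓ) := block fun i => c i • (F ℓ ∘ₗ pr ℓ i)
  let b : Module.End ℂ (Space ℓ) := block ![0, 0, pr ℓ 1, 0]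
  have h : opF ℓ 0 = a + b := by
    apply block_ext <;> intro v <;> simp [opF, a, b, c, block_apply, add_comm]
  rw [h]
  refine add_pow_eq_zero (xiPow_primitive hℓ hodd).inv (by omega) ?_ ?_ ?_
  · apply block_ext <;> intro v <;> simp [a, b, c, block_apply, smul_smul, pow_two, hq]
  · apply block_ext <;> intro v <;> simp [b, block_apply]
  · have key : ∀ (n : ℕ) (v : Space ℓ) (i : Fin 4), (a ^ n) v i = c i ^ n • (F ℓ ^ n) (v i) := by
      intro n v i
      induction n with
      | zero => simp
      | succ n ih =>
        rw [pow_succ', pow_succ', pow_succ', Module.End.mul_apply, Module.End.mul_apply, mul_smul,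
          ← map_smul, ← ih]
        rfl
    refine LinearMap.ext fun v => funext fun i => ?_
    rw [key, F_pow]
    simp

theorem isNilpotentWeight_kac (hℓ : 3 ≤ ℓ) (hodd : Odd ℓ) : (kac μ hℓ).IsNilpotentWeight where
  finite := inferInstanceAs (FiniteDimensional ℂ (Space ℓ))
  e_pow := by rw [kac_e]; exact opE_pow hℓ hodd
  f_pow := by rw [kac_f]; exact opF_pow hℓ hodd
  diagonalizable j := by
    rw [kac_h, Submodule.eq_top_iff']
    intro v
    have hv : v = ∑ i : Fin 4, ∑ a : Fin ℓ, Pi.single i (Pi.single a (v i a)) := by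
      funext i a
      simp [Finset.sum_apply, Pi.single_apply, ite_apply]
    rw [hv]
    refine sum_mem fun i _ => sum_mem fun a _ => ?_
    refine Submodule.mem_iSup_of_mem (weight ℓ μ j i a) (Module.End.mem_eigenspace_iff.2 ?_)
    funext i' a'
    rw [opH_apply]
    by_cases hi : i' = i
    · subst hi
      by_cases ha : a' = a
      · subst ha; simp
      · simp [ha]
    · simp [hi]
  k_eq j c v hv := by
    rw [kac_h] at hv
    rw [kac_k]
    funext i a
    have h : opH ℓ μ j v i a = c * v i a := congrFun (congrFun hv i) a
    rw [opH_apply] at h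
    change opK ℓ μ j v i a = xiPow ℓ c * v i a
    rw [opK_apply]
    by_cases h0 : v i a = 0
    · rw [h0, mul_zero, mul_zero]
    · rw [mul_right_cancel₀ h0 h]

theorem exists_weight_eq (j : Fin 2) (i : Fin 4) (a : Fin ℓ) :
    ∃ n : ℤ, weight ℓ μ j i a = μ j + n := by
  obtain ⟨n, hn⟩ : ∃ n : ℤ, evenWeight ℓ μ j a = μ j + n := by
    fin_cases j
    · exact ⟨-2 * (a : ℕ), by simp [evenWeight]; ring⟩
    · exact ⟨(a : ℕ), by simp [evenWeight]⟩
  refine ⟨n + (![![0, 1, -1, 0], ![0, 0, 1, 1]] : Fin 2 → Fin 4 → ℤ) j i, ?_⟩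
  rw [weight, hn]
  push_cast
  ring

theorem toG_eq_toG {c d : Fin 2 → ℂ} (h : ∀ j, ∃ n : ℤ, c j = d j + n) : toG c = toG d := by
  funext j
  obtain ⟨n, hn⟩ := h j
  rw [toG, toG, QuotientAddGroup.eq, AddSubgroup.mem_zmultiples_iff]
  refine ⟨-n, ?_⟩
  rw [hn, zsmul_one]
  push_cast
  ring

theorem hasWeightsIn_kac (hℓ : 3 ≤ ℓ) : (kac μ hℓ).HasWeightsIn (toG μ) := by
  intro c v hne hv
  obtain ⟨i, a, hia⟩ : ∃ i a, v i a ≠ 0 := by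
    by_contra! h
    exact hne (funext fun i => funext fun a => h i a)
  refine toG_eq_toG fun j => ?_
  have h := hv j
  rw [kac_h] at h
  have h : opH ℓ μ j v i a = c j * v i a := congrFun (congrFun h i) a
  rw [opH_apply] at h
  rw [← mul_right_cancel₀ hia h]
  exact exists_weight_eq j i a

theorem finrank_kac (hℓ : 3 ≤ ℓ) : Module.finrank ℂ (kac μ hℓ).carrier = 4 * ℓ := by
  change Module.finrank ℂ (Fin 4 → Fin ℓ → ℂ) = 4 * ℓ
  simp [Module.finrank_pi_fintype]

/-- An irreducible quotient lies in the same coset, so it is typical and has dimension `4ℓ`, the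
full dimension of the Kac module. The kernel is therefore zero. -/
theorem isTypical_kac (hℓ : 3 ≤ ℓ) (hodd : Odd ℓ)
    (hT : ∀ V : CHPiece ℓ (toG μ), V.obj.IsIrreducible → V.obj.IsTypical) :
    (kac μ hℓ).IsTypical := by
  let V : CHPiece ℓ (toG μ) := ⟨kac μ hℓ, isNilpotentWeight_kac hℓ hodd, hasWeightsIn_kac hℓ⟩
  have hfin := V.property.1.finite
  have hnt : Nontrivial V.obj.carrier := by
    rw [← Module.finrank_pos_iff (R := ℂ)]
    change 0 < Module.finrank ℂ (kac μ hℓ).carrier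
    rw [finrank_kac]; omega
  obtain ⟨N, hN, hs, hQ⟩ := V.obj.exists_irreducible_quotient
  have h1 := (hT (V.quotient N hN hs) hQ).2
  have h2 : Module.finrank ℂ (V.quotient N hN hs).obj.carrier + Module.finrank ℂ N =
      Module.finrank ℂ V.obj.carrier := Submodule.finrank_quotient_add_finrank _
  have h3 : Module.finrank ℂ V.obj.carrier = 4 * ℓ := finrank_kac hℓ
  have hbot : N = ⊥ := Submodule.finrank_eq_zero.1 (by omega)
  refine hT V (hQ.of_bijective (SuperModule.mkQ_mem_homs _ N hN hs)
    ⟨LinearMap.ker_eq_bot.1 ((SuperModule.ker_mkQ _ N hN hs).trans hbot),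
      SuperModule.mkQ_surjective _ N hN hs⟩)

/-- On the Kac module, a subspace stable under `U_ξ sl(2|1)` is graded. -/
theorem opSigma_mem (hℓ : 3 ≤ ℓ) {N : Submodule ℂ (Space ℓ)}
    (hN : ∀ i, ∀ v ∈ N, opK ℓ μ i v ∈ N) {v : Space ℓ} (hv : v ∈ N) : opSigma ℓ v ∈ N := by
  have hq := xi_ne_zero (ℓ := ℓ)
  -- The element `k₁ k₂²` commutes with the even root vectors `e₁`, `f₁`. It is `C` times `1, ξ, ξ,
  -- ξ²` on the four components and so counts the odd factors.
  let C : ℂ := xiPow ℓ (μ 0 + 2 * μ 1)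
  let d : Fin 4 → ℂ := ![1, xi ℓ, xi ℓ, xi ℓ ^ 2]
  let T : Space ℓ → Space ℓ := fun v => C⁻¹ • opK ℓ μ 0 (opK ℓ μ 1 (opK ℓ μ 1 v))
  have hT (v : Space ℓ) (i : Fin 4) (a : Fin ℓ) : T v i a = d i * v i a := by
    have h : xiPow ℓ (weight ℓ μ 0 i a) * (xiPow ℓ (weight ℓ μ 1 i a) *
        xiPow ℓ (weight ℓ μ 1 i a)) = C * d i := by
      rw [← xiPow_add, ← xiPow_add]
      have hd : d i = xiPow ℓ ((![0, 1, 1, 2] : Fin 4 → ℂ) i) := by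
        fin_cases i <;> simp [d, xiPow_one, xiPow_two]
      rw [hd, ← xiPow_add]
      congr 1
      fin_cases i <;> simp [weight, evenWeight] <;> ring
    change C⁻¹ * (opK ℓ μ 0 (opK ℓ μ 1 (opK ℓ μ 1 v)) i a) = _
    rw [opK_apply, opK_apply, opK_apply, ← mul_assoc (xiPow _ _) (xiPow _ _) (v i a),
      ← mul_assoc (xiPow _ _) _ (v i a), h, ← mul_assoc, ← mul_assoc,
      inv_mul_cancel₀ (xiPow_ne_zero _), one_mul]
  have hTN : ∀ v ∈ N, T v ∈ N := fun v hv => N.smul_mem _ (hN _ _ (hN _ _ (hN _ _ hv)))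
  have h1 : xi ℓ - 1 ≠ 0 := sub_ne_zero.2 ((isPrimitiveRoot_xi hℓ).ne_one (by omega))
  -- `w = (T - 1)(T - ξ²) v` vanishes on the even components and equals `-ξ (ξ - 1)² v` on the odd
  -- ones; the coefficient below turns it into `-2 v` there.
  let w : Space ℓ := T (T v) - (xi ℓ ^ 2 + 1) • T v + xi ℓ ^ 2 • v
  have hw : w ∈ N :=
    add_mem (sub_mem (hTN _ (hTN _ hv)) (N.smul_mem _ (hTN _ hv))) (N.smul_mem _ hv)
  have : opSigma ℓ v = v + (2 * (xi ℓ)⁻¹ * ((xi ℓ - 1)⁻¹) ^ 2) • w := by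
    funext i a
    change _ = v i a + (2 * (xi ℓ)⁻¹ * ((xi ℓ - 1)⁻¹) ^ 2) *
      (T (T v) i a - (xi ℓ ^ 2 + 1) * T v i a + xi ℓ ^ 2 * v i a)
    rw [hT, hT]
    fin_cases i <;> simp [opSigma, block_apply, d] <;>
      first | (right; ring) | (field_simp; ring)
  rw [this]
  exact add_mem hv (N.smul_mem _ hw)

end Kac

/-! ### Irreducible representations and operators of rank one -/

/-- Burnside's theorem for irreducible representations whose image meets the operators of rank
one. -/
theorem eq_top_of_smulRight_mem {R M : Type} [Ring R] [Algebra ℂ R] [AddCommGroup M] [Module ℂ M]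
    [FiniteDimensional ℂ M] (ρ : R →ₐ[ℂ] Module.End ℂ M)
    (hirr : ∀ N : Submodule ℂ M, (∀ a, ∀ v ∈ N, ρ a v ∈ N) → N = ⊥ ∨ N = ⊤)
    (I : Submodule ℂ (Module.End ℂ M)) (hl : ∀ a, ∀ φ ∈ I, ρ a * φ ∈ I)
    (hr : ∀ a, ∀ φ ∈ I, φ * ρ a ∈ I) {ψ : M →ₗ[ℂ] ℂ} {u : M} (hψ : ψ ≠ 0) (hu : u ≠ 0)
    (h : ψ.smulRight u ∈ I) : I = ⊤ := by
  have h1 : ∀ w, ψ.smulRight w ∈ I := by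
    -- The vectors `w` with `ψ ⊗ w ∈ I` form a submodule because `I` is a left ideal, and it
    -- contains `u ≠ 0`.
    have : I.comap (LinearMap.smulRightₗ ψ) = ⊤ := by
      refine (hirr _ fun a v hv => ?_).resolve_left fun h0 => hu ?_
      · have := hl a _ hv
        rw [Submodule.mem_comap]
        convert this using 1
        ext v; simp
      · have hmem : u ∈ I.comap (LinearMap.smulRightₗ ψ) := h
        rw [h0] at hmem
        exact hmem
    exact fun w => (this ▸ Submodule.mem_top : w ∈ I.comap (LinearMap.smulRightₗ ψ))
  -- The dual step: the common kernel of these functionals is a submodule because `I` is a right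
  -- ideal, and it is proper since `ψ ∈ J`. It is zero, so `J` is the whole dual and `I` contains
  -- all operators of rank one.
  let J : Submodule ℂ (Module.Dual ℂ M) :=
    ⨅ w : M, I.comap ((LinearMap.smulRightₗ (R := ℂ) (M₂ := M) (M := M)).flip w)
  have hJ {χ : Module.Dual ℂ M} : χ ∈ J ↔ ∀ w, χ.smulRight w ∈ I := by
    simp only [J, Submodule.mem_iInf]
    rfl
  have h2 : J.dualCoannihilator = ⊥ := by
    refine (hirr _ fun a v hv => ?_).resolve_right fun h0 => hψ ?_
    · rw [Submodule.mem_dualCoannihilator] at hv ⊢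
      intro χ hχ
      refine hv (χ ∘ₗ ρ a) (hJ.2 fun w => ?_)
      exact hr a _ (hJ.1 hχ w)
    · ext v
      have hv : v ∈ J.dualCoannihilator := h0 ▸ Submodule.mem_top
      exact (Submodule.mem_dualCoannihilator _ ).1 hv ψ (hJ.2 h1)
  have h3 : J = ⊤ := by
    rw [← Subspace.dualCoannihilator_dualAnnihilator_eq (W := J), h2,
      Submodule.dualAnnihilator_bot]
  rw [Submodule.eq_top_iff']
  intro φ
  let b := Module.finBasis ℂ M
  have hφ : φ = ∑ i, (b.coord i).smulRight (φ (b i)) := by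
    refine b.ext fun j => ?_
    rw [LinearMap.sum_apply]
    simp [Finsupp.single_apply]
  rw [hφ]
  exact sum_mem fun i _ => hJ.1 (h3 ▸ Submodule.mem_top) _

/-! ### The dimension of the algebra `𝒜` -/

section Dimension

theorem mul_pow_of_mul_eq_smul_mul {B : Type} [Ring B] [Algebra ℂ B] {a b : B} {r : ℂ}
    (h : a * b = r • (b * a)) (n : ℕ) : a * b ^ n = r ^ n • (b ^ n * a) := by
  induction n with
  | zero => simp
  | succ n ih =>
    rw [pow_succ b, ← mul_assoc, ih, smul_mul_assoc, mul_assoc, h, mul_smul_comm, smul_smul,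
      ← mul_assoc, pow_succ]

theorem k_pow_mod {ℓ : ℕ} {M : Type} [AddCommGroup M] [Module ℂ M] {k : Module.End ℂ M} {C : ℂ}
    (hk : k ^ ℓ = C • 1) (s : ℕ) : k ^ s = C ^ (s / ℓ) • k ^ (s % ℓ) := by
  conv_lhs => rw [← Nat.div_add_mod s ℓ, pow_add, pow_mul, hk, smul_pow, one_pow, smul_mul_assoc,
    one_mul]

variable {ℓ : ℕ} {M : Type} [AddCommGroup M] [Module ℂ M] {φ : U ℓ →ₐ[ℂ] Module.End ℂ M}
  {C : Fin 2 → ℂ} {Z : Submodule ℂ M}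

/-- The span of the ordered monomials in the `k i` applied to `Z`. -/
noncomputable def torusSpan (φ : U ℓ →ₐ[ℂ] Module.End ℂ M) (Z : Submodule ℂ M) : Submodule ℂ M :=
  ⨆ p : Fin ℓ × Fin ℓ, Z.map (φ (U.gen ℓ (.k 0)) ^ (p.1 : ℕ) * φ (U.gen ℓ (.k 1)) ^ (p.2 : ℕ))

theorem mem_torusSpan (hℓ : 3 ≤ ℓ) (hk : ∀ i, φ (U.gen ℓ (.k i)) ^ ℓ = C i • 1) (s t : ℕ) {z : M}
    (hz : z ∈ Z) :
    (φ (U.gen ℓ (.k 0)) ^ s) ((φ (U.gen ℓ (.k 1)) ^ t) z) ∈ torusSpan φ Z := by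
  rw [k_pow_mod (hk 0) s, k_pow_mod (hk 1) t, LinearMap.smul_apply, LinearMap.smul_apply, map_smul]
  refine Submodule.smul_mem _ _ (Submodule.smul_mem _ _ ?_)
  exact Submodule.mem_iSup_of_mem
    ((⟨s % ℓ, Nat.mod_lt _ (by omega)⟩, ⟨t % ℓ, Nat.mod_lt _ (by omega)⟩) : Fin ℓ × Fin ℓ)
    ⟨z, hz, rfl⟩

theorem torusSpan_induction {T : Module.End ℂ M}
    (h : ∀ (s t : ℕ), ∀ z ∈ Z,
      T ((φ (U.gen ℓ (.k 0)) ^ s) ((φ (U.gen ℓ (.k 1)) ^ t) z)) ∈ torusSpan φ Z)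
    {v : M} (hv : v ∈ torusSpan φ Z) : T v ∈ torusSpan φ Z := by
  suffices h : torusSpan φ Z ≤ (torusSpan φ Z).comap T from h hv
  refine iSup_le fun ⟨s, t⟩ => ?_
  rintro _ ⟨z, hz, rfl⟩
  exact h s t z hz

theorem torusSpan_k (hℓ : 3 ≤ ℓ) (hk : ∀ i, φ (U.gen ℓ (.k i)) ^ ℓ = C i • 1) (i : Fin 2) (v : M)
    (hv : v ∈ torusSpan φ Z) : φ (U.gen ℓ (.k i)) v ∈ torusSpan φ Z := by
  refine torusSpan_induction (fun s t z hz => ?_) hv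
  obtain rfl | rfl : i = 0 ∨ i = 1 := by omega
  · rw [← Module.End.mul_apply, ← pow_succ']
    exact mem_torusSpan hℓ hk _ _ hz
  · have hc : Commute (φ (U.gen ℓ (.k 1))) (φ (U.gen ℓ (.k 0)) ^ s) :=
      Commute.pow_right (k_mul_k φ 1 0) s
    rw [← Module.End.mul_apply, hc.eq, Module.End.mul_apply, ← Module.End.mul_apply (φ _),
      ← pow_succ']
    exact mem_torusSpan hℓ hk _ _ hz

/-- Since `k i ^ ℓ` is the nonzero scalar `C i`, the inverse of `k i` is `(C i)⁻¹ k i ^ (ℓ - 1)`. -/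
theorem torusSpan_kinv (hℓ : 3 ≤ ℓ) (hC : ∀ i, C i ≠ 0)
    (hk : ∀ i, φ (U.gen ℓ (.k i)) ^ ℓ = C i • 1) (i : Fin 2) (v : M) (hv : v ∈ torusSpan φ Z) :
    φ (U.gen ℓ (.kinv i)) v ∈ torusSpan φ Z := by
  have hpow : ∀ n : ℕ, (φ (U.gen ℓ (.k i)) ^ n) v ∈ torusSpan φ Z := by
    intro n
    induction n with
    | zero => exact hv
    | succ n ih =>
      rw [pow_succ', Module.End.mul_apply]
      exact torusSpan_k hℓ hk i _ ih
  have h : C i • φ (U.gen ℓ (.kinv i)) = φ (U.gen ℓ (.k i)) ^ (ℓ - 1) := by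
    have h1 : φ (U.gen ℓ (.kinv i)) * φ (U.gen ℓ (.k i)) ^ ℓ = φ (U.gen ℓ (.k i)) ^ (ℓ - 1) := by
      obtain ⟨n, rfl⟩ : ∃ n, ℓ = n + 1 := ⟨ℓ - 1, by omega⟩
      rw [pow_succ', ← mul_assoc, kinv_mul_k, one_mul, Nat.add_sub_cancel]
    rw [← h1, hk, mul_smul_comm, mul_one]
  have h2 : φ (U.gen ℓ (.kinv i)) v = (C i)⁻¹ • (φ (U.gen ℓ (.k i)) ^ (ℓ - 1)) v := by
    rw [← h, LinearMap.smul_apply, smul_smul, inv_mul_cancel₀ (hC i), one_smul]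
  rw [h2]
  exact Submodule.smul_mem _ _ (hpow _)

theorem torusSpan_e (hℓ : 3 ≤ ℓ) (hk : ∀ i, φ (U.gen ℓ (.k i)) ^ ℓ = C i • 1) (i : Fin 2)
    (hZ : ∀ z ∈ Z, φ (U.gen ℓ (.e i)) z ∈ Z) (v : M) (hv : v ∈ torusSpan φ Z) :
    φ (U.gen ℓ (.e i)) v ∈ torusSpan φ Z := by
  have hc (j : Fin 2) : φ (U.gen ℓ (.e i)) * φ (U.gen ℓ (.k j)) =
      (xi ℓ ^ cartan j i)⁻¹ • (φ (U.gen ℓ (.k j)) * φ (U.gen ℓ (.e i))) := by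
    rw [k_mul_e, smul_smul, inv_mul_cancel₀ (zpow_ne_zero _ xi_ne_zero), one_smul]
  refine torusSpan_induction (fun s t z hz => ?_) hv
  rw [← Module.End.mul_apply, mul_pow_of_mul_eq_smul_mul (hc 0), LinearMap.smul_apply,
    Module.End.mul_apply, ← Module.End.mul_apply (φ (U.gen ℓ (.e i))),
    mul_pow_of_mul_eq_smul_mul (hc 1), LinearMap.smul_apply, Module.End.mul_apply, map_smul]
  exact Submodule.smul_mem _ _ (Submodule.smul_mem _ _ (mem_torusSpan hℓ hk _ _ (hZ z hz)))

instance [FiniteDimensional ℂ Z] : FiniteDimensional ℂ (torusSpan φ Z) := by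
  unfold torusSpan; infer_instance

theorem finrank_torusSpan_le [FiniteDimensional ℂ Z] :
    Module.finrank ℂ (torusSpan φ Z) ≤ ℓ * ℓ * Module.finrank ℂ Z := by
  have := finrank_iSup_le (fun p : Fin ℓ × Fin ℓ =>
    Z.map (φ (U.gen ℓ (.k 0)) ^ (p.1 : ℕ) * φ (U.gen ℓ (.k 1)) ^ (p.2 : ℕ))) (Module.finrank ℂ Z)
    (fun _ => inferInstance) (fun _ => Submodule.finrank_map_le _ _)
  rw [torusSpan]
  simpa only [Fintype.card_prod, Fintype.card_fin] using this

/-- The dimension of a small quotient of `U_ξ sl(2|1)`. -/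
theorem finite_and_finrank_le {R : Type} [Ring R] [Algebra ℂ R] (hℓ : 3 ≤ ℓ) (hodd : Odd ℓ)
    (π : U ℓ →ₐ[ℂ] R) (hπ : Function.Surjective π) (he : π (U.gen ℓ (.e 0)) ^ ℓ = 0)
    (hf : π (U.gen ℓ (.f 0)) ^ ℓ = 0) (hC : ∀ i, C i ≠ 0)
    (hk : ∀ i, π (U.gen ℓ (.k i)) ^ ℓ = algebraMap ℂ R (C i)) :
    FiniteDimensional ℂ R ∧ Module.finrank ℂ R ≤ ℓ ^ 2 * (4 * ℓ * (4 * ℓ)) := by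
  let φ : U ℓ →ₐ[ℂ] Module.End ℂ R := (Algebra.lmul ℂ R).comp π
  have he' : φ (U.gen ℓ (.e 0)) ^ ℓ = 0 := by
    rw [← map_pow, AlgHom.comp_apply, map_pow, he, map_zero]
  have hf' : φ (U.gen ℓ (.f 0)) ^ ℓ = 0 := by
    rw [← map_pow, AlgHom.comp_apply, map_pow, hf, map_zero]
  have hk' (i : Fin 2) : φ (U.gen ℓ (.k i)) ^ ℓ = C i • 1 := by
    rw [← map_pow, AlgHom.comp_apply, map_pow, hk, AlgHom.commutes, Algebra.algebraMap_eq_smul_one]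
  -- In the left regular representation, `Z₃` is the span of the products of an `f`-monomial, a
  -- monomial in the `k i` and an `e`-monomial. It is a left ideal containing `1`, hence everything,
  -- and there are `4ℓ · ℓ² · 4ℓ` such products.
  let Z₁ := monomialSpan ℓ (xi ℓ) (fun i => φ (U.gen ℓ (.e i))) (ℂ ∙ (1 : R))
  let Z₂ := torusSpan φ Z₁
  let Z₃ := monomialSpan ℓ (xi ℓ) (fun i => φ (U.gen ℓ (.f i))) Z₂
  have hBe := isBorel_e φ hℓ hodd he'
  have hBf := isBorel_f φ hℓ hodd hf'
  have h1 : (1 : R) ∈ Z₂ :=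
    mem_torusSpan hℓ hk' 0 0 (hBe.le_monomialSpan (Submodule.mem_span_singleton_self _))
  have htop : Z₃ = ⊤ := by
    rw [Submodule.eq_top_iff']
    intro a
    obtain ⟨b, rfl⟩ := hπ a
    have := monomialSpan_f_stable hℓ hodd φ hf' (torusSpan_k hℓ hk') (torusSpan_kinv hℓ hC hk')
      (fun i => torusSpan_e hℓ hk' i fun z hz => hBe.monomialSpan_stable i hz) b 1
      (hBf.le_monomialSpan h1)
    change π b * 1 ∈ Z₃ at this
    rwa [mul_one] at this
  have d0 : Module.finrank ℂ (ℂ ∙ (1 : R)) ≤ 1 := by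
    simpa using finrank_span_le_card (R := ℂ) ({1} : Set R)
  have d1 : Module.finrank ℂ Z₁ ≤ 4 * ℓ :=
    finrank_monomialSpan_le.trans ((Nat.mul_le_mul_left _ d0).trans (mul_one _).le)
  have d2 : Module.finrank ℂ Z₂ ≤ ℓ * ℓ * (4 * ℓ) :=
    finrank_torusSpan_le.trans (Nat.mul_le_mul_left _ d1)
  have d3 : Module.finrank ℂ Z₃ ≤ 4 * ℓ * (ℓ * ℓ * (4 * ℓ)) :=
    finrank_monomialSpan_le.trans (Nat.mul_le_mul_left _ d2)
  have hfin : FiniteDimensional ℂ Z₃ := inferInstance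
  rw [htop] at d3 hfin
  rw [finrank_top] at d3
  exact ⟨Module.finite_def.2 (Module.Finite.iff_fg.1 hfin), d3.trans (le_of_eq (by ring))⟩

end Dimension

/-! ### The algebra of a typical coset -/

namespace Kac

variable {ℓ : ℕ}

/-- The representation of `U_ξ sl(2|1)` on the Kac module. -/
noncomputable def repU (μ : Fin 2 → ℂ) (hℓ : 3 ≤ ℓ) : U ℓ →ₐ[ℂ] Module.End ℂ (Space ℓ) :=
  (rep μ hℓ).comp (incl ℓ)

theorem repU_gen (μ : Fin 2 → ℂ) (hℓ : 3 ≤ ℓ) (x : Gen) :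
    repU μ hℓ (U.gen ℓ x) = op ℓ μ (.base x) := by
  rw [repU, AlgHom.comp_apply, incl_gen, rep_gen]

theorem opK_pow_apply {μ : Fin 2 → ℂ} (j : Fin 2) (s : ℕ) (v : Space ℓ) (i : Fin 4) (a : Fin ℓ) :
    (opK ℓ μ j ^ s) v i a = xiPow ℓ (weight ℓ μ j i a) ^ s * v i a := by
  induction s with
  | zero => simp
  | succ s ih => rw [pow_succ', Module.End.mul_apply, opK_apply, ih, pow_succ', mul_assoc]

theorem xiPow_add_intCast_pow (hℓ : 3 ≤ ℓ) (x : ℂ) (n : ℤ) :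
    xiPow ℓ (x + n) ^ ℓ = xiPow ℓ (ℓ * x) := by
  have h : (xi ℓ ^ n) ^ ℓ = 1 := by
    rw [← zpow_natCast, ← zpow_mul, mul_comm, zpow_mul, zpow_natCast,
      (isPrimitiveRoot_xi hℓ).pow_eq_one, one_zpow]
  rw [xiPow_add, mul_pow, xiPow_natCast_mul, xiPow_intCast, h, mul_one]

theorem opK_pow (hℓ : 3 ≤ ℓ) (μ : Fin 2 → ℂ) (j : Fin 2) :
    opK ℓ μ j ^ ℓ = algebraMap ℂ (Module.End ℂ (Space ℓ)) (xiPow ℓ (ℓ * μ j)) := by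
  refine LinearMap.ext fun v => funext fun i => funext fun a => ?_
  obtain ⟨n, hn⟩ := exists_weight_eq (ℓ := ℓ) (μ := μ) j i a
  rw [opK_pow_apply, hn, xiPow_add_intCast_pow hℓ]
  rfl

/-- A sum of powers of `k j` that projects to the eigenspace of `ξ ^ c`. -/
noncomputable def weightSum (ℓ : ℕ) (c : ℂ) (j : Fin 2) : U ℓ :=
  ∑ s ∈ Finset.range ℓ, xiPow ℓ (-c) ^ s • U.gen ℓ (.k j) ^ s

theorem repU_weightSum (hℓ : 3 ≤ ℓ) (μ : Fin 2 → ℂ) (c : ℂ) (j : Fin 2) (v : Space ℓ) (i : Fin 4)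
    (a : Fin ℓ) : repU μ hℓ (weightSum ℓ c j) v i a =
      (∑ s ∈ Finset.range ℓ, xiPow ℓ (weight ℓ μ j i a - c) ^ s) * v i a := by
  have h (s : ℕ) : (xiPow ℓ (-c) ^ s • (opK ℓ μ j ^ s) v) i a =
      xiPow ℓ (weight ℓ μ j i a - c) ^ s * v i a := by
    rw [sub_eq_neg_add, xiPow_add, mul_pow, mul_assoc, ← opK_pow_apply]
    rfl
  simp only [weightSum, map_sum, map_smul, map_pow, repU_gen, op, LinearMap.sum_apply,
    LinearMap.smul_apply, Finset.sum_apply, h, Finset.sum_mul]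

/-- The highest weight vector. -/
def highest (hℓ : 3 ≤ ℓ) : Space ℓ := Pi.single 0 (Pi.single ⟨0, by omega⟩ 1)

/-- Modulo the images of the `f i`, the Kac module is spanned by its highest weight vector. As
`topMonomial` kills these images, it acts with rank at most one. -/
theorem exists_opF_eq (hℓ : 3 ≤ ℓ) (v : Space ℓ) : ∃ x y,
    v = v 0 ⟨0, by omega⟩ • highest hℓ + (opF ℓ 0 x + opF ℓ 1 y) := by
  refine ⟨![fun a => if h : (a : ℕ) + 1 < ℓ then v 0 ⟨a + 1, h⟩ else 0, v 2, 0, 0],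
    ![v 1 - xi ℓ • F ℓ (v 2), 0, v 3, 0], ?_⟩
  funext i
  fin_cases i
  · funext a
    by_cases ha : (a : ℕ) = 0
    · have h1 : a = ⟨0, by omega⟩ := Fin.ext ha
      simp [opF, block_apply, highest, F, h1]
    · have h1 : a ≠ ⟨0, by omega⟩ := fun h => ha (congrArg Fin.val h)
      have h2 : 0 < (a : ℕ) := Nat.pos_of_ne_zero ha
      have h3 : (a : ℕ) - 1 + 1 = a := by omega
      simp [opF, block_apply, highest, F, h1, h2, h3]
  · simp [opF, block_apply, highest]
  · simp [opF, block_apply, highest]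
  · simp [opF, block_apply, highest]

theorem topF_apply (hℓ : 3 ≤ ℓ) (hodd : Odd ℓ) (v : Space ℓ) :
    topMonomial ℓ (xi ℓ) (opF ℓ) v =
      v 0 ⟨0, by omega⟩ • topMonomial ℓ (xi ℓ) (opF ℓ) (highest hℓ) := by
  -- The operators `opF` do not depend on the highest weight, so the relations may be read off from
  -- the Kac module of weight `0`.
  have hB : IsBorel ℓ (xi ℓ) (opF ℓ) := by
    have := (isNilpotentWeight_kac (μ := 0) hℓ hodd).isBorel_f hℓ hodd
    rwa [show (kac 0 hℓ).f = opF ℓ from funext fun i => kac_f _ _] at this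
  obtain ⟨x, y, h⟩ := exists_opF_eq hℓ v
  conv_lhs => rw [h]
  rw [map_add, map_add, map_smul, ← Module.End.mul_apply, ← Module.End.mul_apply,
    hB.topMonomial_mul_even (by omega), hB.topMonomial_mul_odd]
  simp

/-- An element of `U_ξ sl(2|1)` that acts by operators of rank at most one on Kac modules. -/
noncomputable def rankOne (ℓ : ℕ) (c : Fin 2 → ℂ) : U ℓ :=
  topMonomial ℓ (xi ℓ) (fun i => U.gen ℓ (.e i)) *
    (topMonomial ℓ (xi ℓ) (fun i => U.gen ℓ (.f i)) * (weightSum ℓ (c 0) 0 * weightSum ℓ (c 1) 1))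

/-- After `F` only the highest weight coordinate of a vector matters, and there each `weightSum`
acts by a geometric sum evaluated at `μ j - c j`. -/
theorem repU_rankOne (hℓ : 3 ≤ ℓ) (hodd : Odd ℓ) (μ c : Fin 2 → ℂ) (v : Space ℓ) :
    repU μ hℓ (rankOne ℓ c) v =
      ((∏ j, ∑ s ∈ Finset.range ℓ, xiPow ℓ (μ j - c j) ^ s) * v 0 ⟨0, by omega⟩) •
        (kac μ hℓ).topE ((kac μ hℓ).topF (highest hℓ)) := by
  have hw (j : Fin 2) : weight ℓ μ j 0 ⟨0, by omega⟩ = μ j := by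
    fin_cases j <;> simp [weight, evenWeight]
  have hE : (kac μ hℓ).topE = topMonomial ℓ (xi ℓ) (opE ℓ μ) := by
    rw [UHModule.topE, show (kac μ hℓ).e = opE ℓ μ from funext fun i => kac_e _ _]
  have hF : (kac μ hℓ).topF = topMonomial ℓ (xi ℓ) (opF ℓ) := by
    rw [UHModule.topF, show (kac μ hℓ).f = opF ℓ from funext fun i => kac_f _ _]
  rw [hE, hF, rankOne, map_mul, map_mul, map_mul, map_topMonomial, map_topMonomial]
  simp only [repU_gen, op, Module.End.mul_apply]
  rw [topF_apply hℓ hodd, repU_weightSum, repU_weightSum, hw, hw, map_smul, Fin.prod_univ_two,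
    mul_assoc]

theorem isHighestWeightVector_highest (hℓ : 3 ≤ ℓ) (μ : Fin 2 → ℂ) :
    (kac μ hℓ).IsHighestWeightVector μ 1 (highest hℓ) where
  h j := by
    rw [kac_h]
    funext i a
    rw [opH_apply]
    by_cases h : i = 0
    · subst h
      by_cases ha : a = ⟨0, by omega⟩
      · subst ha
        fin_cases j <;> simp [weight, evenWeight]
      · simp [highest, ha]
    · simp [highest, h]
  sigma := by
    rw [kac_sigma, one_smul]
    funext i
    fin_cases i <;> simp [opSigma, block_apply, highest]
  e j := by
    rw [kac_e]
    funext i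
    change _ = (0 : Fin ℓ → ℂ)
    fin_cases j <;> fin_cases i <;> simp [opE, block_apply, highest]
    funext a
    simp [E]

theorem highest_ne_zero (hℓ : 3 ≤ ℓ) : highest hℓ ≠ 0 := fun h => by
  have := congrFun (congrFun h 0) ⟨0, by omega⟩
  simp [highest] at this

/-- The translates of a weight that represent the characters of the finite torus. -/
def shift (μ : Fin 2 → ℂ) (n : Fin 2 → Fin ℓ) (j : Fin 2) : ℂ := μ j + (n j : ℕ)

theorem toG_shift (μ : Fin 2 → ℂ) (n : Fin 2 → Fin ℓ) : toG (shift μ n) = toG μ :=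
  toG_eq_toG fun j => ⟨(n j : ℕ), by simp [shift]⟩

/-- Orthogonality of the characters of `ℤ/ℓ`; it separates the `ℓ²` shifted Kac modules. -/
theorem sum_xiPow_pow (hℓ : 3 ≤ ℓ) (x : ℂ) (a b : Fin ℓ) :
    ∑ s ∈ Finset.range ℓ, xiPow ℓ (x + (a : ℕ) - (x + (b : ℕ))) ^ s = if a = b then (ℓ : ℂ) else 0 := by
  have hx : x + (a : ℕ) - (x + (b : ℕ)) = (((a : ℕ) - (b : ℕ) : ℤ) : ℂ) := by push_cast; ring
  rw [hx, xiPow_intCast]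
  split_ifs with h
  · simp [h]
  · have hξ := isPrimitiveRoot_xi hℓ
    have h1 : xi ℓ ^ ((a : ℕ) - (b : ℕ) : ℤ) - 1 ≠ 0 := by
      rw [sub_ne_zero, Ne, hξ.zpow_eq_one_iff_dvd]
      rintro h'
      have := Int.eq_zero_of_abs_lt_dvd h' (by rw [abs_lt]; omega)
      exact h (Fin.ext (by omega))
    refine (mul_eq_zero.1 ?_).resolve_left h1
    rw [mul_geom_sum, ← zpow_natCast, ← zpow_mul, mul_comm, zpow_mul, zpow_natCast, hξ.pow_eq_one,
      one_zpow, sub_self]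

/-- Typical modules are irreducible only among graded submodules, whereas the Burnside argument
needs all submodules. The gap closes because the torus already determines the parity
(`opSigma_mem`). -/
theorem repU_irreducible (hℓ : 3 ≤ ℓ) {μ : Fin 2 → ℂ} (hT : (kac μ hℓ).IsTypical)
    (N : Submodule ℂ (Space ℓ)) (hN : ∀ a, ∀ v ∈ N, repU μ hℓ a v ∈ N) : N = ⊥ ∨ N = ⊤ := by
  refine ((SuperModule.isIrreducible_iff _).1 hT.1).2 N hN fun v hv => ?_
  have h : (kac μ hℓ).restrict.sigma = opSigma ℓ := kac_sigma (μ := μ) hℓ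
  rw [h]
  refine opSigma_mem (μ := μ) hℓ (fun i v hv => ?_) hv
  have := hN (U.gen ℓ (.k i)) v hv
  rwa [repU_gen] at this

/-- The product of the representations on the Kac modules with highest weight in a coset. -/
noncomputable def repPi (μ : Fin 2 → ℂ) (hℓ : 3 ≤ ℓ) :
    U ℓ →ₐ[ℂ] ((Fin 2 → Fin ℓ) → Module.End ℂ (Space ℓ)) :=
  AlgHom.pi fun n => repU (shift μ n) hℓ

theorem repPi_surjective (hℓ : 3 ≤ ℓ) (hodd : Odd ℓ) {μ : Fin 2 → ℂ}
    (hT : ∀ n : Fin 2 → Fin ℓ, (kac (shift μ n) hℓ).IsTypical) :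
    Function.Surjective (repPi μ hℓ) := by
  let D : Submodule ℂ ((Fin 2 → Fin ℓ) → Module.End ℂ (Space ℓ)) :=
    LinearMap.range (repPi μ hℓ).toLinearMap
  -- The operators that, placed in the factor `n` with zeros elsewhere, lie in the image form a
  -- two-sided ideal. `rankOne ℓ (shift μ n)` puts a rank one operator into it, with nonzero vector
  -- `E F highest` and functional `ℓ²` times the highest weight coordinate.
  have key (n : Fin 2 → Fin ℓ) : D.comap (LinearMap.single ℂ _ n) = ⊤ := by
    let ψ : Space ℓ →ₗ[ℂ] ℂ :=
      (LinearMap.proj (R := ℂ) (φ := fun _ : Fin ℓ => ℂ) ⟨0, by omega⟩).comp (pr ℓ 0)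
    refine eq_top_of_smulRight_mem (repU (shift μ n) hℓ) (repU_irreducible hℓ (hT n)) _ ?_ ?_
      (ψ := ((ℓ : ℂ) * ℓ) • ψ) ?_ ((hT n).topE_topF_ne_zero hℓ hodd
        (isNilpotentWeight_kac hℓ hodd) (isHighestWeightVector_highest hℓ _) (highest_ne_zero hℓ)) ?_
    · rintro a φ ⟨b, hb⟩
      refine ⟨a * b, ?_⟩
      change repPi μ hℓ (a * b) = _
      have hb : repPi μ hℓ b = Pi.single n φ := hb
      rw [map_mul, hb]
      refine funext fun m => ?_
      by_cases h : m = n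
      · subst h
        simp [repPi]
      · simp [h]
    · rintro a φ ⟨b, hb⟩
      refine ⟨b * a, ?_⟩
      change repPi μ hℓ (b * a) = _
      have hb : repPi μ hℓ b = Pi.single n φ := hb
      rw [map_mul, hb]
      refine funext fun m => ?_
      by_cases h : m = n
      · subst h
        simp [repPi]
      · simp [h]
    · intro h
      have := LinearMap.congr_fun h (highest hℓ)
      simp [ψ, highest] at this
      omega
    · refine ⟨rankOne ℓ (shift μ n), funext fun m => LinearMap.ext fun v => ?_⟩
      change repU (shift μ m) hℓ (rankOne ℓ (shift μ n)) v = _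
      rw [repU_rankOne hℓ hodd]
      simp only [shift, sum_xiPow_pow hℓ, Fin.prod_univ_two]
      by_cases h : m = n
      · subst h
        simp [ψ]
      · rw [LinearMap.single_apply, Pi.single_eq_of_ne h]
        have : ¬ (m 0 = n 0 ∧ m 1 = n 1) := fun h' => h (funext fun j => by
          fin_cases j
          exacts [h'.1, h'.2])
        rcases not_and_or.1 this with h | h <;> simp [h]
  intro x
  have hx : x ∈ D := by
    rw [← Finset.univ_sum_single x]
    exact sum_mem fun n _ => (key n ▸ Submodule.mem_top : x n ∈ D.comap (LinearMap.single ℂ _ n))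
  exact hx

theorem repPi_rel (hℓ : 3 ≤ ℓ) (hodd : Odd ℓ) (μ : Fin 2 → ℂ) ⦃a b : U ℓ⦄ (r : RelA ℓ μ a b) :
    repPi μ hℓ a = repPi μ hℓ b := by
  refine funext fun n => ?_
  change repU (shift μ n) hℓ a = repU (shift μ n) hℓ b
  cases r with
  | e_pow => rw [map_pow, map_zero, repU_gen]; exact opE_pow hℓ hodd
  | f_pow => rw [map_pow, map_zero, repU_gen]; exact opF_pow hℓ hodd
  | k_pow i =>
    rw [map_pow, AlgHom.commutes, repU_gen]
    refine (opK_pow hℓ _ i).trans ?_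
    congr 1
    have := xiPow_add_intCast_pow hℓ (μ i) (n i : ℕ)
    rw [← this, shift, xiPow_natCast_mul]
    simp

end Kac

theorem bijective_of_surjective_of_finrank_le {R S : Type} [Ring R] [Algebra ℂ R] [Ring S]
    [Algebra ℂ S] [FiniteDimensional ℂ R] [FiniteDimensional ℂ S] (Φ : R →ₐ[ℂ] S)
    (hΦ : Function.Surjective Φ) (h : Module.finrank ℂ R ≤ Module.finrank ℂ S) :
    Function.Bijective Φ :=
  ⟨(LinearMap.injective_iff_surjective_of_finrank_eq_finrank (f := Φ.toLinearMap)
    (h.antisymm (LinearMap.finrank_le_finrank_of_surjective (f := Φ.toLinearMap) hΦ))).2 hΦ, hΦ⟩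

/-- The structure of the algebra `𝒜` for a typical coset. -/
theorem nonempty_algEquiv {ℓ : ℕ} (hℓ : 3 ≤ ℓ) (hodd : Odd ℓ) (μ : Fin 2 → ℂ)
    (hT : ∀ V : CHPiece ℓ (toG μ), V.obj.IsIrreducible → V.obj.IsTypical) :
    Nonempty (A ℓ μ ≃ₐ[ℂ] (Fin (ℓ ^ 2) → Matrix (Fin (4 * ℓ)) (Fin (4 * ℓ)) ℂ)) := by
  let Φ : A ℓ μ →ₐ[ℂ] ((Fin 2 → Fin ℓ) → Module.End ℂ (Kac.Space ℓ)) :=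
    RingQuot.liftAlgHom ℂ ⟨Kac.repPi μ hℓ, Kac.repPi_rel hℓ hodd μ⟩
  let π : U ℓ →ₐ[ℂ] A ℓ μ := RingQuot.mkAlgHom ℂ (RelA ℓ μ)
  have hsurj : Function.Surjective Φ := fun x => by
    obtain ⟨a, rfl⟩ := Kac.repPi_surjective hℓ hodd (μ := μ)
      (fun n => Kac.isTypical_kac hℓ hodd (by rw [Kac.toG_shift]; exact hT)) x
    exact ⟨π a, RingQuot.liftAlgHom_mkAlgHom_apply ℂ _ _ _⟩
  obtain ⟨hfin, hle⟩ := finite_and_finrank_le (R := A ℓ μ) (C := fun i => xiPow ℓ (ℓ * μ i)) hℓ hodd π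
    (RingQuot.mkAlgHom_surjective ℂ _)
    (by simpa using RingQuot.mkAlgHom_rel ℂ (RelA.e_pow (ℓ := ℓ) (μ := μ)))
    (by simpa using RingQuot.mkAlgHom_rel ℂ (RelA.f_pow (ℓ := ℓ) (μ := μ)))
    (fun i => xiPow_ne_zero _)
    (fun i => by
      rw [← map_pow, ← AlgHom.commutes π]
      exact RingQuot.mkAlgHom_rel ℂ (RelA.k_pow (ℓ := ℓ) (μ := μ) i))
  have hrank : Module.finrank ℂ (Kac.Space ℓ) = 4 * ℓ := by
    simp [Module.finrank_pi_fintype]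
  have hdim : Module.finrank ℂ ((Fin 2 → Fin ℓ) → Module.End ℂ (Kac.Space ℓ)) =
      ℓ ^ 2 * (4 * ℓ * (4 * ℓ)) := by
    rw [Module.finrank_pi_fintype]
    simp only [Module.End, Module.finrank_linearMap, hrank]
    simp
  -- The upper bound from the triangular decomposition equals the dimension of the target, so
  -- surjectivity suffices.
  have hbij : Function.Bijective Φ :=
    bijective_of_surjective_of_finrank_le (R := A ℓ μ) Φ hsurj (hle.trans hdim.ge)
  let b : Module.Basis (Fin (4 * ℓ)) ℂ (Kac.Space ℓ) := Module.finBasisOfFinrankEq ℂ _ hrank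
  let ε : (Fin 2 → Fin ℓ) ≃ Fin (ℓ ^ 2) := Fintype.equivFinOfCardEq (by simp)
  exact ⟨((AlgEquiv.ofBijective Φ hbij).trans
    (AlgEquiv.piCongrRight fun _ => algEquivMatrix b)).trans
    (AlgEquiv.piCongrLeft ℂ (fun _ => Matrix (Fin (4 * ℓ)) (Fin (4 * ℓ)) ℂ) ε)⟩

end QuantumSl21

theorem mainTheorem8 (ℓ : ℕ) (hℓ : 3 ≤ ℓ) (hodd : Odd ℓ) :
    (∀ μ : Fin 2 → ℂ, QuantumSl21.toG μ ∉ QuantumSl21.Gs ℓ →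
      QuantumSl21.IsSemisimpleCategory (QuantumSl21.CHPiece ℓ (QuantumSl21.toG μ)) ∧
      (∀ V : QuantumSl21.CHPiece ℓ (QuantumSl21.toG μ),
        QuantumSl21.IsSimpleObject V ↔ V.obj.IsIrreducible) ∧
      Nonempty (QuantumSl21.A ℓ μ ≃ₐ[ℂ]
        (Fin (ℓ ^ 2) → Matrix (Fin (4 * ℓ)) (Fin (4 * ℓ)) ℂ))) ∧
    (∀ V : QuantumSl21.CH ℓ, V.obj.IsTypical → CategoryTheory.Projective V) := by
  refine ⟨fun μ hμ => ?_, fun V hV => QuantumSl21.projective_of_isTypical hℓ hodd V hV⟩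
  have hT (V : QuantumSl21.CHPiece ℓ (QuantumSl21.toG μ)) (hV : V.obj.IsIrreducible) :
      V.obj.IsTypical := by
    by_contra h
    exact hμ ⟨V, hV, h⟩
  exact ⟨QuantumSl21.CHPiece.isSemisimpleCategory hℓ hodd hT,
    fun V => ⟨QuantumSl21.CHPiece.isIrreducible_of_isSimpleObject hℓ hodd hT V,
      QuantumSl21.CHPiece.isSimpleObject V⟩,
    QuantumSl21.nonempty_algEquiv hℓ hodd μ hT⟩
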